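/- Let $k\in\{3,4\}$, let $M=2^{2k-1}-2^k+1$, and let $\varepsilon>0$ satisfy $2M\varepsilon<1$. **Setting.** For a set $G$ of $k$-subsets of $[n]$ (a $k$-uniform hypergraph), let $K_{k-1}(G)$ be the set of all $(k-1)$-sets (facets) contained in edges of $G$; two hypergraphs are facet-disjoint if their sets of facets are disjoint. A partial design is a set of $k$-subsets of $[n]$ any two distinct members of which share fewer than $k-1$ vertices. A $K_k$-decomposition of a set $L$ of $(k-1)$-sets is a set $S$ of $k$-sets, all of whose facets are in $L$, such that each element of $L$ is contained in exactly one member of $S$. Let $2n\le 2^m\le 4n$, let $\mathbb F$ be the field with $2^m$ elements, let $\pi:[n]\to\mathbb F\setminus\{0\}$ be injective and let $H$ be a $k$-uniform hypergraph on $[n]$. The template is $T=\{x\in H:\sum_{v\in x}\pi(v)=0\}$. **Absorbers.** For distinct vertices $x_1,\dots,x_k,a_1,\dots,a_k$ and $I\subseteq[k]$ put $e_I(x,a)=\{x_i:i\notin I\}\cup\{a_i:i\in I\}$; the cross-polytope $C_{x,a}$ is $\{e_I(x,a):I\subseteq[k]\}$. If $x=\{x_1,\dots,x_k\}\notin T$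 and there are vertices $a_i$ such that replacing $x_i$ by $a_i$ in $x$ gives an edge of $T$, for each $i$, then these $a_i$ are unique and $C_x=C_{x,a}$ is called the cross-polytope associated with $x$, the $a_i$ its algebraic vertices. Let $\mathcal C$ be the set of those $x$ for which $C_x$ exists and all its edges $e_I$ with $|I|$ even and $I\ne\emptyset$ are in $H$. For a $k$-set $x=\{x_1,\dots,x_k\}\subseteq[n]$, the vertices $a_1,\dots,a_k$ span an absorber for $x$ if $e_I(x,a)\in H$ for $|I|$ odd, $e_I(x,a)\in\mathcal C$ for $|I|$ even and $I\neq\emptyset$, and the $x_i$, the $a_i$ and the algebraic vertices of all these $C_{e_I}$ are all distinct. The absorber is then the hypergraph consisting of the edges $e_I(x,a)$, $|I|$ odd, and of $C_{e_I}\setminus\{e_I\}$ for all nonempty $I$ of even size; it has $M$ edges. Let $\mathcal A_x$ be the set of absorbers for $x$. **Many absorbers.** For $c>0$ let $\mathcal M_c$ be the property of $(\pi,H)$ that $|\mathcal A_x|\ge c\,n^{k-M\varepsilon}$ for every $k$-set $x\subseteq[n]$. **The leave.** Let $N\subseteq H$ be a partial design that is facet-disjoint from $T$, and let $L$ be the set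 of all $(k-1)$-subsets of $[n]$ not in $K_{k-1}(T\cup N)$. Let $\pi(L)\subseteq\mathbb F^{k-1}$ be the set of all vectors $(\pi(y_1),\dots,\pi(y_{k-1}))$ with $\{y_1,\dots,y_{k-1}\}\in L$. We say that $L$ is $C$-affine-bounded if $|A\cap\pi(L)|\le C|A|\,|\pi(L)|/|\mathbb F|^{k-1}$ for every affine subspace $A\subseteq\mathbb F^{k-1}$ of dimension at least $1$. **The random greedy algorithm.** Let $S$ be a $K_k$-decomposition of $L$, with its edges ordered arbitrarily as $s_1,\dots,s_{|S|}$. For $i=1,\dots,|S|$ in turn, call an absorber in $\mathcal A_{s_i}$ permissible if it is facet-disjoint from $A_1,\dots,A_{i-1}$ and from $S\setminus\{s_i\}$, and choose $A_i$ uniformly at random from the permissible absorbers in $\mathcal A_{s_i}$; abort if there are none. **Claim.** 1. There is $c>0$ such that for every real $D$ the following holds for all sufficiently large $n$ and all $m$ with $2n\le 2^m\le 4n$: if $\pi$ is a uniformly random injection and, independently, $H$ contains each $k$-subset of $[n]$ independently with probability $n^{-\varepsilon}$, then $\mathcal M_c$ fails with probability at most $n^{-D}$. 2. For all $C,\delta,c>0$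 with $2M\varepsilon<\delta$ and every real $D$, the following holds for all sufficiently large $n$, all $m$ with $2n\le 2^m\le 4n$, all $\pi$ and $H$ satisfying $\mathcal M_c$, all $N$ as above for which $L$ is $C$-affine-bounded and $|L|\le n^{-\delta}\binom{n}{k-1}$, all $K_k$-decompositions $S$ of $L$, and all orderings of $S$: with probability at least $1-n^{-D}$ over its random choices, the random greedy algorithm does not abort, and at each step $i$ at least $\frac12|\mathcal A_{s_i}|$ of the absorbers in $\mathcal A_{s_i}$ are permissible. -/

import Mathlib

open Finset Filter

namespace RandomSteiner

/-- A finite hypergraph on the vertex set `{0, …, n - 1}`, identified with its set of edges. -/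
abbrev Hypergraph (n : ℕ) : Type := Finset (Finset (Fin n))

/-- The complete `k`-uniform hypergraph on `n` vertices. -/
def complete (n k : ℕ) : Hypergraph n := (univ : Finset (Fin n)).powersetCard k

/-- The set of facets, i.e. of `(k - 1)`-sets contained in some edge of the `k`-uniform `G`. -/
def facets {n : ℕ} (k : ℕ) (G : Hypergraph n) : Hypergraph n :=
  G.biUnion fun e => e.powersetCard (k - 1)

/-- Two `k`-uniform hypergraphs are facet-disjoint if no facet is covered by both. -/
def FacetDisjoint {n : ℕ} (k : ℕ) (A B : Hypergraph n) : Prop :=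
  Disjoint (facets k A) (facets k B)

/-- A partial design: a set of `k`-sets, no two of which share a facet. -/
def IsPartialDesign {n : ℕ} (k : ℕ) (S : Hypergraph n) : Prop :=
  S ⊆ complete n k ∧ ∀ x ∈ S, ∀ y ∈ S, x ≠ y → #(x ∩ y) < k - 1

/-- `S` is a `K_k`-decomposition of the `(k - 1)`-uniform hypergraph `G`: every edge of `S` is a
`k`-set all of whose facets belong to `G`, and every element of `G` lies in exactly one edge
of `S`. -/
def IsDecomposition {n : ℕ} (k : ℕ) (S G : Hypergraph n) : Prop :=
  (∀ e ∈ S, #e = k ∧ e.powersetCard (k - 1) ⊆ G) ∧ ∀ f ∈ G, ∃! e, e ∈ S ∧ f ⊆ e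

/-- The density of a `d`-uniform hypergraph. -/
noncomputable def density {n : ℕ} (d : ℕ) (G : Hypergraph n) : ℝ :=
  (#G : ℝ) / (n.choose d : ℝ)

section Template

variable {n k : ℕ} {F : Type} [Field F]

open Classical in
/-- The template: the edges of `H` whose vertices have sum zero under the injection `π` of the
vertex set into the nonzero elements of `F`. Its elements are the algebraic edges. -/
noncomputable def template (π : Fin n ↪ Fˣ) (H : Hypergraph n) : Hypergraph n :=
  H.filter fun x => ∑ v ∈ x, (π v : F) = 0

/-- The edge `e_I` of the cross-polytope spanned by the tuples `x` and `a`, as a tuple: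
the `i`-th entry is `a i` if `i ∈ I` and `x i` otherwise. -/
def crossTuple (x a : Fin k → Fin n) (I : Finset (Fin k)) : Fin k → Fin n :=
  fun i => if i ∈ I then a i else x i

/-- The edge `e_I` of the cross-polytope spanned by the tuples `x` and `a`, as a set. -/
def crossEdge (x a : Fin k → Fin n) (I : Finset (Fin k)) : Finset (Fin n) :=
  univ.image (crossTuple x a I)

/-- The edge with (distinct) vertices `y 0, …, y (k - 1)` is non-algebraic, each of its facets is
algebraic, `b 0, …, b (k - 1)` are the algebraic vertices of the associated cross-polytope (so
replacing `y i` by `b i` always gives an algebraic edge), and all even edges of the associated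
cross-polytope except for `y` itself belong to `H`. -/
structure HasAssociated (π : Fin n ↪ Fˣ) (H : Hypergraph n) (y b : Fin k → Fin n) : Prop where
  nonalgebraic : univ.image y ∉ template π H
  algebraic : ∀ i : Fin k, crossEdge y b {i} ∈ template π H
  even_mem : ∀ J : Finset (Fin k), J.Nonempty → Even (#J) → crossEdge y b J ∈ H

/-- The vertices of the absorber spanned by `x` and `a`, listed with all their labels: the entries
of `x`, those of `a`, and the algebraic vertices `b I 0, …, b I (k - 1)` of the cross-polytopes
associated with the edges `e_I`, where `I` is nonempty and even. -/
def absorberVertex (x a : Fin k → Fin n) (b : Finset (Fin k) → Fin k → Fin n) :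
    (Fin k ⊕ Fin k) ⊕ ({I : Finset (Fin k) // I.Nonempty ∧ Even (#I)} × Fin k) → Fin n :=
  Sum.elim (Sum.elim x a) fun q => b q.1.1 q.2

/-- The tuple `a` spans an absorber for the edge with vertices `x 0, …, x (k - 1)`; here `b I i` is
the `i`-th algebraic vertex of the cross-polytope associated with the even edge `e_I`. -/
structure SpansAbsorber (π : Fin n ↪ Fˣ) (H : Hypergraph n) (x a : Fin k → Fin n)
    (b : Finset (Fin k) → Fin k → Fin n) : Prop where
  odd_mem : ∀ I : Finset (Fin k), Odd (#I) → crossEdge x a I ∈ H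
  associated : ∀ I : Finset (Fin k), I.Nonempty → Even (#I) →
    HasAssociated π H (crossTuple x a I) (b I)
  distinct : Function.Injective (absorberVertex x a b)

/-- The absorber itself: the odd edges of the cross-polytope spanned by `x` and `a`, together with,
for every nonempty even `I`, all edges except `e_I` of the cross-polytope associated with `e_I`. -/
def absorberGraph (x a : Fin k → Fin n) (b : Finset (Fin k) → Fin k → Fin n) : Hypergraph n :=
  ((univ : Finset (Finset (Fin k))).filter fun I => Odd (#I)).image (crossEdge x a) ∪
    ((univ : Finset (Finset (Fin k))).filter fun I => I.Nonempty ∧ Even (#I)).biUnion fun I =>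
      ((univ : Finset (Finset (Fin k))).filter fun J => J.Nonempty).image
        (crossEdge (crossTuple x a I) (b I))

open Classical in
/-- The set of all absorbers for the edge `x`. -/
noncomputable def absorbers (k : ℕ) (π : Fin n ↪ Fˣ) (H : Hypergraph n) (x : Finset (Fin n)) :
    Finset (Hypergraph n) :=
  univ.filter fun A => ∃ (y a : Fin k → Fin n) (b : Finset (Fin k) → Fin k → Fin n),
    univ.image y = x ∧ SpansAbsorber π H y a b ∧ A = absorberGraph y a b

/-- The number of edges of an absorber, `2 ^ (2 k - 1) - 2 ^ k + 1`. -/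
def absorberSize (k : ℕ) : ℕ := 2 ^ (2 * k - 1) + 1 - 2 ^ k

/-- Every `k`-set of vertices has at least `c * n ^ (k - M ε)` absorbers, where `M` is the number of
edges of an absorber. -/
def ManyAbsorbers (k : ℕ) (c ε : ℝ) (π : Fin n ↪ Fˣ) (H : Hypergraph n) : Prop :=
  ∀ x ∈ complete n k,
    c * (n : ℝ) ^ ((k : ℝ) - (absorberSize k : ℝ) * ε) ≤ (#(absorbers k π H x) : ℝ)

/-- The leave of `T ∪ N`, where `T` is the template: the set of uncovered facets. -/
noncomputable def leave (k : ℕ) (π : Fin n ↪ Fˣ) (H N : Hypergraph n) : Hypergraph n :=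
  complete n (k - 1) \ facets k (template π H ∪ N)

/-- The image of a `d`-uniform hypergraph in `F ^ d`: all vectors (in every order of the
coordinates) that list the images of the vertices of an edge. -/
def vectorImage (d : ℕ) (π : Fin n ↪ Fˣ) (G : Hypergraph n) : Set (Fin d → F) :=
  {v | ∃ y : Fin d → Fin n, Function.Injective y ∧ univ.image y ∈ G ∧ v = fun i => (π (y i) : F)}

/-- A subset `S` of `F ^ d` is `C`-affine-bounded if every affine subspace `A` of dimension at least
`1` satisfies `|A ∩ S| ≤ C |A| |S| / |F| ^ d`. -/
def AffineBounded (d : ℕ) (C : ℝ) (S : Set (Fin d → F)) : Prop :=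
  ∀ A : AffineSubspace F (Fin d → F), 1 ≤ Module.finrank F A.direction →
    ((((A : Set (Fin d → F)) ∩ S).ncard : ℕ) : ℝ) ≤
      C * ((A : Set (Fin d → F)).ncard : ℝ) * ((S.ncard : ℝ) / (Nat.card F : ℝ) ^ d)

open Classical in
/-- The absorbers for `x` that are permissible after the absorbers in the list `hist` have been
chosen: those facet-disjoint from all elements of `hist` and from `S \ {x}`. -/
noncomputable def permissible (k : ℕ) (π : Fin n ↪ Fˣ) (H S : Hypergraph n)
    (hist : List (Hypergraph n)) (x : Finset (Fin n)) : Finset (Hypergraph n) :=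
  (absorbers k π H x).filter fun A =>
    (∀ B ∈ hist, FacetDisjoint k A B) ∧ FacetDisjoint k A (S.erase x)

open Classical in
/-- The random greedy algorithm, with the edges in the given list still to be treated and `hist` the
list of the absorbers chosen so far. For each edge in turn it chooses a permissible absorber
uniformly at random; it aborts (with outcome `none`) if there is none, and otherwise returns the
list of all chosen absorbers. -/
noncomputable def greedyAux (k : ℕ) (π : Fin n ↪ Fˣ) (H S : Hypergraph n) :
    List (Finset (Fin n)) → List (Hypergraph n) → PMF (Option (List (Hypergraph n)))
  | [], hist => PMF.pure (some hist)
  | x :: rest, hist =>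
    if h : (permissible k π H S hist x).Nonempty then
      (PMF.uniformOfFinset (permissible k π H S hist x) h).bind fun A =>
        greedyAux k π H S rest (hist ++ [A])
    else PMF.pure none

/-- The law of the outcome of the random greedy algorithm applied to the edges `s_1, s_2, …` of `S`,
given as a list without repetitions. -/
noncomputable def greedy (k : ℕ) (π : Fin n ↪ Fˣ) (H : Hypergraph n) (s : List (Finset (Fin n))) :
    PMF (Option (List (Hypergraph n))) :=
  greedyAux k π H s.toFinset s []

/-- The event that the algorithm does not abort and that, at each of its steps, at least half of the
absorbers for the current edge are permissible. -/
def greedySuccess (k : ℕ) (π : Fin n ↪ Fˣ) (H : Hypergraph n) (s : List (Finset (Fin n))) :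
    Set (Option (List (Hypergraph n))) :=
  {o | ∃ As : List (Hypergraph n), o = some As ∧ As.length = s.length ∧
    ∀ i : Fin s.length,
      #(absorbers k π H (s.get i)) ≤
        2 * #(permissible k π H s.toFinset (As.take i) (s.get i))}

open Classical in
/-- The probability of an event depending on an injection `π`, uniformly distributed among all
injections of the vertex set into the nonzero elements of `F`, and on a random hypergraph `H`
independent of `π` that contains each `k`-set independently with probability `p`. -/
noncomputable def probInjHyp (n k : ℕ) (F : Type) [Field F] [Finite F] (p : ℝ)
    (E : (Fin n ↪ Fˣ) → Hypergraph n → Prop) : ℝ :=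
  letI : Fintype (Fin n ↪ Fˣ) := Fintype.ofFinite _
  (∑ π : Fin n ↪ Fˣ, ∑ H ∈ (complete n k).powerset,
    if E π H then p ^ #H * (1 - p) ^ (#(complete n k) - #H) else 0) /
      (Fintype.card (Fin n ↪ Fˣ) : ℝ)

end Template

end RandomSteiner

/-!
Write `q` for the size of `F`, which lies between `2 n` and `4 n`, write `α` and `β` for the tuples
of the values under `π` of the vertices of an edge and of the spanning vertices of an absorber for
it, and `M` for the number of edges of an absorber. All vertices of the absorber have values that
are linear in `(α, β)`, so that counting absorbers amounts to counting tuples `β` subject to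
linear conditions.

**Many absorbers.** For `k ≤ 4` and characteristic two, the values of all vertices of the absorber
are distinct as polynomials in `β`, whatever the distinct nonzero values `α` are
(`alphaSupport_sum_ne`), so all but `O(q ^ (k - 1))` tuples `β` are generic. The values of `π` form
a set of positive density, so on average a positive proportion of the tuples is *good*, that is,
generic and with all values taken by `π`. A transposition of two values affects `O(q ^ (k - 1))`
tuples, and bounded differences for random permutations (`card_perm_lt_half_le`) show that, outside
an event of probability `exp (-Ω(n))`, there are `Ω(n ^ k)` good tuples for all `α`. For such a `π`,
the expected number of good tuples whose candidate absorber is contained in the random hypergraph is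
`Ω(n ^ (k - M ε))`, while a single edge affects `O(n ^ (k - 1))` of them, so that the sum of the
squares of these effects is `O(n ^ (2 k - 1))`. As `2 M ε < 1`, bounded differences
(`bernoulliSum_lt_half_le`) and a union bound finish the proof.

**The random greedy algorithm.** Let `x` be an edge of the decomposition. A facet of an absorber for
`x` that is not contained in `x` is a nonconstant affine function of `β`. As `L` is affine-bounded,
such a facet lies in `L` for only `O(n ^ (k - δ))` tuples `β`
(`card_absorbers_not_facetDisjoint_le`), so few absorbers are lost through other edges. Conversely,
the absorbers for all edges of the decomposition together contain a given facet outside `L` at most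
`O(n ^ (k - δ))` times (`sum_card_absorbers_mem_facets_le`): an edge is determined by any of its
facets, one vertex of the edge does not influence the facet of the absorber, and the pairs of a
facet of the edge and of a tuple `β` that give the facet of the absorber form an affine space that
is not constant in the facet of the edge. As long as half of the absorbers are permissible, each
absorber is chosen with probability `O(n ^ (M ε - k))`, so the expected proportion of the absorbers
for `x` that conflict with those chosen before is `O(n ^ (M ε - δ))`, whereas a single choice
conflicts with a proportion of `O(n ^ (M ε - 1))`. An exponential moment computed along the
algorithm (`greedyAux_failure_le`) then bounds the failure probability by
`n ^ k * exp (-Ω(n ^ (1 - M ε)))`.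
-/

namespace RandomSteiner

/-! ### Counting solutions of linear equations over a finite field -/

section LinearCounting

open scoped Classical

variable {F : Type} [Field F]

lemma card_fiber_mul_le [Fintype F] {V W : Type*} [AddCommGroup V] [Module F V] [Fintype V]
    [AddCommGroup W] [Module F W] (φ : V →ₗ[F] W) (hφ : φ ≠ 0) (w : W) :
    #{v | φ v = w} * Fintype.card F ≤ Fintype.card V := by
  obtain ⟨v₀, hv₀⟩ : ∃ v, φ v ≠ 0 := by
    by_contra! h
    exact hφ (LinearMap.ext h)
  rw [← Finset.card_univ, ← Finset.card_univ, ← card_product]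
  refine card_le_card_of_injOn (fun p => p.1 + p.2 • v₀) (fun _ _ => by simp) ?_
  rintro ⟨v, t⟩ hv ⟨v', t'⟩ hv' h
  simp only [coe_product, Set.mem_prod, mem_coe, mem_filter, Finset.mem_univ, true_and,
    and_true] at hv hv' h
  have ht : t = t' := by
    have := congrArg φ h
    simp only [map_add, map_smul, hv, hv', add_right_inj] at this
    exact smul_left_injective F hv₀ this
  subst ht
  simpa using h

lemma card_fiber_eq_card_ker {V W : Type*} [AddCommGroup V] [Module F V] [Fintype V]
    [AddCommGroup W] [Module F W] (φ : V →ₗ[F] W) (v₀ : V) :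
    #{v | φ v = φ v₀} = Nat.card (LinearMap.ker φ) := by
  rw [Nat.card_eq_fintype_card, Fintype.card_subtype]
  refine card_nbij' (fun v => v - v₀) (fun v => v + v₀) ?_ ?_ ?_ ?_ <;> intro v hv <;>
    simp_all

lemma card_ker_mul_card_range {V W : Type*} [AddCommGroup V] [Module F V] [Fintype V]
    [AddCommGroup W] [Module F W] (φ : V →ₗ[F] W) :
    Nat.card (LinearMap.ker φ) * Nat.card (LinearMap.range φ) = Fintype.card V := by
  rw [← Nat.card_eq_fintype_card, Submodule.card_eq_card_quotient_mul_card (LinearMap.ker φ),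
    Nat.card_congr φ.quotKerEquivRange.toEquiv]

/-- A nonconstant affine map to `F ^ d` hits an affine-bounded set about as often as a uniformly
random vector does: its image is an affine subspace of positive dimension, all of whose points have
equally many preimages. -/
lemma AffineBounded.card_preimage_le [Fintype F] {d : ℕ} {C : ℝ} {S : Set (Fin d → F)}
    (hS : AffineBounded d C S) {V : Type*} [AddCommGroup V] [Module F V] [Fintype V]
    (φ : V →ₗ[F] (Fin d → F)) (hφ : φ ≠ 0) (w : Fin d → F) :
    (#{v | w + φ v ∈ S} : ℝ) ≤
      C * Fintype.card V * ((S.ncard : ℝ) / (Fintype.card F : ℝ) ^ d) := by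
  set A : AffineSubspace F (Fin d → F) := AffineSubspace.mk' w (LinearMap.range φ) with hA
  have hdir : 1 ≤ Module.finrank F A.direction := by
    rw [hA, AffineSubspace.direction_mk']
    rw [Nat.one_le_iff_ne_zero]
    intro h
    rw [Submodule.finrank_eq_zero] at h
    exact hφ (LinearMap.range_eq_bot.1 h)
  have hcoe : (A : Set (Fin d → F)) =
      (fun u => w + u) '' (LinearMap.range φ : Set (Fin d → F)) := by
    ext u
    simp only [hA, SetLike.mem_coe, AffineSubspace.mem_mk', vsub_eq_sub, Set.mem_image]
    constructor
    · intro h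
      exact ⟨u - w, h, by abel⟩
    · rintro ⟨u', h, rfl⟩
      simpa using h
  have hcard : (A : Set (Fin d → F)).ncard = Nat.card (LinearMap.range φ) := by
    rw [hcoe, Set.ncard_image_of_injective _ (add_right_injective w)]
    rfl
  have h1 := hS A hdir
  rw [hcard] at h1
  have hfin : ((A : Set (Fin d → F)) ∩ S).Finite := Set.toFinite _
  have h2 : #{v | w + φ v ∈ S} ≤
      Nat.card (LinearMap.ker φ) * ((A : Set (Fin d → F)) ∩ S).ncard := by
    rw [Set.ncard_eq_toFinset_card _ hfin]
    refine card_le_mul_card_image_of_maps_to (f := fun v => w + φ v) ?_ _ ?_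
    · intro v hv
      simp only [mem_filter, Finset.mem_univ, true_and] at hv
      simp only [Set.Finite.mem_toFinset, Set.mem_inter_iff, hv, and_true, hcoe]
      exact ⟨φ v, ⟨v, rfl⟩, rfl⟩
    · intro u hu
      simp only [Set.Finite.mem_toFinset, Set.mem_inter_iff, hcoe] at hu
      obtain ⟨⟨_, ⟨v₀, rfl⟩, rfl⟩, -⟩ := hu
      rw [← card_fiber_eq_card_ker φ v₀]
      refine card_le_card fun v hv => ?_
      simpa using (mem_filter.1 hv).2
  have h3 := card_ker_mul_card_range φ
  calc (#{v | w + φ v ∈ S} : ℝ)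
      ≤ (Nat.card (LinearMap.ker φ) : ℝ) * ((A : Set (Fin d → F)) ∩ S).ncard := by
        exact_mod_cast h2
    _ ≤ (Nat.card (LinearMap.ker φ) : ℝ) *
        (C * (Nat.card (LinearMap.range φ) : ℝ) * ((S.ncard : ℝ) / (Nat.card F : ℝ) ^ d)) := by
        gcongr
    _ = _ := by
        rw [← h3, Nat.card_eq_fintype_card (α := F)]
        push_cast
        ring

end LinearCounting

/-! ### The facets of an absorber in coordinates -/

section FacetMap

variable {F : Type} [Field F]

/-- The values of the vertices of the edge `e_I` of a cross-polytope whose two opposite edges have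
the vertex values `α` and `β`. -/
def mix {k : ℕ} (I : Finset (Fin k)) (α β : Fin k → F) : Fin k → F :=
  fun i => if i ∈ I then β i else α i

/-- The values of the vertices of a facet of an absorber, as a linear function of the values `α` of
the given edge and the values `β` of the spanning vertices. The facet omits the `i`-th vertex of the
edge `e_J` of the cross-polytope associated with the edge `e_I`; with `J = ∅` it is a facet of `e_I`
itself. -/
def facetMap {d : ℕ} (I J : Finset (Fin (d + 1))) (i : Fin (d + 1)) :
    (Fin (d + 1) → F) × (Fin (d + 1) → F) →ₗ[F] (Fin d → F) where
  toFun p j := mix I p.1 p.2 (i.succAbove j) -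
    if i.succAbove j ∈ J then ∑ l, mix I p.1 p.2 l else 0
  map_add' p q := by
    have h : ∀ l, mix I (p.1 + q.1) (p.2 + q.2) l = mix I p.1 p.2 l + mix I q.1 q.2 l := by
      intro l; simp only [mix]; split_ifs <;> rfl
    ext j
    simp only [Prod.fst_add, Prod.snd_add, h, Pi.add_apply, sum_add_distrib]
    split_ifs <;> ring
  map_smul' t p := by
    have h : ∀ l, mix I (t • p.1) (t • p.2) l = t * mix I p.1 p.2 l := by
      intro l; simp only [mix]; split_ifs <;> rfl
    ext j
    simp only [Prod.smul_fst, Prod.smul_snd, h, Pi.smul_apply, ← mul_sum, smul_eq_mul,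
      RingHom.id_apply]
    split_ifs <;> ring

/-- The positions `(I, J, i)` of those facets of an absorber that are not facets of the edge it
absorbs. -/
def ProperPosition {k : ℕ} (p : Finset (Fin k) × Finset (Fin k) × Fin k) : Prop :=
  p.1.Nonempty ∧ (2 ≤ #p.1 ∨ (p.2.1 = ∅ ∧ p.2.2 ∉ p.1))

lemma facetMap_congr {d : ℕ} {I J : Finset (Fin (d + 1))} {i : Fin (d + 1)}
    {α α' β : Fin (d + 1) → F} (h : ∀ j ∉ I, α j = α' j) :
    facetMap I J i (α, β) = facetMap I J i (α', β) := by
  have : mix I α β = mix I α' β := by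
    ext l; simp only [mix]; split_ifs with hl
    · rfl
    · exact h l hl
  ext j
  simp only [facetMap, LinearMap.coe_mk, AddHom.coe_mk, this]

/-- A facet that does not lie in the absorbed edge varies with the spanning vertices. -/
lemma facetMap_inr_ne_zero {d : ℕ} {I J : Finset (Fin (d + 1))} {i : Fin (d + 1)}
    (h : ProperPosition (I, J, i)) :
    (facetMap I J i).comp (LinearMap.inr F (Fin (d + 1) → F) (Fin (d + 1) → F)) ≠ 0 := by
  obtain ⟨⟨l, hl⟩, h⟩ := h
  dsimp only at hl h
  intro h0
  rcases h with h | ⟨rfl, hi⟩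
  · -- the vector `e_l - e_l'` has coordinate sum zero
    obtain ⟨l, hl, l', hl', hne⟩ := Finset.one_lt_card.1 (show 1 < #I by omega)
    wlog hli : l ≠ i generalizing l l'
    · exact this l' hl' l hl hne.symm (by rintro rfl; exact hli hne)
    obtain ⟨j, rfl⟩ := Fin.exists_succAbove_eq hli
    set v : Fin (d + 1) → F := Pi.single (i.succAbove j) 1 - Pi.single l' 1 with hv
    have hmix : mix I 0 v = v := by
      ext m
      simp only [mix, hv]
      split_ifs with hm
      · rfl
      · rw [Pi.sub_apply, Pi.single_eq_of_ne (by rintro rfl; exact hm hl),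
          Pi.single_eq_of_ne (by rintro rfl; exact hm hl')]
        simp
    have := congrFun (LinearMap.congr_fun h0 v) j
    simp only [LinearMap.comp_apply, LinearMap.inr_apply, facetMap, LinearMap.coe_mk,
      AddHom.coe_mk, hmix, LinearMap.zero_apply, Pi.zero_apply] at this
    simp [hv, Pi.single_eq_of_ne hne] at this
  · have hli : l ≠ i := by rintro rfl; exact hi hl
    obtain ⟨j, rfl⟩ := Fin.exists_succAbove_eq hli
    have := congrFun (LinearMap.congr_fun h0
      (Pi.single (i.succAbove j) (1 : F) : Fin (d + 1) → F)) j
    simp [facetMap, mix, hl] at this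

variable {d : ℕ}

/-- The map `facetMap` for given `I ∋ i₀`, as a function of all its relevant arguments: the value
`α i₀` does not matter. -/
def reducedFacetMap (I J : Finset (Fin (d + 1))) (i i₀ : Fin (d + 1)) :
    (Fin d → F) × (Fin (d + 1) → F) →ₗ[F] (Fin d → F) :=
  (facetMap I J i).comp (LinearMap.prodMap
    { toFun := fun α => i₀.insertNth (0 : F) α
      map_add' := fun x y => by
        ext j; refine Fin.succAboveCases i₀ ?_ (fun j => ?_) j <;> simp
      map_smul' := fun t x => by
        ext j; refine Fin.succAboveCases i₀ ?_ (fun j => ?_) j <;> simp } LinearMap.id)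

lemma reducedFacetMap_apply {I J : Finset (Fin (d + 1))} {i i₀ : Fin (d + 1)} (h : i₀ ∈ I)
    (α β : Fin (d + 1) → F) :
    reducedFacetMap I J i i₀ (α ∘ i₀.succAbove, β) = facetMap I J i (α, β) := by
  refine facetMap_congr fun j hj => ?_
  obtain ⟨j, rfl⟩ := Fin.exists_succAbove_eq (show j ≠ i₀ by rintro rfl; exact hj h)
  simp

/-- Every vector is a possible value of a facet in a given position. -/
lemma reducedFacetMap_surjective {I J : Finset (Fin (d + 1))} {i i₀ : Fin (d + 1)} (h : i₀ ∈ I) :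
    Function.Surjective (reducedFacetMap (F := F) I J i i₀) := by
  intro t
  set y : Fin (d + 1) → F := i.insertNth (-∑ j, t j) t with hy
  refine ⟨(y ∘ i₀.succAbove, y), ?_⟩
  rw [reducedFacetMap_apply h]
  have hm : mix I y y = y := by ext; simp [mix]
  have hs : ∑ l, y l = 0 := by simp [hy, Fin.sum_univ_succAbove _ i]
  ext j
  simp only [facetMap, LinearMap.coe_mk, AddHom.coe_mk, hm, hs, ite_self, sub_zero]
  simp [hy]

/-- Fixing a facet that does not lie in the absorbed edge leaves freedom in the choice of the
absorbed edge, even in those vertices that matter. -/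
lemma exists_reducedFacetMap_eq_zero {I J : Finset (Fin (d + 1))} {i i₀ : Fin (d + 1)}
    (h₀ : i₀ ∈ I) (h : ProperPosition (I, J, i)) :
    ∃ α : Fin d → F, α ≠ 0 ∧ reducedFacetMap I J i i₀ (α, 0) = 0 := by
  obtain ⟨-, h⟩ := h
  dsimp only at h
  have key : ∃ l, l ≠ i₀ ∧ (l ∈ I ∨ (J = ∅ ∧ l = i)) := by
    rcases h with h | ⟨hJ, hi⟩
    · obtain ⟨l, hl, hne⟩ := Finset.exists_mem_ne (show 1 < #I by omega) i₀
      exact ⟨l, hne, .inl hl⟩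
    · exact ⟨i, by rintro rfl; exact hi h₀, .inr ⟨hJ, rfl⟩⟩
  obtain ⟨l, hl, h⟩ := key
  obtain ⟨m, rfl⟩ := Fin.exists_succAbove_eq hl
  refine ⟨Pi.single m 1, by simp, ?_⟩
  have hcomp : (Pi.single m (1 : F) : Fin d → F) =
      (Pi.single (i₀.succAbove m) (1 : F) : Fin (d + 1) → F) ∘ i₀.succAbove := by
    ext j
    simp [Pi.single_apply]
  rw [hcomp, reducedFacetMap_apply h₀]
  rcases h with h | ⟨rfl, rfl⟩
  · have : mix I (Pi.single (i₀.succAbove m) (1 : F)) 0 = 0 := by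
      ext j
      simp only [mix]
      split_ifs with hj
      · rfl
      · rw [Pi.single_eq_of_ne (by rintro rfl; exact hj h)]; rfl
    ext j
    simp [facetMap, this]
  · ext j
    simp only [facetMap, LinearMap.coe_mk, AddHom.coe_mk, notMem_empty, if_false, sub_zero, mix]
    split_ifs
    · rfl
    · rw [Pi.single_eq_of_ne (Fin.succAbove_ne _ _)]; rfl

end FacetMap

section FacetCounting

open scoped Classical

variable {F : Type} [Field F] [Fintype F] {d : ℕ}

lemma card_facetMap_mem_le {C : ℝ} {S : Set (Fin d → F)} (hS : AffineBounded d C S)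
    {I J : Finset (Fin (d + 1))} {i : Fin (d + 1)} (h : ProperPosition (I, J, i))
    (α : Fin (d + 1) → F) :
    (#{β : Fin (d + 1) → F | facetMap I J i (α, β) ∈ S} : ℝ) ≤
      C * (Fintype.card F : ℝ) ^ (d + 1) * ((S.ncard : ℝ) / (Fintype.card F : ℝ) ^ d) := by
  have := hS.card_preimage_le _ (facetMap_inr_ne_zero h) (facetMap I J i (α, 0))
  simp only [LinearMap.comp_apply, LinearMap.inr_apply, ← map_add, Prod.mk_add_mk, add_zero,
    zero_add, Fintype.card_pi, prod_const, Finset.card_univ, Fintype.card_fin] at this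
  exact_mod_cast this

lemma card_facetMap_eq_le {I J : Finset (Fin (d + 1))} {i : Fin (d + 1)}
    (h : ProperPosition (I, J, i)) (α : Fin (d + 1) → F) (w : Fin d → F) :
    #{β : Fin (d + 1) → F | facetMap I J i (α, β) = w} ≤ Fintype.card F ^ d := by
  have := card_fiber_mul_le _ (facetMap_inr_ne_zero (F := F) h) (w - facetMap I J i (α, 0))
  simp only [LinearMap.comp_apply, LinearMap.inr_apply, eq_sub_iff_add_eq, ← map_add,
    Prod.mk_add_mk, add_zero, zero_add, Fintype.card_pi, prod_const, Finset.card_univ,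
    Fintype.card_fin, pow_succ] at this
  exact Nat.le_of_mul_le_mul_right this Fintype.card_pos

lemma card_reducedFacetMap_eq_le {C : ℝ} {S : Set (Fin d → F)} (hS : AffineBounded d C S)
    {I J : Finset (Fin (d + 1))} {i i₀ : Fin (d + 1)} (h₀ : i₀ ∈ I)
    (h : ProperPosition (I, J, i)) (w : Fin d → F) :
    (#{p : (Fin d → F) × (Fin (d + 1) → F) | reducedFacetMap I J i i₀ p = w ∧ p.1 ∈ S} : ℝ) ≤
      C * (Fintype.card F : ℝ) ^ (d + 1) * ((S.ncard : ℝ) / (Fintype.card F : ℝ) ^ d) := by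
  set ψ := reducedFacetMap (F := F) I J i i₀ with hψ
  obtain ⟨p₀, hp₀⟩ := reducedFacetMap_surjective (F := F) (J := J) (i := i) h₀ w
  set φ : LinearMap.ker ψ →ₗ[F] (Fin d → F) :=
    (LinearMap.fst F _ _).comp (LinearMap.ker ψ).subtype with hφ
  have hφ0 : φ ≠ 0 := by
    obtain ⟨α, hα, hz⟩ := exists_reducedFacetMap_eq_zero (F := F) (J := J) h₀ h
    intro h
    exact hα (LinearMap.congr_fun h ⟨(α, 0), hz⟩)
  have hker : Fintype.card (LinearMap.ker ψ) = Fintype.card F ^ (d + 1) := by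
    have h1 := card_ker_mul_card_range ψ
    rw [LinearMap.range_eq_top.2 (reducedFacetMap_surjective h₀)] at h1
    simp only [Nat.card_eq_fintype_card, Fintype.card_prod, Fintype.card_pi, prod_const,
      Finset.card_univ, Fintype.card_fin] at h1
    have h2 : Fintype.card (⊤ : Submodule F (Fin d → F)) = Fintype.card F ^ d := by
      rw [Fintype.card_congr (Submodule.topEquiv (R := F)).toEquiv]
      simp
    rw [h2, mul_comm] at h1
    exact Nat.eq_of_mul_eq_mul_left (pow_pos Fintype.card_pos d) h1
  have h1 := hS.card_preimage_le φ hφ0 p₀.1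
  rw [hker] at h1
  push_cast at h1
  refine le_trans ?_ h1
  rw [Nat.cast_le]
  refine card_le_card_of_surjOn (fun v => p₀ + (v : (Fin d → F) × (Fin (d + 1) → F))) ?_
  intro p hp
  simp only [coe_filter, Finset.mem_univ, true_and, Set.mem_ofPred_eq] at hp
  refine ⟨⟨p - p₀, by rw [LinearMap.mem_ker, map_sub, hp.1, hp₀, sub_self]⟩, ?_, by simp⟩
  simp [hφ, hp.2]

end FacetCounting

/-! ### Absorbers containing a given facet -/

section AbsorberFacets

variable {n d k : ℕ} {F : Type} [Field F]

lemma exists_facet_eq_image {t : Fin (d + 1) → Fin n} (ht : Function.Injective t)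
    {f : Finset (Fin n)} (hf : f ∈ (univ.image t).powersetCard d) :
    ∃ i : Fin (d + 1), f = univ.image (t ∘ i.succAbove) := by
  obtain ⟨hsub, hcard⟩ := mem_powersetCard.1 hf
  have hex : ∃ i, t i ∉ f := by
    by_contra! h
    have : univ.image t ⊆ f := by
      intro v hv
      obtain ⟨i, -, rfl⟩ := mem_image.1 hv
      exact h i
    have := card_le_card this
    rw [card_image_of_injective _ ht, hcard] at this
    simp at this
  obtain ⟨i, hi⟩ := hex
  refine ⟨i, eq_of_subset_of_card_le ?_ ?_⟩
  · intro v hv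
    obtain ⟨j, -, rfl⟩ := mem_image.1 (hsub hv)
    obtain ⟨m, rfl⟩ := Fin.exists_succAbove_eq (show j ≠ i by rintro rfl; exact hi hv)
    exact mem_image.2 ⟨m, mem_univ _, rfl⟩
  · rw [hcard, card_image_of_injective _ (ht.comp Fin.succAbove_right_injective)]
    simp

lemma crossTuple_empty (x a : Fin k → Fin n) : crossTuple x a ∅ = x := by
  ext; simp [crossTuple]

lemma val_crossTuple (π : Fin n ↪ Fˣ) (x a : Fin k → Fin n) (I : Finset (Fin k)) (i : Fin k) :
    (π (crossTuple x a I i) : F) = mix I (fun j => (π (x j) : F)) (fun j => (π (a j) : F)) i := by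
  simp only [crossTuple, mix]; split_ifs <;> rfl

lemma unit_val_injective (π : Fin n ↪ Fˣ) : Function.Injective fun v => (π v : F) :=
  Units.val_injective.comp π.injective

variable {π : Fin n ↪ Fˣ} {H : Hypergraph n} {x a : Fin k → Fin n}
  {b : Finset (Fin k) → Fin k → Fin n}

lemma crossTuple_injective_of_absorberVertex (h : Function.Injective (absorberVertex x a b))
    (I : Finset (Fin k)) : Function.Injective (crossTuple x a I) := by
  have : crossTuple x a I = absorberVertex x a b ∘
      fun i => if i ∈ I then .inl (.inr i) else .inl (.inl i) := by
    ext i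
    simp only [crossTuple, absorberVertex, Function.comp]
    split_ifs <;> rfl
  rw [this]
  refine h.comp fun i j hij => ?_
  split_ifs at hij <;> simp_all

lemma crossTuple_crossTuple_injective_of_absorberVertex
    (h : Function.Injective (absorberVertex x a b)) {I : Finset (Fin k)} (hI : I.Nonempty)
    (hI' : Even #I) (J : Finset (Fin k)) :
    Function.Injective (crossTuple (crossTuple x a I) (b I) J) := by
  have : crossTuple (crossTuple x a I) (b I) J = absorberVertex x a b ∘
      fun i => if i ∈ J then .inr (⟨I, hI, hI'⟩, i) else
        if i ∈ I then .inl (.inr i) else .inl (.inl i) := by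
    ext i
    simp only [crossTuple, absorberVertex, Function.comp]
    split_ifs <;> rfl
  rw [this]
  refine h.comp fun i j hij => ?_
  split_ifs at hij <;> simp_all

lemma mem_template {n : ℕ} {π : Fin n ↪ Fˣ} {H : Hypergraph n} {x : Finset (Fin n)} :
    x ∈ template π H ↔ x ∈ H ∧ ∑ v ∈ x, (π v : F) = 0 := by
  simp [template]

lemma sum_mix_singleton (y b : Fin k → F) (i : Fin k) :
    ∑ j, mix {i} y b j = b i - y i + ∑ j, y j := by
  rw [← Finset.add_sum_erase _ _ (mem_univ i), ← Finset.add_sum_erase univ y (mem_univ i)]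
  have : ∑ j ∈ univ.erase i, mix {i} y b j = ∑ j ∈ univ.erase i, y j :=
    sum_congr rfl fun j hj => by simp [mix, ne_of_mem_erase hj]
  rw [this, sum_erase_eq_sub (mem_univ i)]
  simp [mix]
  ring

/-- The value of an algebraic vertex is determined by the edge. -/
lemma SpansAbsorber.val_algebraic (h : SpansAbsorber π H x a b) {I : Finset (Fin k)}
    (hI : I.Nonempty) (hI' : Even #I) (i : Fin k) :
    (π (b I i) : F) = mix I (fun j => (π (x j) : F)) (fun j => (π (a j) : F)) i -
      ∑ j, mix I (fun j => (π (x j) : F)) (fun j => (π (a j) : F)) j := by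
  have h1 := (mem_template.1 ((h.associated I hI hI').algebraic i)).2
  rw [crossEdge, sum_image
    (crossTuple_crossTuple_injective_of_absorberVertex h.distinct hI hI' {i}).injOn] at h1
  simp only [val_crossTuple, sum_mix_singleton] at h1
  linear_combination h1

/-- A spanned absorber is determined by the tuples of its edge and of its spanning vertices. -/
lemma SpansAbsorber.absorberGraph_eq {b' : Finset (Fin k) → Fin k → Fin n}
    (h : SpansAbsorber π H x a b) (h' : SpansAbsorber π H x a b') :
    absorberGraph x a b = absorberGraph x a b' := by
  unfold absorberGraph
  congr 1
  refine biUnion_congr rfl fun I hI => ?_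
  obtain ⟨-, hI, hI'⟩ := mem_filter.1 hI
  have : b I = b' I := by
    ext1 i
    apply unit_val_injective π
    dsimp only
    rw [h.val_algebraic hI hI', h'.val_algebraic hI hI']
  rw [this]

end AbsorberFacets

section Positions

variable {n d : ℕ} {F : Type} [Field F] {π : Fin n ↪ Fˣ} {H : Hypergraph n}
  {x a : Fin (d + 1) → Fin n} {b : Finset (Fin (d + 1)) → Fin (d + 1) → Fin n}

/-- A facet of an absorber that is not a facet of the absorbed edge has a proper position. -/
lemma SpansAbsorber.exists_properPosition (h : SpansAbsorber π H x a b) {f : Finset (Fin n)}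
    (hf : f ∈ facets (d + 1) (absorberGraph x a b)) (hfx : f ∉ facets (d + 1) {univ.image x}) :
    ∃ p, ProperPosition p ∧ ∃ v : Fin d → Fin n, Function.Injective v ∧ univ.image v = f ∧
      facetMap p.1 p.2.1 p.2.2 (fun j => (π (x j) : F), fun j => (π (a j) : F)) =
        fun j => (π (v j) : F) := by
  simp only [facets, mem_biUnion, absorberGraph, mem_union, mem_image, mem_filter, mem_univ,
    true_and, Nat.add_sub_cancel, mem_singleton, exists_eq_left] at hf hfx
  obtain ⟨e, he, hfe⟩ := hf
  rcases he with ⟨I, hI, rfl⟩ | ⟨I, ⟨hI, hI'⟩, J, hJ, rfl⟩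
  · have hinj := crossTuple_injective_of_absorberVertex h.distinct I
    obtain ⟨i, rfl⟩ := exists_facet_eq_image hinj hfe
    refine ⟨(I, ∅, i), ⟨card_pos.1 hI.pos, ?_⟩, crossTuple x a I ∘ i.succAbove,
      hinj.comp Fin.succAbove_right_injective, rfl, ?_⟩
    · by_contra! hcon
      obtain ⟨h1, h2⟩ := hcon
      have hi : i ∈ I := h2 rfl
      have hIi : I = {i} := (card_le_one_iff_subset_singleton.1 (by simp at h1; omega)).elim
        fun j hj => by
          rw [subset_singleton_iff] at hj
          rcases hj with rfl | rfl
          · simp at hi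
          · simp at hi; rw [hi]
      subst hIi
      refine hfx (mem_powersetCard.2 ⟨?_, ?_⟩)
      · intro v hv
        obtain ⟨j, -, rfl⟩ := mem_image.1 hv
        simp [crossTuple]
      · rw [card_image_of_injective _ (hinj.comp Fin.succAbove_right_injective)]
        simp
    · ext j
      simp [facetMap, val_crossTuple]
  · have hinj := crossTuple_crossTuple_injective_of_absorberVertex h.distinct hI hI' J
    obtain ⟨i, rfl⟩ := exists_facet_eq_image hinj hfe
    refine ⟨(I, J, i), ⟨hI, .inl ?_⟩, crossTuple (crossTuple x a I) (b I) J ∘ i.succAbove,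
      hinj.comp Fin.succAbove_right_injective, rfl, ?_⟩
    · have := hI.card_pos
      obtain ⟨r, hr⟩ := hI'
      dsimp only
      omega
    · ext j
      simp only [facetMap, LinearMap.coe_mk, AddHom.coe_mk, Function.comp]
      by_cases hj : i.succAbove j ∈ J
      · rw [if_pos hj, ← h.val_algebraic hI hI', crossTuple, if_pos hj]
      · rw [if_neg hj, sub_zero, ← val_crossTuple, crossTuple.eq_def _ (b I), if_neg hj]

end Positions

section AbsorberCounting

open scoped Classical

variable {n d : ℕ} {F : Type} [Field F] [Fintype F] {π : Fin n ↪ Fˣ} {H : Hypergraph n}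

/-- The orderings of a `k`-set. -/
noncomputable def orderings {n : ℕ} (k : ℕ) (x : Finset (Fin n)) : Finset (Fin k → Fin n) :=
  {y | Function.Injective y ∧ univ.image y = x}

lemma card_orderings_le {n k : ℕ} {x : Finset (Fin n)} (hx : #x = k) :
    #(orderings k x) ≤ k ^ k := by
  calc #(orderings k x) ≤ #(Fintype.piFinset fun _ : Fin k => x) := by
        refine card_le_card fun y hy => ?_
        simp only [orderings, mem_filter, mem_univ, true_and] at hy
        simp only [Fintype.mem_piFinset]
        intro i
        rw [← hy.2]
        exact mem_image_of_mem _ (mem_univ i)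
    _ = k ^ k := by simp [hx]

lemma mem_absorbers {n k : ℕ} {F : Type} [Field F] {π : Fin n ↪ Fˣ} {H : Hypergraph n}
    {x : Finset (Fin n)} {A : Hypergraph n} : A ∈ absorbers k π H x ↔
      ∃ (y a : Fin k → Fin n) (b : Finset (Fin k) → Fin k → Fin n),
        univ.image y = x ∧ SpansAbsorber π H y a b ∧ A = absorberGraph y a b := by
  simp [absorbers]

/-- A set of absorbers for `x` is at most as large as the set of pairs consisting of an ordering of
`x` and of the tuple of values of spanning vertices. -/
lemma card_absorbers_filter_le {k : ℕ} (x : Finset (Fin n)) (P : Hypergraph n → Prop)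
    [DecidablePred P] (Q : (Fin k → Fin n) → (Fin k → F) → Prop) [∀ y, DecidablePred (Q y)]
    (hQ : ∀ y a b, univ.image y = x → SpansAbsorber π H y a b → P (absorberGraph y a b) →
      Q y fun i => (π (a i) : F)) :
    #{A ∈ absorbers k π H x | P A} ≤ ∑ y ∈ orderings k x, #{β | Q y β} := by
  have hex : ∀ A ∈ {A ∈ absorbers k π H x | P A}, ∃ w : (_ : Fin k → Fin n) × (Fin k → F),
      w ∈ (orderings k x).sigma (fun y => ({β | Q y β} : Finset (Fin k → F))) ∧
      ∃ a b, w.2 = (fun i => (π (a i) : F)) ∧ SpansAbsorber π H w.1 a b ∧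
        A = absorberGraph w.1 a b := by
    intro A hA
    obtain ⟨hA, hP⟩ := mem_filter.1 hA
    obtain ⟨y, a, b, hy, hs, rfl⟩ := mem_absorbers.1 hA
    refine ⟨⟨y, fun i => (π (a i) : F)⟩, ?_, a, b, rfl, hs, rfl⟩
    simp only [orderings, mem_sigma, mem_filter, mem_univ, true_and]
    refine ⟨⟨?_, hy⟩, hQ y a b hy hs hP⟩
    have := crossTuple_injective_of_absorberVertex hs.distinct ∅
    rwa [crossTuple_empty] at this
  obtain h0 | ⟨A₀, hA₀⟩ := {A ∈ absorbers k π H x | P A}.eq_empty_or_nonempty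
  · simp [h0]
  have : Nonempty ((_ : Fin k → Fin n) × (Fin k → F)) := ⟨(hex A₀ hA₀).choose⟩
  choose! w hw using hex
  rw [← card_sigma]
  refine card_le_card_of_injOn w (fun A hA => (hw A hA).1) ?_
  intro A hA A' hA' hAA
  obtain ⟨-, a, b, ha, hs, h⟩ := hw A hA
  obtain ⟨-, a', b', ha', hs', h'⟩ := hw A' hA'
  rw [← hAA] at ha' hs' h'
  have : a = a' := by
    ext1 i
    exact unit_val_injective π (congrFun (ha.symm.trans ha') i)
  subst this
  rw [h, h', hs.absorberGraph_eq hs']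

/-- The number of positions of facets in an absorber. -/
def numPositions (d : ℕ) : ℕ := 2 ^ (d + 1) * (2 ^ (d + 1) * (d + 1))

lemma card_properPosition_le (d : ℕ) :
    #{p : Finset (Fin (d + 1)) × Finset (Fin (d + 1)) × Fin (d + 1) | ProperPosition p} ≤
      numPositions d := by
  refine (card_filter_le _ _).trans ?_
  simp [numPositions]

/-- Few absorbers for an edge `x` have a given facet that is not contained in `x`. -/
lemma card_absorbers_mem_facets_le {x f : Finset (Fin n)} (hx : #x = d + 1) (hf : #f = d)
    (hfx : f ∉ facets (d + 1) {x}) :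
    #{A ∈ absorbers (d + 1) π H x | f ∈ facets (d + 1) A} ≤
      (d + 1) ^ (d + 1) * (numPositions d * (d ^ d * Fintype.card F ^ d)) := by
  refine (card_absorbers_filter_le x _ (fun y β => ∃ p, ProperPosition p ∧ ∃ v : Fin d → Fin n,
    v ∈ orderings d f ∧ facetMap p.1 p.2.1 p.2.2 (fun j => (π (y j) : F), β) =
        fun j => (π (v j) : F)) ?_).trans ?_
  · intro y a b hy hs hfA
    subst hy
    obtain ⟨p, hp, v, hv, hvf, h⟩ := hs.exists_properPosition hfA hfx
    exact ⟨p, hp, v, by simp [orderings, hv, hvf], h⟩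
  · refine (sum_le_card_nsmul _ _ (numPositions d * (d ^ d * Fintype.card F ^ d))
      fun y _ => ?_).trans (by rw [smul_eq_mul]; gcongr; exact card_orderings_le hx)
    calc _ ≤ #(({p | ProperPosition p} : Finset (Finset (Fin (d + 1)) × Finset (Fin (d + 1)) ×
            Fin (d + 1))).biUnion fun p => (orderings d f).biUnion fun v =>
              ({β | facetMap p.1 p.2.1 p.2.2 (fun j => (π (y j) : F), β) =
                fun j => (π (v j) : F)} : Finset (Fin (d + 1) → F))) := by
          refine card_le_card fun β hβ => ?_
          simpa using hβ
      _ ≤ #({p | ProperPosition p} : Finset (Finset (Fin (d + 1)) × Finset (Fin (d + 1)) ×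
            Fin (d + 1))) * (d ^ d * Fintype.card F ^ d) := by
          refine card_biUnion_le_card_mul _ _ _ fun p hp => ?_
          refine (card_biUnion_le_card_mul _ _ (Fintype.card F ^ d) fun v _ => ?_).trans ?_
          · exact card_facetMap_eq_le (mem_filter.1 hp).2 _ _
          · gcongr
            exact card_orderings_le hf
      _ ≤ _ := by
          gcongr
          exact card_properPosition_le d

variable {L S : Hypergraph n} {C : ℝ}

lemma IsDecomposition.facets_singleton_subset (hS : IsDecomposition (d + 1) S L)
    {x : Finset (Fin n)} (hx : x ∈ S) : facets (d + 1) {x} ⊆ L := by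
  simpa [facets] using (hS.1 x hx).2

/-- Few absorbers for an edge of a decomposition of `L` share a facet with another edge of it. -/
lemma card_absorbers_not_facetDisjoint_le (hS : IsDecomposition (d + 1) S L)
    (hL : AffineBounded d C (vectorImage d π L)) (hC : 0 ≤ C) {x : Finset (Fin n)} (hx : x ∈ S) :
    (#{A ∈ absorbers (d + 1) π H x | ¬ FacetDisjoint (d + 1) A (S.erase x)} : ℝ) ≤
      (d + 1) ^ (d + 1) * (numPositions d * (C * (Fintype.card F : ℝ) ^ (d + 1) *
        (((vectorImage d π L).ncard : ℝ) / (Fintype.card F : ℝ) ^ d))) := by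
  set B : ℝ := C * (Fintype.card F : ℝ) ^ (d + 1) *
        (((vectorImage d π L).ncard : ℝ) / (Fintype.card F : ℝ) ^ d) with hB
  have hB0 : 0 ≤ B := by positivity
  have h1 := card_absorbers_filter_le (π := π) (H := H) x
    (fun A => ¬ FacetDisjoint (d + 1) A (S.erase x))
    (fun y β => ∃ p, ProperPosition p ∧
      facetMap p.1 p.2.1 p.2.2 (fun j => (π (y j) : F), β) ∈ vectorImage d π L) ?_
  · have h1' : (#{A ∈ absorbers (d + 1) π H x | ¬ FacetDisjoint (d + 1) A (S.erase x)} : ℝ) ≤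
        ∑ y ∈ orderings (d + 1) x, (#{β | ∃ p, ProperPosition p ∧
          facetMap p.1 p.2.1 p.2.2 (fun j => (π (y j) : F), β) ∈ vectorImage d π L} : ℝ) := by
      exact_mod_cast h1
    refine h1'.trans ?_
    refine (sum_le_card_nsmul _ _ (numPositions d * B) fun y _ => ?_).trans (by
      rw [nsmul_eq_mul]
      gcongr
      exact_mod_cast card_orderings_le (hS.1 x hx).1)
    have h2 : #{β | ∃ p, ProperPosition p ∧
          facetMap p.1 p.2.1 p.2.2 (fun j => (π (y j) : F), β) ∈ vectorImage d π L} ≤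
        ∑ p : Finset (Fin (d + 1)) × Finset (Fin (d + 1)) × Fin (d + 1) with ProperPosition p,
          #{β | facetMap p.1 p.2.1 p.2.2 (fun j => (π (y j) : F), β) ∈ vectorImage d π L} := by
      refine le_trans (card_le_card fun β hβ => ?_) card_biUnion_le
      simpa using hβ
    calc (_ : ℝ) ≤ _ := Nat.cast_le.2 h2
      _ ≤ _ := by
        push_cast
        refine (sum_le_card_nsmul _ _ B fun p hp => ?_).trans ?_
        · exact card_facetMap_mem_le hL (mem_filter.1 hp).2 _
        · rw [nsmul_eq_mul]
          gcongr
          exact_mod_cast card_properPosition_le d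
  · intro y a b hy hs hA
    rw [FacetDisjoint, not_disjoint_iff] at hA
    obtain ⟨f, hfA, hfS⟩ := hA
    obtain ⟨e, heS, hfe⟩ := mem_biUnion.1 hfS
    obtain ⟨hex, heS⟩ := mem_erase.1 heS
    have hfL : f ∈ L := (hS.1 e heS).2 hfe
    have hfx : f ∉ facets (d + 1) {univ.image y} := by
      intro hf
      simp only [facets, singleton_biUnion, hy] at hf
      exact hex ((hS.2 f hfL).unique ⟨heS, (mem_powersetCard.1 hfe).1⟩
        ⟨hx, (mem_powersetCard.1 hf).1⟩)
    obtain ⟨p, hp, v, hv, hvf, h⟩ := hs.exists_properPosition hfA hfx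
    exact ⟨p, hp, v, hv, by rwa [hvf], h⟩

/-- A facet outside `L` occurs in few absorbers for the edges of a decomposition of `L`. -/
lemma sum_card_absorbers_mem_facets_le (hS : IsDecomposition (d + 1) S L)
    (hL : AffineBounded d C (vectorImage d π L)) (hC : 0 ≤ C) {f : Finset (Fin n)} (hf : #f = d)
    (hfL : f ∉ L) :
    (∑ x ∈ S, (#{A ∈ absorbers (d + 1) π H x | f ∈ facets (d + 1) A} : ℝ)) ≤
      numPositions d * (d ^ d * (C * (Fintype.card F : ℝ) ^ (d + 1) *
        (((vectorImage d π L).ncard : ℝ) / (Fintype.card F : ℝ) ^ d))) := by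
  set B : ℝ := C * (Fintype.card F : ℝ) ^ (d + 1) *
        (((vectorImage d π L).ncard : ℝ) / (Fintype.card F : ℝ) ^ d) with hB
  set Q : Finset (Fin (d + 1)) × Finset (Fin (d + 1)) × Fin (d + 1) → (Fin d → Fin n) →
    (Fin (d + 1) → Fin n) → (Fin (d + 1) → F) → Prop := fun p v y β =>
      facetMap p.1 p.2.1 p.2.2 (fun j => (π (y j) : F), β) = fun j => (π (v j) : F) with hQ
  have h1 : ∀ x ∈ S, #{A ∈ absorbers (d + 1) π H x | f ∈ facets (d + 1) A} ≤
      ∑ y ∈ orderings (d + 1) x, #{β | ∃ p, ProperPosition p ∧ ∃ v ∈ orderings d f, Q p v y β} := by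
    intro x hx
    refine card_absorbers_filter_le x _ _ ?_
    intro y a b hy hs hfA
    obtain ⟨p, hp, v, hv, hvf, h⟩ := hs.exists_properPosition hfA (by
      rw [hy]; exact fun h => hfL (hS.facets_singleton_subset hx h))
    exact ⟨p, hp, v, by simp [orderings, hv, hvf], h⟩
  set W : Finset (Finset (Fin (d + 1)) × Finset (Fin (d + 1)) × Fin (d + 1)) :=
    {p | ProperPosition p} with hW
  set Z : Finset (Fin (d + 1)) × Finset (Fin (d + 1)) × Fin (d + 1) → (Fin d → Fin n) →
    Finset ((Fin (d + 1) → Fin n) × (Fin (d + 1) → F)) := fun p v =>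
      {w | Function.Injective w.1 ∧ univ.image w.1 ∈ S ∧ Q p v w.1 w.2} with hZ
  have h2 : ∑ x ∈ S, ∑ y ∈ orderings (d + 1) x,
      #{β | ∃ p, ProperPosition p ∧ ∃ v ∈ orderings d f, Q p v y β} ≤
      #(W.biUnion fun p => (orderings d f).biUnion fun v => Z p v) := by
    simp_rw [← card_sigma]
    refine card_le_card_of_injOn (fun w => (w.2.1, w.2.2)) ?_ ?_
    · rintro ⟨x, y, β⟩ h
      simp only [coe_sigma, Set.mem_sigma_iff, mem_coe, mem_filter, mem_univ, true_and,
        orderings] at h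
      obtain ⟨hx, ⟨hy, hyx⟩, p, hp, v, hv, h⟩ := h
      simp only [coe_biUnion, mem_coe, Set.mem_iUnion, hW, hZ, mem_filter, mem_univ, true_and]
      exact ⟨p, hp, v, by simpa [orderings] using hv, hy, by rwa [hyx], h⟩
    · rintro ⟨x, y, β⟩ h ⟨x', y', β'⟩ h' heq
      simp only [coe_sigma, Set.mem_sigma_iff, mem_coe, mem_filter, mem_univ, true_and,
        orderings, Prod.mk.injEq] at h h' heq
      obtain ⟨rfl, rfl⟩ := heq
      obtain ⟨hx, ⟨hy, rfl⟩, -⟩ := h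
      obtain ⟨hx', ⟨hy', rfl⟩, -⟩ := h'
      rfl
  have h3 : ∀ p ∈ W, ∀ v, (#(Z p v) : ℝ) ≤ B := by
    intro p hp v
    replace hp : ProperPosition p := (mem_filter.1 hp).2
    obtain ⟨i₀, hi₀⟩ := hp.1
    refine le_trans ?_ (card_reducedFacetMap_eq_le hL hi₀ hp fun j => (π (v j) : F))
    rw [Nat.cast_le]
    -- an edge of the decomposition is determined by any of its facets
    refine card_le_card_of_injOn
      (fun w => ((fun j => (π (w.1 j) : F)) ∘ i₀.succAbove, w.2)) ?_ ?_
    · rintro ⟨y, β⟩ h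
      simp only [hZ, hQ, coe_filter, mem_univ, true_and, Set.mem_ofPred_eq] at h ⊢
      obtain ⟨hy, hyS, h⟩ := h
      rw [reducedFacetMap_apply hi₀]
      refine ⟨h, y ∘ i₀.succAbove, hy.comp Fin.succAbove_right_injective, ?_, rfl⟩
      refine (hS.1 _ hyS).2 (mem_powersetCard.2 ⟨?_, ?_⟩)
      · intro u hu
        obtain ⟨j, -, rfl⟩ := mem_image.1 hu
        exact mem_image_of_mem _ (mem_univ _)
      · rw [card_image_of_injective _ (hy.comp Fin.succAbove_right_injective)]
        simp
    · rintro ⟨y, β⟩ h ⟨y', β'⟩ h' heq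
      simp only [hZ, hQ, coe_filter, mem_univ, true_and, Set.mem_ofPred_eq,
        Prod.mk.injEq] at h h' heq
      obtain ⟨heq, rfl⟩ := heq
      have hc : ∀ j, y (i₀.succAbove j) = y' (i₀.succAbove j) := fun j =>
        unit_val_injective π (congrFun heq j)
      have hfy : univ.image (y ∘ i₀.succAbove) ∈ (univ.image y).powersetCard d := by
        refine mem_powersetCard.2 ⟨?_, ?_⟩
        · intro u hu
          obtain ⟨j, -, rfl⟩ := mem_image.1 hu
          exact mem_image_of_mem _ (mem_univ _)
        · rw [card_image_of_injective _ (h.1.comp Fin.succAbove_right_injective)]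
          simp
      have himg : univ.image y = univ.image y' := by
        refine (hS.2 _ ((hS.1 _ h.2.1).2 hfy)).unique
          ⟨h.2.1, (mem_powersetCard.1 hfy).1⟩ ⟨h'.2.1, ?_⟩
        intro u hu
        obtain ⟨j, -, rfl⟩ := mem_image.1 hu
        rw [Function.comp, hc]
        exact mem_image_of_mem _ (mem_univ _)
      have h0 : y i₀ = y' i₀ := by
        have : y i₀ ∈ univ.image y' := himg ▸ mem_image_of_mem _ (mem_univ _)
        obtain ⟨j, -, hj⟩ := mem_image.1 this
        by_cases hji : j = i₀
        · rw [← hj, hji]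
        · obtain ⟨m, rfl⟩ := Fin.exists_succAbove_eq hji
          rw [← hc] at hj
          exact absurd (h.1 hj) hji
      have : y = y' := by
        ext1 j
        refine Fin.succAboveCases i₀ h0 hc j
      rw [this]
  have hB0 : 0 ≤ B := by positivity
  calc (∑ x ∈ S, (#{A ∈ absorbers (d + 1) π H x | f ∈ facets (d + 1) A} : ℝ))
      ≤ #(W.biUnion fun p => (orderings d f).biUnion fun v => Z p v) := by
        exact_mod_cast (sum_le_sum h1).trans h2
    _ ≤ ∑ p ∈ W, ∑ v ∈ orderings d f, (#(Z p v) : ℝ) := by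
        exact_mod_cast card_biUnion_le.trans (sum_le_sum fun p _ => card_biUnion_le)
    _ ≤ ∑ p ∈ W, ∑ v ∈ orderings d f, B := sum_le_sum fun p hp => sum_le_sum fun v _ => h3 p hp v
    _ = #W * (#(orderings d f) * B) := by simp
    _ ≤ numPositions d * (d ^ d * B) := by
        gcongr
        · exact_mod_cast card_properPosition_le d
        · exact_mod_cast card_orderings_le hf

end AbsorberCounting

/-! ### Exponential moments of the random greedy algorithm -/

section Greedy

variable {n : ℕ} {F : Type} [Field F]

/-- At least half of the absorbers for `x` are permissible after the choices in `hist`. -/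
def HalfPermissible (k : ℕ) (π : Fin n ↪ Fˣ) (H S : Hypergraph n) (hist : List (Hypergraph n))
    (x : Finset (Fin n)) : Prop :=
  #(absorbers k π H x) ≤ 2 * #(permissible k π H S hist x)

lemma mem_permissible {k : ℕ} {π : Fin n ↪ Fˣ} {H S : Hypergraph n}
    {hist : List (Hypergraph n)} {x : Finset (Fin n)} {A : Hypergraph n} :
    A ∈ permissible k π H S hist x ↔ A ∈ absorbers k π H x ∧
      (∀ B ∈ hist, FacetDisjoint k A B) ∧ FacetDisjoint k A (S.erase x) := by
  simp [permissible]

lemma permissible_subset {k : ℕ} {π : Fin n ↪ Fˣ} {H S : Hypergraph n}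
    {hist : List (Hypergraph n)} {x : Finset (Fin n)} :
    permissible k π H S hist x ⊆ absorbers k π H x := fun _ hA => (mem_permissible.1 hA).1

lemma sum_list_sum_map {α β : Type*} (P : Finset α) (l : List β) (φ : β → α → ℝ) :
    ∑ A ∈ P, (l.map fun x => φ x A).sum = (l.map fun x => ∑ A ∈ P, φ x A).sum := by
  induction l with
  | nil => simp
  | cons z r ih => simp [sum_add_distrib, ih]

/-- The event that the algorithm treats all edges in `rest` after the choices in `hist`, with at
least half of the absorbers permissible at each of these steps. -/
def auxSuccess (k : ℕ) (π : Fin n ↪ Fˣ) (H S : Hypergraph n) (rest : List (Finset (Fin n)))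
    (hist : List (Hypergraph n)) : Set (Option (List (Hypergraph n))) :=
  {o | ∃ As : List (Hypergraph n), o = some (hist ++ As) ∧ As.length = rest.length ∧
    ∀ i : Fin rest.length, HalfPermissible k π H S (hist ++ As.take i) (rest.get i)}

lemma auxSuccess_cons_subset {k : ℕ} {π : Fin n ↪ Fˣ} {H S : Hypergraph n}
    {x : Finset (Fin n)} {rest : List (Finset (Fin n))} {hist : List (Hypergraph n)}
    (h : HalfPermissible k π H S hist x) (A : Hypergraph n) :
    auxSuccess k π H S rest (hist ++ [A]) ⊆ auxSuccess k π H S (x :: rest) hist := by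
  rintro o ⟨As, rfl, hlen, hAs⟩
  refine ⟨A :: As, by simp, by simp [hlen], fun i => ?_⟩
  refine Fin.cases ?_ (fun i => ?_) i
  · simpa using h
  · simpa using hAs i

lemma toOuterMeasure_le_one {α : Type*} (p : PMF α) (s : Set α) : p.toOuterMeasure s ≤ 1 :=
  (p.toOuterMeasure.mono (Set.subset_univ s)).trans
    ((PMF.toOuterMeasure_apply_eq_one_iff p (s := Set.univ)).2 (Set.subset_univ _)).le

lemma toOuterMeasure_uniformOfFinset_bind {α β : Type*} (P : Finset α) (hP : P.Nonempty)
    (f : α → PMF β) (s : Set β) :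
    ((PMF.uniformOfFinset P hP).bind f).toOuterMeasure s =
      (#P : ENNReal)⁻¹ * ∑ a ∈ P, (f a).toOuterMeasure s := by
  classical
  rw [PMF.toOuterMeasure_bind_apply, tsum_eq_sum (s := P), mul_sum]
  · refine sum_congr rfl fun a ha => ?_
    rw [PMF.uniformOfFinset_apply_of_mem hP ha]
  · intro a ha
    rw [PMF.uniformOfFinset_apply_of_notMem hP ha, zero_mul]

/-- The exponential moment method for the random greedy algorithm. The choice of `A` adds the cost
`e x A` to each edge `x` still to be treated, `μ x y` bounds the logarithm of the exponential moment
of the cost that the treatment of `y` adds to `x`, and `x` has at least half of its absorbers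
permissible unless its cost reaches the threshold `T`. -/
theorem greedyAux_failure_le {k : ℕ} {π : Fin n ↪ Fˣ} {H S : Hypergraph n}
    (habs : ∀ x ∈ S, (absorbers k π H x).Nonempty)
    (e : Finset (Fin n) → Hypergraph n → ℝ) (μ : Finset (Fin n) → Finset (Fin n) → ℝ) (T : ℝ)
    (h1 : ∀ x ∈ S, ∀ hist : List (Hypergraph n), (∀ B ∈ hist, FacetDisjoint k B {x}) →
      ¬ HalfPermissible k π H S hist x → T ≤ (hist.map (e x)).sum)
    (h2 : ∀ x ∈ S, ∀ y ∈ S, ∀ P ⊆ absorbers k π H y, #(absorbers k π H y) ≤ 2 * #P →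
      ∑ A ∈ P, Real.exp (e x A) ≤ #P * Real.exp (μ x y))
    (hμ : ∀ x y, 0 ≤ μ x y) (rest : List (Finset (Fin n))) (hist : List (Hypergraph n))
    (hnodup : rest.Nodup) (hrest : ∀ x ∈ rest, x ∈ S)
    (hhist : ∀ x ∈ rest, ∀ B ∈ hist, FacetDisjoint k B {x}) :
    (greedyAux k π H S rest hist).toOuterMeasure (auxSuccess k π H S rest hist)ᶜ ≤
      ENNReal.ofReal (rest.map fun x =>
        Real.exp (-T + (hist.map (e x)).sum + (rest.map (μ x)).sum)).sum := by
  induction rest generalizing hist with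
  | nil =>
    simp only [greedyAux, PMF.toOuterMeasure_pure_apply]
    rw [if_neg]
    · simp
    · simp only [Set.mem_compl_iff, not_not]
      exact ⟨[], by simp, rfl, fun i => i.elim0⟩
  | cons y rest ih =>
    obtain ⟨hy, hnodup⟩ := List.nodup_cons.1 hnodup
    have hyS : y ∈ S := hrest y (by simp)
    have hnn : ∀ (l : List (Finset (Fin n))) (φ : Finset (Fin n) → ℝ),
        0 ≤ (l.map fun x => Real.exp (φ x)).sum := fun l φ => by
      apply List.sum_nonneg
      simp only [List.mem_map]
      rintro _ ⟨x, -, rfl⟩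
      positivity
    by_cases hhalf : HalfPermissible k π H S hist y
    · have hP : (permissible k π H S hist y).Nonempty := by
        have := (habs y hyS).card_pos
        rw [HalfPermissible] at hhalf
        rw [← card_pos]
        omega
      rw [greedyAux, dif_pos hP, toOuterMeasure_uniformOfFinset_bind]
      set P := permissible k π H S hist y with hPdef
      have hPc : (0 : ℝ) < #P := by exact_mod_cast hP.card_pos
      have hstep : ∀ A ∈ P, (greedyAux k π H S rest (hist ++ [A])).toOuterMeasure
          (auxSuccess k π H S (y :: rest) hist)ᶜ ≤ ENNReal.ofReal (rest.map fun x =>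
            Real.exp (-T + ((hist ++ [A]).map (e x)).sum + (rest.map (μ x)).sum)).sum := by
        intro A hA
        refine (MeasureTheory.measure_mono (Set.compl_subset_compl.2
          (auxSuccess_cons_subset hhalf A))).trans
          (ih (hist ++ [A]) hnodup (fun x hx => hrest x (by simp [hx])) ?_)
        intro x hx B hB
        rcases List.mem_append.1 hB with hB | hB
        · exact hhist x (by simp [hx]) B hB
        · obtain rfl : B = A := by simpa using hB
          have hdis := (mem_permissible.1 hA).2.2
          refine Disjoint.mono_right ?_ hdis
          refine biUnion_subset_biUnion_of_subset_left _ ?_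
          rw [singleton_subset_iff, mem_erase]
          exact ⟨by rintro rfl; exact hy hx, hrest x (by simp [hx])⟩
      calc _ ≤ (#P : ENNReal)⁻¹ * ∑ A ∈ P, ENNReal.ofReal (rest.map fun x =>
            Real.exp (-T + ((hist ++ [A]).map (e x)).sum + (rest.map (μ x)).sum)).sum := by
            gcongr with A hA
            exact hstep A hA
        _ = ENNReal.ofReal ((#P : ℝ)⁻¹ * ∑ A ∈ P, (rest.map fun x =>
            Real.exp (-T + ((hist ++ [A]).map (e x)).sum + (rest.map (μ x)).sum)).sum) := by
            rw [ENNReal.ofReal_mul (by positivity), ENNReal.ofReal_inv_of_pos hPc,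
              ENNReal.ofReal_natCast, ENNReal.ofReal_sum_of_nonneg fun A _ => hnn _ _]
        _ ≤ _ := by
            apply ENNReal.ofReal_le_ofReal
            rw [inv_mul_le_iff₀ hPc, List.map_cons, List.sum_cons]
            rw [sum_list_sum_map, mul_add]
            refine le_trans ?_ (le_add_of_nonneg_left (by positivity))
            rw [← List.sum_map_mul_left]
            refine List.sum_le_sum fun x hx => ?_
            have hxS : x ∈ S := hrest x (by simp [hx])
            have := h2 x hxS y hyS P permissible_subset hhalf
            calc ∑ A ∈ P, Real.exp (-T + ((hist ++ [A]).map (e x)).sum + (rest.map (μ x)).sum)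
                = Real.exp (-T + (hist.map (e x)).sum + (rest.map (μ x)).sum) *
                    ∑ A ∈ P, Real.exp (e x A) := by
                  rw [mul_sum]
                  refine sum_congr rfl fun A _ => ?_
                  rw [← Real.exp_add]
                  congr 1
                  simp
                  ring
              _ ≤ Real.exp (-T + (hist.map (e x)).sum + (rest.map (μ x)).sum) *
                    (#P * Real.exp (μ x y)) := by gcongr
              _ = _ := by
                  rw [List.map_cons, List.sum_cons, mul_left_comm, ← Real.exp_add]
                  congr 2
                  ring
    · refine (toOuterMeasure_le_one _ _).trans ?_
      rw [← ENNReal.ofReal_one]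
      apply ENNReal.ofReal_le_ofReal
      rw [List.map_cons, List.sum_cons]
      have hT := h1 y hyS hist (hhist y (by simp)) hhalf
      have hμs : 0 ≤ ((y :: rest).map (μ y)).sum := by
        apply List.sum_nonneg
        simp only [List.mem_map]
        rintro _ ⟨x, -, rfl⟩
        exact hμ _ _
      have := Real.one_le_exp (show 0 ≤ -T + (hist.map (e y)).sum + ((y :: rest).map (μ y)).sum by
        linarith)
      linarith [hnn rest fun x => -T + (hist.map (e x)).sum + ((y :: rest).map (μ x)).sum]

lemma auxSuccess_nil_eq {k : ℕ} {π : Fin n ↪ Fˣ} {H : Hypergraph n} (s : List (Finset (Fin n))) :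
    auxSuccess k π H s.toFinset s [] = greedySuccess k π H s := by
  simp [auxSuccess, greedySuccess, HalfPermissible]

end Greedy

/-! ### Conflicts between absorbers -/

section Conflicts

open scoped Classical

variable {n d : ℕ} {F : Type} [Field F] {π : Fin n ↪ Fˣ} {H L S : Hypergraph n}

/-- The absorbers for `x` that share with `B` a facet outside `L`. -/
noncomputable def conflicts (k : ℕ) (π : Fin n ↪ Fˣ) (H L : Hypergraph n) (x : Finset (Fin n))
    (B : Hypergraph n) : Finset (Hypergraph n) :=
  {A ∈ absorbers k π H x | ∃ f ∈ facets k A, f ∈ facets k B ∧ f ∉ L}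

lemma card_of_mem_facets {G : Hypergraph n} {f : Finset (Fin n)} (hf : f ∈ facets (d + 1) G) :
    #f = d := by
  obtain ⟨e, -, he⟩ := mem_biUnion.1 hf
  exact (mem_powersetCard.1 he).2

lemma card_conflicts_le_sum (x : Finset (Fin n)) (B : Hypergraph n) :
    #(conflicts (d + 1) π H L x B) ≤
      ∑ f ∈ (facets (d + 1) B).filter (· ∉ L),
        #{A ∈ absorbers (d + 1) π H x | f ∈ facets (d + 1) A} := by
  refine le_trans (card_le_card fun A hA => ?_) card_biUnion_le
  obtain ⟨hA, f, hfA, hfB, hfL⟩ := mem_filter.1 hA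
  exact mem_biUnion.2 ⟨f, mem_filter.2 ⟨hfB, hfL⟩, mem_filter.2 ⟨hA, hfA⟩⟩

/-- An absorber for `x` that is not permissible meets another edge of the decomposition or has a
conflict outside `L` with an absorber chosen before. -/
lemma card_absorbers_le_of_isDecomposition (hS : IsDecomposition (d + 1) S L) {x : Finset (Fin n)}
    (hx : x ∈ S) (hist : List (Hypergraph n))
    (hhist : ∀ B ∈ hist, FacetDisjoint (d + 1) B {x}) :
    #(absorbers (d + 1) π H x) ≤ #(permissible (d + 1) π H S hist x) +
      #{A ∈ absorbers (d + 1) π H x | ¬ FacetDisjoint (d + 1) A (S.erase x)} +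
      (hist.map fun B => #(conflicts (d + 1) π H L x B)).sum := by
  have hlist : ∀ l : List (Hypergraph n),
      #{A ∈ absorbers (d + 1) π H x | ∃ B ∈ l, A ∈ conflicts (d + 1) π H L x B} ≤
        (l.map fun B => #(conflicts (d + 1) π H L x B)).sum := by
    intro l
    induction l with
    | nil => simp
    | cons B l ih =>
      rw [List.map_cons, List.sum_cons]
      refine le_trans (card_le_card (t := conflicts (d + 1) π H L x B ∪
        {A ∈ absorbers (d + 1) π H x | ∃ B ∈ l, A ∈ conflicts (d + 1) π H L x B})
        fun A hA => ?_) ((card_union_le _ _).trans (by gcongr))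
      obtain ⟨hA, B', hB', h⟩ := mem_filter.1 hA
      rcases List.mem_cons.1 hB' with rfl | hB'
      · exact mem_union_left _ h
      · exact mem_union_right _ (mem_filter.2 ⟨hA, B', hB', h⟩)
  refine le_trans (card_le_card (t := permissible (d + 1) π H S hist x ∪
    ({A ∈ absorbers (d + 1) π H x | ¬ FacetDisjoint (d + 1) A (S.erase x)} : Finset _) ∪
    {A ∈ absorbers (d + 1) π H x | ∃ B ∈ hist, A ∈ conflicts (d + 1) π H L x B}) fun A hA => ?_)
    ((card_union_le _ _).trans (add_le_add (card_union_le _ _) (hlist hist)))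
  by_cases h1 : FacetDisjoint (d + 1) A (S.erase x)
  · by_cases h2 : ∀ B ∈ hist, FacetDisjoint (d + 1) A B
    · exact mem_union_left _ (mem_union_left _ (mem_permissible.2 ⟨hA, h2, h1⟩))
    · refine mem_union_right _ (mem_filter.2 ⟨hA, ?_⟩)
      push Not at h2
      obtain ⟨B, hB, hAB⟩ := h2
      obtain ⟨f, hfA, hfB⟩ := not_disjoint_iff.1 hAB
      refine ⟨B, hB, mem_filter.2 ⟨hA, f, hfA, hfB, fun hfL => ?_⟩⟩
      obtain ⟨e, ⟨he, hfe⟩, -⟩ := hS.2 f hfL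
      have hfe' : f ∈ e.powersetCard d := mem_powersetCard.2 ⟨hfe, card_of_mem_facets hfA⟩
      by_cases hex : e = x
      · subst hex
        exact disjoint_left.1 (hhist B hB) hfB (by simpa [facets] using hfe')
      · exact disjoint_left.1 h1 hfA (mem_biUnion.2 ⟨e, mem_erase.2 ⟨hex, he⟩, hfe'⟩)
  · exact mem_union_left _ (mem_union_right _ (mem_filter.2 ⟨hA, h1⟩))

lemma sum_card_conflicts_comm (x y : Finset (Fin n)) :
    (∑ A ∈ absorbers (d + 1) π H y, (#(conflicts (d + 1) π H L x A) : ℝ)) =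
      ∑ B ∈ absorbers (d + 1) π H x, (#(conflicts (d + 1) π H L y B) : ℝ) := by
  simp only [conflicts, card_filter, Nat.cast_sum]
  rw [sum_comm]
  refine sum_congr rfl fun B _ => sum_congr rfl fun A _ => ?_
  congr 1
  exact if_congr ⟨fun ⟨f, h1, h2, h3⟩ => ⟨f, h2, h1, h3⟩,
    fun ⟨f, h1, h2, h3⟩ => ⟨f, h2, h1, h3⟩⟩ rfl rfl

lemma exp_le_one_add_two_mul {t : ℝ} (h0 : 0 ≤ t) (h1 : t ≤ 1) : Real.exp t ≤ 1 + 2 * t := by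
  have := (abs_le.1 (Real.abs_exp_sub_one_sub_id_le (abs_le.2 ⟨by linarith, h1⟩))).2
  nlinarith

/-- The failure probability of the random greedy algorithm, in terms of a lower bound `X` for the
number of absorbers of an edge, a bound `Φ` for the number of facets of an absorber, a bound `V` for
the number of absorbers of an edge with a given facet, and a bound `W` for the total number of
absorbers with a given facet. -/
theorem greedy_failure_le (s : List (Finset (Fin n))) (hs : s.Nodup)
    (hS : IsDecomposition (d + 1) s.toFinset L) {X V W Φ : ℝ} (hX : 0 < X) (hV : 0 < V)
    (hΦ : 0 < Φ) (hW : 0 ≤ W) (hXW : 32 * Φ * W ≤ X)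
    (habs : ∀ x ∈ s, X ≤ #(absorbers (d + 1) π H x))
    (hdis : ∀ x ∈ s, (#{A ∈ absorbers (d + 1) π H x |
      ¬ FacetDisjoint (d + 1) A (s.toFinset.erase x)} : ℝ) ≤ X / 4)
    (hmax : ∀ x ∈ s, ∀ f, #f = d → f ∉ L →
      (#{A ∈ absorbers (d + 1) π H x | f ∈ facets (d + 1) A} : ℝ) ≤ V)
    (hsum : ∀ f, #f = d → f ∉ L →
      (∑ x ∈ s.toFinset, (#{A ∈ absorbers (d + 1) π H x | f ∈ facets (d + 1) A} : ℝ)) ≤ W)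
    (hfac : ∀ x ∈ s, ∀ A ∈ absorbers (d + 1) π H x, (#(facets (d + 1) A) : ℝ) ≤ Φ) :
    (greedy (d + 1) π H s).toOuterMeasure (greedySuccess (d + 1) π H s)ᶜ ≤
      ENNReal.ofReal (s.length * Real.exp (-(X / (8 * Φ * V)))) := by
  obtain ⟨a, ha⟩ : ∃ a : Finset (Fin n) → ℝ, ∀ x, a x = #(absorbers (d + 1) π H x) :=
    ⟨_, fun _ => rfl⟩
  simp only [← ha] at habs
  have ha0 : ∀ x ∈ s, 0 < a x := fun x hx => hX.trans_le (habs x hx)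
  obtain ⟨g, hg⟩ : ∃ g : Finset (Fin n) → Hypergraph n → ℝ,
      ∀ x B, g x B = #(conflicts (d + 1) π H L x B) / a x := ⟨_, fun _ _ => rfl⟩
  have hg0 : ∀ x B, 0 ≤ g x B := fun x B => by
    rw [hg, ha]
    exact div_nonneg (Nat.cast_nonneg _) (Nat.cast_nonneg _)
  -- the scale at which a single choice costs at most `1`
  obtain ⟨lam, hlam⟩ : ∃ lam : ℝ, lam = X / (Φ * V) := ⟨_, rfl⟩
  have hlam0 : 0 < lam := by rw [hlam]; positivity
  obtain ⟨μ, hμ⟩ : ∃ μ : Finset (Fin n) → Finset (Fin n) → ℝ,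
      ∀ x y, μ x y = 4 * lam * (∑ A ∈ absorbers (d + 1) π H y, g x A) / a y :=
    ⟨_, fun _ _ => rfl⟩
  have hμ0 : ∀ x y, 0 ≤ μ x y := fun x y => by
    have := sum_nonneg fun A (_ : A ∈ absorbers (d + 1) π H y) => hg0 x A
    rw [hμ, ha]
    exact div_nonneg (mul_nonneg (by linarith) this) (Nat.cast_nonneg _)
  have hcost : ∀ x ∈ s, ∀ y ∈ s, ∀ A ∈ absorbers (d + 1) π H y, lam * g x A ≤ 1 := by
    intro x hx y hy A hA
    have h1 : (#(conflicts (d + 1) π H L x A) : ℝ) ≤ Φ * V := by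
      calc (#(conflicts (d + 1) π H L x A) : ℝ)
          ≤ ∑ f ∈ (facets (d + 1) A).filter (· ∉ L),
            (#{A ∈ absorbers (d + 1) π H x | f ∈ facets (d + 1) A} : ℝ) := by
            exact_mod_cast card_conflicts_le_sum x A
        _ ≤ ∑ f ∈ (facets (d + 1) A).filter (· ∉ L), V := by
            refine sum_le_sum fun f hf => ?_
            obtain ⟨hf, hfL⟩ := mem_filter.1 hf
            exact hmax x hx f (card_of_mem_facets hf) hfL
        _ ≤ Φ * V := by
            rw [sum_const, nsmul_eq_mul]
            gcongr
            exact le_trans (by exact_mod_cast card_filter_le _ _) (hfac y hy A hA)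
    rw [hlam, hg, div_mul_div_comm, div_le_one (mul_pos (by positivity) (ha0 x hx)), mul_comm]
    gcongr
    exact habs x hx
  have hμsum : ∀ x ∈ s, ∑ y ∈ s.toFinset, μ x y ≤ lam / 8 := by
    intro x hx
    have h1 : ∑ y ∈ s.toFinset, ∑ A ∈ absorbers (d + 1) π H y, g x A ≤ Φ * W := by
      have h2 : ∀ B ∈ absorbers (d + 1) π H x,
          ∑ y ∈ s.toFinset, (#(conflicts (d + 1) π H L y B) : ℝ) ≤ Φ * W := by
        intro B hB
        calc ∑ y ∈ s.toFinset, (#(conflicts (d + 1) π H L y B) : ℝ)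
            ≤ ∑ y ∈ s.toFinset, ∑ f ∈ (facets (d + 1) B).filter (· ∉ L),
              (#{A ∈ absorbers (d + 1) π H y | f ∈ facets (d + 1) A} : ℝ) :=
              sum_le_sum fun y _ => by exact_mod_cast card_conflicts_le_sum y B
          _ = ∑ f ∈ (facets (d + 1) B).filter (· ∉ L), ∑ y ∈ s.toFinset,
              (#{A ∈ absorbers (d + 1) π H y | f ∈ facets (d + 1) A} : ℝ) := sum_comm
          _ ≤ ∑ f ∈ (facets (d + 1) B).filter (· ∉ L), W := by
              refine sum_le_sum fun f hf => ?_
              obtain ⟨hf, hfL⟩ := mem_filter.1 hf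
              exact hsum f (card_of_mem_facets hf) hfL
          _ ≤ Φ * W := by
              rw [sum_const, nsmul_eq_mul]
              gcongr
              exact le_trans (by exact_mod_cast card_filter_le _ _) (hfac x hx B hB)
      simp only [hg, ← sum_div, sum_card_conflicts_comm x]
      rw [sum_comm, div_le_iff₀ (ha0 x hx)]
      refine (sum_le_card_nsmul _ _ _ h2).trans ?_
      rw [nsmul_eq_mul, mul_comm, ha]
    calc ∑ y ∈ s.toFinset, μ x y
        ≤ ∑ y ∈ s.toFinset, 4 * lam * (∑ A ∈ absorbers (d + 1) π H y, g x A) / X := by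
          refine sum_le_sum fun y hy => ?_
          have := sum_nonneg fun A (_ : A ∈ absorbers (d + 1) π H y) => hg0 x A
          simp only [hμ]
          gcongr
          exact habs y (List.mem_toFinset.1 hy)
      _ = 4 * lam * (∑ y ∈ s.toFinset, ∑ A ∈ absorbers (d + 1) π H y, g x A) / X := by
          rw [← sum_div, ← mul_sum]
      _ ≤ 4 * lam * (Φ * W) / X := by gcongr
      _ ≤ lam / 8 := by
          rw [div_le_iff₀ hX]
          nlinarith
  have hmain := greedyAux_failure_le (k := d + 1) (π := π) (H := H) (S := s.toFinset)
    (fun x hx => card_pos.1 (by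
      have := ha0 x (List.mem_toFinset.1 hx)
      rw [ha] at this
      exact_mod_cast this))
    (fun x A => lam * g x A) μ (lam / 4) ?_ ?_ hμ0 s [] hs (fun x hx => List.mem_toFinset.2 hx)
    (by simp)
  · rw [auxSuccess_nil_eq] at hmain
    refine hmain.trans (ENNReal.ofReal_le_ofReal ?_)
    rw [← nsmul_eq_mul, ← List.length_map (as := s) (f := fun x => Real.exp (-(lam / 4) +
      (([] : List (Hypergraph n)).map fun A => lam * g x A).sum + (s.map (μ x)).sum))]
    refine List.sum_le_card_nsmul _ _ ?_
    simp only [List.mem_map]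
    rintro _ ⟨x, hx, rfl⟩
    have h := hμsum x hx
    rw [List.sum_toFinset _ hs] at h
    have h8 : X / (8 * Φ * V) = lam / 8 := by rw [hlam]; field_simp
    rw [h8]
    apply Real.exp_le_exp.2
    simp only [List.map_nil, List.sum_nil]
    linarith
  · intro x hx hist hhist hhalf
    have hxs := List.mem_toFinset.1 hx
    have h1 := card_absorbers_le_of_isDecomposition (π := π) (H := H) hS hx hist hhist
    have h2 := hdis x hxs
    have h3 := habs x hxs
    rw [HalfPermissible, not_le] at hhalf
    rw [← Nat.cast_lt (α := ℝ), Nat.cast_mul, Nat.cast_ofNat, ← ha] at hhalf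
    have h1' : a x ≤ #(permissible (d + 1) π H s.toFinset hist x) +
      (#{A ∈ absorbers (d + 1) π H x | ¬ FacetDisjoint (d + 1) A (s.toFinset.erase x)} : ℝ) +
      (hist.map fun B => (#(conflicts (d + 1) π H L x B) : ℝ)).sum := by
      have : ((hist.map fun B => #(conflicts (d + 1) π H L x B)).sum : ℝ) =
          (hist.map fun B => (#(conflicts (d + 1) π H L x B) : ℝ)).sum := by
        rw [Nat.cast_list_sum, List.map_map]; rfl
      rw [← this, ha]
      exact_mod_cast h1
    have h5 : (hist.map fun A => lam * g x A).sum =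
        lam * ((hist.map fun B => (#(conflicts (d + 1) π H L x B) : ℝ)).sum / a x) := by
      rw [List.sum_map_mul_left, div_eq_mul_inv, ← List.sum_map_mul_right]
      rw [show g x = fun B => #(conflicts (d + 1) π H L x B) * (a x)⁻¹ from
        funext fun B => by rw [hg, div_eq_mul_inv]]
    rw [h5, div_eq_mul_one_div]
    refine mul_le_mul_of_nonneg_left ?_ hlam0.le
    rw [le_div_iff₀ (ha0 x hxs)]
    linarith
  · intro x hx y hy P hP hcard
    have hxs := List.mem_toFinset.1 hx
    have hys := List.mem_toFinset.1 hy
    have hcard' : a y ≤ 2 * #P := by rw [ha]; exact_mod_cast hcard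
    calc ∑ A ∈ P, Real.exp (lam * g x A) ≤ ∑ A ∈ P, (1 + 2 * (lam * g x A)) :=
          sum_le_sum fun A hA => exp_le_one_add_two_mul (mul_nonneg hlam0.le (hg0 x A))
            (hcost x hxs y hys A (hP hA))
      _ = #P + 2 * lam * ∑ A ∈ P, g x A := by
          rw [sum_add_distrib, sum_const, mul_sum]
          simp only [nsmul_eq_mul, mul_one, mul_assoc]
      _ ≤ #P + 2 * lam * ∑ A ∈ absorbers (d + 1) π H y, g x A := by
          gcongr
          exact fun A _ _ => hg0 x A
      _ = #P + a y / 2 * μ x y := by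
          rw [hμ]
          have := (ha0 y hys).ne'
          field_simp
          ring
      _ ≤ #P + #P * μ x y := by
          have := hμ0 x y
          gcongr
          linarith
      _ = #P * (μ x y + 1) := by ring
      _ ≤ #P * Real.exp (μ x y) := by
          gcongr
          exact Real.add_one_le_exp _

end Conflicts

/-! ### Success of the random greedy algorithm -/

section Asymptotics

lemma eventually_rpow_neg_le {a κ : ℝ} (ha : 0 < a) (hκ : 0 < κ) :
    ∀ᶠ n : ℕ in atTop, (n : ℝ) ^ (-a) ≤ κ :=
  ((tendsto_rpow_neg_atTop ha).comp tendsto_natCast_atTop_atTop).eventually_le_const hκ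

lemma eventually_mul_exp_neg_le {a κ : ℝ} (ha : 0 < a) (hκ : 0 < κ) (r D : ℝ) :
    ∀ᶠ n : ℕ in atTop, (n : ℝ) ^ r * Real.exp (-(κ * (n : ℝ) ^ a)) ≤ (n : ℝ) ^ (-D) := by
  have h1 : Tendsto (fun n : ℕ => (n : ℝ) ^ a) atTop atTop :=
    (tendsto_rpow_atTop ha).comp tendsto_natCast_atTop_atTop
  have h2 := ((tendsto_rpow_mul_exp_neg_mul_atTop_nhds_zero ((r + D) / a) κ hκ).comp
    h1).eventually_le_const zero_lt_one
  filter_upwards [h2, eventually_gt_atTop 0] with n hn hn0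
  have hn0' : (0 : ℝ) < n := by exact_mod_cast hn0
  simp only [Function.comp] at hn
  rw [← Real.rpow_mul hn0'.le, mul_div_cancel₀ _ ha.ne', Real.rpow_add hn0', neg_mul] at hn
  rw [Real.rpow_neg hn0'.le, ← one_div, le_div_iff₀ (by positivity)]
  linarith

end Asymptotics

section GreedyAsymptotics

variable {n d : ℕ} {F : Type} [Field F] {π : Fin n ↪ Fˣ} {H : Hypergraph n}

lemma card_facets_absorber_le {k : ℕ} {x : Finset (Fin n)} {A : Hypergraph n}
    (hA : A ∈ absorbers k π H x) : #(facets k A) ≤ (2 ^ k + 2 ^ k * 2 ^ k) * 2 ^ k := by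
  obtain ⟨y, a, b, -, -, rfl⟩ := mem_absorbers.1 hA
  have hpow : ∀ P : Finset (Fin k) → Prop, ∀ [DecidablePred P],
      #({I | P I} : Finset (Finset (Fin k))) ≤ 2 ^ k := fun P _ =>
    (card_filter_le _ _).trans (by simp)
  have h1 : ∀ e ∈ absorberGraph y a b, #(e.powersetCard (k - 1)) ≤ 2 ^ k := by
    intro e he
    have hek : #e ≤ k := by
      have : ∃ t : Fin k → Fin n, e = univ.image t := by
        simp only [absorberGraph, mem_union, mem_image, mem_biUnion] at he
        rcases he with ⟨I, -, rfl⟩ | ⟨I, -, J, -, rfl⟩ <;> exact ⟨_, rfl⟩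
      obtain ⟨t, rfl⟩ := this
      exact card_image_le.trans (by simp)
    calc #(e.powersetCard (k - 1)) ≤ #e.powerset := card_le_card fun _ hf =>
          mem_powerset.2 (mem_powersetCard.1 hf).1
      _ = 2 ^ #e := card_powerset e
      _ ≤ 2 ^ k := by gcongr; norm_num
  refine (card_biUnion_le_card_mul _ _ _ h1).trans ?_
  gcongr
  refine (card_union_le _ _).trans (add_le_add (card_image_le.trans (hpow _)) ?_)
  refine (card_biUnion_le_card_mul _ _ (2 ^ k) fun I _ => card_image_le.trans (hpow _)).trans ?_
  gcongr
  exact hpow _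

lemma ncard_vectorImage_le {L : Hypergraph n} (hL : ∀ f ∈ L, #f = d) :
    (vectorImage d π L).ncard ≤ d ^ d * #L := by
  classical
  have hsub : vectorImage d π L ⊆
      ((L.biUnion fun f => orderings d f).image fun y i => (π (y i) : F) : Finset (Fin d → F)) := by
    rintro v ⟨y, hy, hyL, rfl⟩
    rw [mem_coe]
    exact mem_image_of_mem _ (mem_biUnion.2 ⟨_, hyL, by simp [orderings, hy]⟩)
  refine (Set.ncard_le_ncard hsub (finite_toSet _)).trans ?_
  rw [Set.ncard_coe_finset]
  refine card_image_le.trans ?_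
  rw [mul_comm]
  exact card_biUnion_le_card_mul _ _ _ fun f hf => card_orderings_le (hL f hf)

/-- The analysis of the random greedy algorithm: the number of absorbers of an edge exceeds by a
power of `n` the numbers of absorbers lost through other edges of the decomposition and, in
expectation, through absorbers chosen before; a single choice destroys so few absorbers that the
deviation from the expectation is negligible. -/
theorem eventually_greedy_failure_le (d : ℕ) {η C δ c : ℝ} (hη : η < 1) (hηδ : η < δ)
    (hC : 0 < C) (hc : 0 < c) (D : ℝ) :
    ∀ᶠ n : ℕ in atTop, ∀ (F : Type) [Field F] [Fintype F], n ≤ Fintype.card F →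
      Fintype.card F ≤ 4 * n → ∀ (π : Fin n ↪ Fˣ) (H : Hypergraph n),
      (∀ x ∈ complete n (d + 1),
        c * (n : ℝ) ^ (((d + 1 : ℕ) : ℝ) - η) ≤ #(absorbers (d + 1) π H x)) →
      ∀ L : Hypergraph n, (∀ f ∈ L, #f = d) → AffineBounded d C (vectorImage d π L) →
      (#L : ℝ) ≤ (n : ℝ) ^ (-δ) * (n : ℝ) ^ d →
      ∀ s : List (Finset (Fin n)), s.Nodup → IsDecomposition (d + 1) s.toFinset L →
        (greedy (d + 1) π H s).toOuterMeasure (greedySuccess (d + 1) π H s)ᶜ ≤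
          ENNReal.ofReal ((n : ℝ) ^ (-D)) := by
  classical
  obtain ⟨P, hP⟩ : ∃ P : ℝ, P = numPositions d := ⟨_, rfl⟩
  have hP0 : 0 < P := by rw [hP, numPositions]; positivity
  obtain ⟨Φ, hΦ⟩ : ∃ Φ : ℝ, Φ = ((2 ^ (d + 1) + 2 ^ (d + 1) * 2 ^ (d + 1)) * 2 ^ (d + 1) : ℕ) :=
    ⟨_, rfl⟩
  have hΦ0 : 0 < Φ := by rw [hΦ]; positivity
  obtain ⟨dd, hdd⟩ : ∃ x : ℝ, x = (d : ℝ) ^ d := ⟨_, rfl⟩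
  have hdd0 : 0 < dd := by
    rw [hdd]
    rcases Nat.eq_zero_or_pos d with rfl | h
    · simp
    · positivity
  obtain ⟨kk, hkk⟩ : ∃ x : ℝ, x = ((d : ℝ) + 1) ^ (d + 1) := ⟨_, rfl⟩
  have hkk0 : 0 < kk := by rw [hkk]; positivity
  obtain ⟨K, hK⟩ : ∃ K : ℝ, K = C * 4 ^ (d + 1) * dd := ⟨_, rfl⟩
  have hK0 : 0 < K := by rw [hK]; positivity
  obtain ⟨κ, hκ⟩ : ∃ κ : ℝ, κ = c / (8 * Φ * (kk * (P * (dd * 4 ^ d)))) := ⟨_, rfl⟩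
  have hκ0 : 0 < κ := by rw [hκ]; positivity
  have ev1 := eventually_rpow_neg_le (sub_pos.2 hηδ) (κ := c / (4 * (kk * (P * K))))
    (by positivity)
  have ev2 := eventually_rpow_neg_le (sub_pos.2 hηδ) (κ := c / (32 * Φ * (P * (dd * K))))
    (by positivity)
  have ev3 := eventually_mul_exp_neg_le (sub_pos.2 hη) hκ0 ((d + 1 : ℕ) : ℝ) D
  filter_upwards [ev1, ev2, ev3, eventually_ge_atTop 1] with n ev1 ev2 ev3 hn F _ _ hq hq4 π H habs
    L hLd hL hLn s hs hS
  have hn0 : (0 : ℝ) < n := by exact_mod_cast hn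
  have hqn : (n : ℝ) ≤ Fintype.card F := by exact_mod_cast hq
  have hq4n : (Fintype.card F : ℝ) ≤ 4 * n := by exact_mod_cast hq4
  have hq0 : (0 : ℝ) < Fintype.card F := hn0.trans_le hqn
  obtain ⟨B, hB⟩ : ∃ B : ℝ, B = C * (Fintype.card F : ℝ) ^ (d + 1) *
    (((vectorImage d π L).ncard : ℝ) / (Fintype.card F : ℝ) ^ d) := ⟨_, rfl⟩
  have hB0 : 0 ≤ B := by rw [hB]; positivity
  have hBle : B ≤ K * (n : ℝ) ^ (((d + 1 : ℕ) : ℝ) - δ) := by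
    have h1 : ((vectorImage d π L).ncard : ℝ) ≤ dd * ((n : ℝ) ^ (-δ) * (n : ℝ) ^ d) := by
      have : ((vectorImage d π L).ncard : ℝ) ≤ dd * #L := by
        rw [hdd]; exact_mod_cast ncard_vectorImage_le hLd
      exact this.trans (by gcongr)
    calc B ≤ C * (4 * (n : ℝ)) ^ (d + 1) *
          (dd * ((n : ℝ) ^ (-δ) * (n : ℝ) ^ d) / (n : ℝ) ^ d) := by rw [hB]; gcongr
      _ = K * ((n : ℝ) ^ (d + 1) * (n : ℝ) ^ (-δ)) := by
          rw [hK, mul_pow]; field_simp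
      _ = _ := by
          rw [sub_eq_add_neg, Real.rpow_add hn0, Real.rpow_natCast]
  have hsplit : (n : ℝ) ^ (((d + 1 : ℕ) : ℝ) - δ) =
      (n : ℝ) ^ (-(δ - η)) * (n : ℝ) ^ (((d + 1 : ℕ) : ℝ) - η) := by
    rw [← Real.rpow_add hn0]; congr 1; ring
  have hkset : ∀ x ∈ s, x ∈ complete n (d + 1) := fun x hx =>
    mem_powersetCard.2 ⟨subset_univ _, (hS.1 x (List.mem_toFinset.2 hx)).1⟩
  have hX0 : 0 < (n : ℝ) ^ (((d + 1 : ℕ) : ℝ) - η) := by positivity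
  rw [le_div_iff₀ (by positivity)] at ev1 ev2
  have hfail := greedy_failure_le (π := π) (H := H) s hs hS
    (X := c * (n : ℝ) ^ (((d + 1 : ℕ) : ℝ) - η))
    (V := kk * (P * (dd * (4 * n) ^ d))) (W := P * (dd * B)) (Φ := Φ)
    (by positivity) (by positivity) hΦ0 (by positivity) ?_ (fun x hx => habs x (hkset x hx))
    ?_ ?_ ?_ ?_
  · refine hfail.trans (ENNReal.ofReal_le_ofReal (le_trans ?_ ev3))
    have hlen : (s.length : ℝ) ≤ (n : ℝ) ^ ((d + 1 : ℕ) : ℝ) := by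
      rw [Real.rpow_natCast, ← List.toFinset_card_of_nodup hs]
      have : #s.toFinset ≤ n ^ (d + 1) := by
        refine (card_le_card (t := complete n (d + 1)) fun x hx =>
          hkset x (List.mem_toFinset.1 hx)).trans ?_
        rw [complete, card_powersetCard, card_univ, Fintype.card_fin]
        exact Nat.choose_le_pow _ _
      exact_mod_cast this
    have hexp : c * (n : ℝ) ^ (((d + 1 : ℕ) : ℝ) - η) /
        (8 * Φ * (kk * (P * (dd * (4 * n) ^ d)))) = κ * (n : ℝ) ^ (1 - η) := by
      have : (n : ℝ) ^ (((d + 1 : ℕ) : ℝ) - η) = (n : ℝ) ^ (1 - η) * (n : ℝ) ^ d := by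
        rw [← Real.rpow_natCast, ← Real.rpow_add hn0]
        congr 1
        push_cast
        ring
      rw [this, hκ, mul_pow]
      field_simp
    rw [hexp]
    gcongr
  · rw [hsplit] at hBle
    calc 32 * Φ * (P * (dd * B)) ≤ 32 * Φ * (P * (dd * (K * ((n : ℝ) ^ (-(δ - η)) *
          (n : ℝ) ^ (((d + 1 : ℕ) : ℝ) - η))))) := by gcongr
      _ = ((n : ℝ) ^ (-(δ - η)) * (32 * Φ * (P * (dd * K)))) *
          (n : ℝ) ^ (((d + 1 : ℕ) : ℝ) - η) := by ring
      _ ≤ _ := by gcongr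
  · intro x hx
    refine (card_absorbers_not_facetDisjoint_le hS hL hC.le (List.mem_toFinset.2 hx)).trans ?_
    rw [← hB, ← hkk, ← hP]
    rw [hsplit] at hBle
    rw [le_div_iff₀ (by norm_num)]
    calc kk * (P * B) * 4 ≤ kk * (P * (K * ((n : ℝ) ^ (-(δ - η)) *
          (n : ℝ) ^ (((d + 1 : ℕ) : ℝ) - η)))) * 4 := by gcongr
      _ = ((n : ℝ) ^ (-(δ - η)) * (4 * (kk * (P * K)))) *
          (n : ℝ) ^ (((d + 1 : ℕ) : ℝ) - η) := by ring
      _ ≤ _ := by gcongr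
  · intro x hx f hf hfL
    have h1 := card_absorbers_mem_facets_le (π := π) (H := H)
      (hS.1 x (List.mem_toFinset.2 hx)).1 hf
      fun h => hfL (hS.facets_singleton_subset (List.mem_toFinset.2 hx) h)
    calc _ ≤ (((d + 1) ^ (d + 1) * (numPositions d * (d ^ d * Fintype.card F ^ d)) : ℕ) : ℝ) := by
          exact_mod_cast h1
      _ = kk * (P * (dd * (Fintype.card F : ℝ) ^ d)) := by
          rw [hkk, hP, hdd]; push_cast; ring
      _ ≤ _ := by gcongr
  · intro f hf hfL
    have := sum_card_absorbers_mem_facets_le (π := π) (H := H) hS hL hC.le hf hfL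
    rw [← hB, ← hdd, ← hP] at this
    exact this
  · intro x _ A hA
    rw [hΦ]
    exact_mod_cast card_facets_absorber_le hA

end GreedyAsymptotics

/-! ### Concentration by exponential moments -/

section Concentration

lemma exp_le_self_add_exp_sq (x : ℝ) : Real.exp x ≤ x + Real.exp (x ^ 2) := by
  rcases le_total |x| 1 with h | h
  · have h1 := (abs_le.1 (Real.abs_exp_sub_one_sub_id_le h)).2
    have h2 := Real.add_one_le_exp (x ^ 2)
    linarith
  · rcases le_abs.1 h with h | h
    · have : Real.exp x ≤ Real.exp (x ^ 2) := Real.exp_le_exp.2 (by nlinarith)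
      linarith
    · have h1 : Real.exp x ≤ 1 := Real.exp_le_one_iff.2 (by linarith)
      have h2 := Real.add_one_le_exp (x ^ 2)
      nlinarith

/-- Hoeffding's lemma, with a weak constant. -/
lemma sum_mul_exp_le {ι : Type*} (s : Finset ι) (w f : ι → ℝ) (hw : ∀ i ∈ s, 0 ≤ w i)
    (hw1 : ∑ i ∈ s, w i = 1) {m c : ℝ} (hm : ∑ i ∈ s, w i * f i = m)
    (hc : ∀ i ∈ s, |f i - m| ≤ c) : ∑ i ∈ s, w i * Real.exp (f i) ≤ Real.exp (m + c ^ 2) := by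
  have h1 : ∀ i ∈ s, w i * Real.exp (f i) ≤
      Real.exp m * (w i * (f i - m) + w i * Real.exp (c ^ 2)) := by
    intro i hi
    have h2 : Real.exp (f i) = Real.exp m * Real.exp (f i - m) := by
      rw [← Real.exp_add]; congr 1; ring
    have h3 : Real.exp ((f i - m) ^ 2) ≤ Real.exp (c ^ 2) :=
      Real.exp_le_exp.2 (sq_le_sq' (by linarith [(abs_le.1 (hc i hi)).1]) (abs_le.1 (hc i hi)).2)
    have h4 := exp_le_self_add_exp_sq (f i - m)
    rw [h2, mul_left_comm, ← mul_add]
    exact mul_le_mul_of_nonneg_left (mul_le_mul_of_nonneg_left (by linarith) (hw i hi))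
      (Real.exp_pos _).le
  refine (sum_le_sum h1).trans_eq ?_
  rw [← mul_sum, sum_add_distrib, ← sum_mul, hw1, Real.exp_add]
  simp only [mul_sub, sum_sub_distrib, ← sum_mul, hw1, hm]
  ring

open Equiv in
lemma decomposeFin_symm_eq_swap_mul {N : ℕ} (p : Fin (N + 1)) (e : Perm (Fin N)) :
    Perm.decomposeFin.symm (p, e) = swap 0 p * Perm.decomposeFin.symm (0, e) := by
  ext x
  refine Fin.cases ?_ (fun x => ?_) x <;> simp

open Equiv in
lemma decomposeFin_symm_swap_mul {N : ℕ} (u v : Fin N) (e : Perm (Fin N)) :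
    Perm.decomposeFin.symm (0, swap u v * e) =
      swap u.succ v.succ * Perm.decomposeFin.symm (0, e) := by
  ext x
  refine Fin.cases ?_ (fun x => ?_) x
  · rw [Perm.decomposeFin_symm_apply_zero, Perm.mul_apply, Perm.decomposeFin_symm_apply_zero,
      swap_apply_of_ne_of_ne (Fin.succ_ne_zero u).symm (Fin.succ_ne_zero v).symm]
  · simp only [Perm.decomposeFin_symm_apply_succ, Perm.mul_apply, swap_self, refl_apply]
    rw [(Fin.succ_injective N).swap_apply]

open Equiv in
lemma sum_exp_perm_fin_le {N : ℕ} (f : Perm (Fin N) → ℝ) {c : ℝ}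
    (hf : ∀ σ u v, |f (swap u v * σ) - f σ| ≤ c) :
    ∑ σ, Real.exp (f σ) ≤ N.factorial * Real.exp ((∑ σ, f σ) / N.factorial + N * (2 * c) ^ 2) := by
  induction N with
  | zero => simp [univ_unique]
  | succ N ih =>
    have hreindex : ∀ φ : Perm (Fin (N + 1)) → ℝ,
        ∑ σ, φ σ = ∑ e : Perm (Fin N), ∑ p, φ (Perm.decomposeFin.symm (p, e)) := by
      intro φ
      rw [← sum_product_right']
      exact (Equiv.sum_comp Perm.decomposeFin.symm φ).symm
    have hN : (0 : ℝ) < (N + 1 : ℕ) := by positivity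
    -- the conditional expectation given the part of the permutation in `e`
    set g : Perm (Fin N) → ℝ :=
      fun e => (∑ p, f (Perm.decomposeFin.symm (p, e))) / (N + 1 : ℕ) with hg
    have hgL : ∀ σ u v, |g (swap u v * σ) - g σ| ≤ c := by
      intro σ u v
      have : ∀ p, |f (Perm.decomposeFin.symm (p, swap u v * σ)) -
          f (Perm.decomposeFin.symm (p, σ))| ≤ c := by
        intro p
        rw [decomposeFin_symm_eq_swap_mul, decomposeFin_symm_swap_mul,
          decomposeFin_symm_eq_swap_mul p, ← mul_assoc, mul_swap_eq_swap_mul, mul_assoc]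
        exact hf _ _ _
      rw [hg]
      dsimp only
      rw [← sub_div, ← sum_sub_distrib, abs_div, abs_of_pos hN, div_le_iff₀ hN]
      refine (abs_sum_le_sum_abs _ _).trans ((sum_le_sum fun p _ => this p).trans ?_)
      simp [mul_comm]
    have hstep : ∀ e : Perm (Fin N), ∑ p, Real.exp (f (Perm.decomposeFin.symm (p, e))) ≤
        (N + 1 : ℕ) * Real.exp (g e + (2 * c) ^ 2) := by
      intro e
      have hdiff : ∀ p p', |f (Perm.decomposeFin.symm (p, e)) -
          f (Perm.decomposeFin.symm (p', e))| ≤ 2 * c := by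
        intro p p'
        rw [decomposeFin_symm_eq_swap_mul p, decomposeFin_symm_eq_swap_mul p']
        have h1 := hf (Perm.decomposeFin.symm (0, e)) 0 p
        have h2 := hf (Perm.decomposeFin.symm (0, e)) 0 p'
        rw [abs_le] at *
        constructor <;> linarith
      have := sum_mul_exp_le univ (fun _ : Fin (N + 1) => ((N + 1 : ℕ) : ℝ)⁻¹)
        (fun p => f (Perm.decomposeFin.symm (p, e))) (m := g e) (c := 2 * c)
        (fun _ _ => by positivity) (by simp; field_simp)
        (by rw [← mul_sum]; simp only [hg, div_eq_inv_mul]) ?_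
      · rw [← mul_sum, inv_mul_le_iff₀ hN] at this
        exact this
      · intro p _
        rw [hg]
        dsimp only
        rw [sub_div' hN.ne', abs_div, abs_of_pos hN, div_le_iff₀ hN]
        have h1 : f (Perm.decomposeFin.symm (p, e)) * (N + 1 : ℕ) -
            ∑ p', f (Perm.decomposeFin.symm (p', e)) =
            ∑ p', (f (Perm.decomposeFin.symm (p, e)) - f (Perm.decomposeFin.symm (p', e))) := by
          rw [sum_sub_distrib, sum_const, card_univ, Fintype.card_fin, nsmul_eq_mul, mul_comm]
        rw [h1]
        refine (abs_sum_le_sum_abs _ _).trans ((sum_le_sum fun p' _ => hdiff p p').trans ?_)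
        rw [sum_const, card_univ, Fintype.card_fin, nsmul_eq_mul, mul_comm]
    rw [hreindex, hreindex]
    refine (sum_le_sum fun e _ => hstep e).trans ?_
    simp only [Real.exp_add, ← mul_sum, ← sum_mul]
    have h2 := ih g hgL
    have h3 : (∑ σ, g σ) / N.factorial =
        (∑ e : Perm (Fin N), ∑ p, f (Perm.decomposeFin.symm (p, e))) / (N + 1).factorial := by
      rw [hg, ← sum_div, Nat.factorial_succ, Nat.cast_mul, div_div]
    rw [h3] at h2
    calc _ ≤ ((N + 1 : ℕ) : ℝ) * ((N.factorial * Real.exp ((∑ e : Perm (Fin N),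
          ∑ p, f (Perm.decomposeFin.symm (p, e))) / (N + 1).factorial + N * (2 * c) ^ 2)) *
            Real.exp ((2 * c) ^ 2)) := by gcongr
      _ = _ := by
        rw [Nat.factorial_succ, Nat.cast_mul, mul_assoc, mul_assoc, ← Real.exp_add,
          ← Real.exp_add]
        congr 3
        push_cast
        ring

open Equiv in
/-- The exponential moments of a function of a uniformly random permutation that changes by at most
`c` under transpositions of values: reveal the permutation step by step. -/
lemma sum_exp_perm_le {V : Type*} [Fintype V] [DecidableEq V] (f : Perm V → ℝ) {c : ℝ}
    (hf : ∀ σ u v, |f (swap u v * σ) - f σ| ≤ c) :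
    ∑ σ, Real.exp (f σ) ≤ Fintype.card (Perm V) *
      Real.exp ((∑ σ, f σ) / Fintype.card (Perm V) + Fintype.card V * (2 * c) ^ 2) := by
  set e := Fintype.equivFin V
  have h := sum_exp_perm_fin_le (fun τ => f (e.permCongr.symm τ)) (c := c) ?_
  · rw [Equiv.sum_comp e.permCongr.symm f,
      Equiv.sum_comp e.permCongr.symm fun σ => Real.exp (f σ)] at h
    rwa [Fintype.card_perm]
  · intro σ u v
    have : e.permCongr.symm (swap u v * σ) =
        swap (e.symm u) (e.symm v) * e.permCongr.symm σ := by
      ext x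
      simp only [permCongr_symm, permCongr_apply, Perm.mul_apply, symm_symm]
      exact (e.symm.injective.map_swap _ _ _).trans (by simp)
    rw [this]
    exact hf _ _ _

open Equiv in
/-- The lower tail of a function of a uniformly random permutation. -/
lemma card_perm_lt_half_le {V : Type*} [Fintype V] [DecidableEq V] (f : Perm V → ℝ) {c m v : ℝ}
    (hf : ∀ σ u v, |f (swap u v * σ) - f σ| ≤ c) (hm : 0 ≤ m)
    (hmean : Fintype.card (Perm V) * m ≤ ∑ σ, f σ) (hv : 0 < v)
    (hcv : 4 * Fintype.card V * c ^ 2 ≤ v) :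
    (#{σ | f σ < m / 2} : ℝ) ≤ Fintype.card (Perm V) * Real.exp (-(m ^ 2 / (16 * v))) := by
  have hcard : (0 : ℝ) < Fintype.card (Perm V) := by exact_mod_cast Fintype.card_pos
  set t : ℝ := m / (4 * v) with ht
  have ht0 : 0 ≤ t := by positivity
  have h1 := sum_exp_perm_le (fun σ => -t * f σ) (c := t * c) (by
    intro σ u v
    rw [← mul_sub, abs_mul, abs_neg, abs_of_nonneg ht0]
    exact mul_le_mul_of_nonneg_left (hf σ u v) ht0)
  rw [← mul_sum] at h1
  calc (#{σ | f σ < m / 2} : ℝ) = ∑ σ with f σ < m / 2, (1 : ℝ) := by simp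
    _ ≤ ∑ σ with f σ < m / 2, Real.exp (t * (m / 2)) * Real.exp (-t * f σ) := by
        refine sum_le_sum fun σ hσ => ?_
        rw [← Real.exp_add]
        apply Real.one_le_exp
        have := (mem_filter.1 hσ).2
        nlinarith
    _ ≤ ∑ σ, Real.exp (t * (m / 2)) * Real.exp (-t * f σ) :=
        sum_le_sum_of_subset_of_nonneg (filter_subset _ _) fun _ _ _ => by positivity
    _ ≤ Real.exp (t * (m / 2)) * (Fintype.card (Perm V) * Real.exp (-t * (∑ σ, f σ) /
          Fintype.card (Perm V) + Fintype.card V * (2 * (t * c)) ^ 2)) := by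
        rw [← mul_sum]
        gcongr
    _ ≤ Real.exp (t * (m / 2)) * (Fintype.card (Perm V) * Real.exp (-t * m + t ^ 2 * v)) := by
        have h2 : -t * (∑ σ, f σ) / Fintype.card (Perm V) ≤ -t * m := by
          rw [mul_div_assoc, neg_mul, neg_mul, neg_le_neg_iff]
          gcongr
          rw [le_div_iff₀ hcard]
          linarith
        have h3 : Fintype.card V * (2 * (t * c)) ^ 2 ≤ t ^ 2 * v := by
          nlinarith [sq_nonneg t]
        gcongr
    _ = _ := by
        rw [mul_left_comm, ← Real.exp_add]
        congr 2
        rw [ht]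
        field_simp
        ring

end Concentration

section Bernoulli

variable {α : Type*}

/-- The expectation of `f` of a random subset of `S` that contains each element independently with
probability `p`. -/
def bernoulliSum (S : Finset α) (p : ℝ) (f : Finset α → ℝ) : ℝ :=
  ∑ H ∈ S.powerset, p ^ #H * (1 - p) ^ (#S - #H) * f H

lemma bernoulliSum_insert [DecidableEq α] {S : Finset α} {a : α} (ha : a ∉ S) (p : ℝ)
    (f : Finset α → ℝ) :
    bernoulliSum (insert a S) p f =
      bernoulliSum S p fun H => p * f (insert a H) + (1 - p) * f H := by
  rw [bernoulliSum, sum_powerset_insert ha, bernoulliSum, ← sum_add_distrib]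
  refine sum_congr rfl fun H hH => ?_
  have hHS := mem_powerset.1 hH
  have hcard := card_le_card hHS
  rw [card_insert_of_notMem ha, card_insert_of_notMem fun h => ha (hHS h),
    Nat.add_sub_add_right, Nat.sub_add_comm hcard]
  ring

lemma bernoulliSum_mono {S : Finset α} {p : ℝ} (hp0 : 0 ≤ p) (hp1 : p ≤ 1) {f g : Finset α → ℝ}
    (h : ∀ H ⊆ S, f H ≤ g H) : bernoulliSum S p f ≤ bernoulliSum S p g := by
  have : 0 ≤ 1 - p := by linarith
  exact sum_le_sum fun H hH => mul_le_mul_of_nonneg_left (h H (mem_powerset.1 hH)) (by positivity)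

lemma bernoulliSum_congr {S : Finset α} {p : ℝ} {f g : Finset α → ℝ}
    (h : ∀ H ⊆ S, f H = g H) : bernoulliSum S p f = bernoulliSum S p g :=
  sum_congr rfl fun H hH => by rw [h H (mem_powerset.1 hH)]

lemma bernoulliSum_mul_left (S : Finset α) (p t : ℝ) (f : Finset α → ℝ) :
    bernoulliSum S p (fun H => t * f H) = t * bernoulliSum S p f := by
  simp only [bernoulliSum, mul_sum]
  exact sum_congr rfl fun H _ => by ring

lemma bernoulliSum_sum {ι : Type*} (S : Finset α) (p : ℝ) (s : Finset ι)
    (f : ι → Finset α → ℝ) :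
    bernoulliSum S p (fun H => ∑ i ∈ s, f i H) = ∑ i ∈ s, bernoulliSum S p (f i) := by
  simp only [bernoulliSum, mul_sum]
  exact sum_comm

lemma bernoulliSum_const [DecidableEq α] (S : Finset α) (p t : ℝ) :
    bernoulliSum S p (fun _ => t) = t := by
  induction S using Finset.induction_on generalizing t with
  | empty => simp [bernoulliSum]
  | insert a S ha ih =>
    rw [bernoulliSum_insert ha]
    convert ih t using 2
    ext
    ring

lemma bernoulliSum_subset [DecidableEq α] {S G : Finset α} (hG : G ⊆ S) (p : ℝ) :
    bernoulliSum S p (fun H => if G ⊆ H then 1 else 0) = p ^ #G := by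
  induction S using Finset.induction_on generalizing G with
  | empty => simp [bernoulliSum, subset_empty.1 hG]
  | insert a S ha ih =>
    rw [bernoulliSum_insert ha]
    by_cases haG : a ∈ G
    · rw [← card_erase_add_one haG, pow_succ, mul_comm, ← ih (G := G.erase a)
        (by rw [← subset_insert_iff]; exact hG), ← bernoulliSum_mul_left]
      refine bernoulliSum_congr fun H hH => ?_
      rw [if_neg fun h : G ⊆ H => ha (hH (h haG)), mul_zero, add_zero]
      congr 1
      exact if_congr subset_insert_iff rfl rfl
    · rw [← ih ((subset_insert_iff_of_notMem haG).1 hG)]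
      refine bernoulliSum_congr fun H hH => ?_
      rw [if_congr (subset_insert_iff_of_notMem haG) rfl rfl]
      ring

/-- The exponential moments of a function of a random set that changes by at most `c a` when `a` is
added: reveal the random set element by element. -/
lemma bernoulliSum_exp_le [DecidableEq α] (S : Finset α) {p : ℝ} (hp0 : 0 ≤ p) (hp1 : p ≤ 1)
    (c : α → ℝ)
    (f : Finset α → ℝ) (hf : ∀ a H, |f (insert a H) - f H| ≤ c a) :
    bernoulliSum S p (fun H => Real.exp (f H)) ≤
      Real.exp (bernoulliSum S p f + ∑ a ∈ S, c a ^ 2) := by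
  induction S using Finset.induction_on generalizing f with
  | empty => simp [bernoulliSum]
  | insert a S ha ih =>
    have hq : 0 ≤ 1 - p := by linarith
    rw [bernoulliSum_insert ha, bernoulliSum_insert ha, sum_insert ha]
    set g : Finset α → ℝ := fun H => p * f (insert a H) + (1 - p) * f H with hg
    have hgL : ∀ b H, |g (insert b H) - g H| ≤ c b := by
      intro b H
      have h1 := hf b (insert a H)
      have h2 := hf b H
      rw [insert_comm] at h1
      simp only [hg]
      rw [abs_le] at *
      constructor <;> nlinarith
    have hstep : ∀ H ⊆ S, p * Real.exp (f (insert a H)) + (1 - p) * Real.exp (f H) ≤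
        Real.exp (c a ^ 2) * Real.exp (g H) := by
      intro H _
      have h1 := hf a H
      have := sum_mul_exp_le (univ : Finset Bool) (fun b => if b then p else 1 - p)
        (fun b => if b then f (insert a H) else f H) (m := g H) (c := c a)
        (by intro b _; cases b <;> simp [hp0, hp1]) (by simp) (by simp [hg]) (by
          intro b _
          rw [abs_le] at *
          cases b <;> simp only [hg] <;> constructor <;> simp <;> nlinarith)
      rw [← Real.exp_add, add_comm (c a ^ 2)]
      simpa using this
    refine (bernoulliSum_mono hp0 hp1 hstep).trans ?_
    rw [bernoulliSum_mul_left]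
    refine (mul_le_mul_of_nonneg_left (ih g hgL) (Real.exp_pos _).le).trans_eq ?_
    rw [← Real.exp_add]
    congr 1
    ring

/-- The lower tail of a function of a random set. -/
lemma bernoulliSum_lt_half_le [DecidableEq α] (S : Finset α) {p : ℝ} (hp0 : 0 ≤ p) (hp1 : p ≤ 1)
    (c : α → ℝ)
    (f : Finset α → ℝ) (hf : ∀ a H, |f (insert a H) - f H| ≤ c a) {m v : ℝ} (hm : 0 ≤ m)
    (hmean : m ≤ bernoulliSum S p f) (hv : 0 < v) (hcv : ∑ a ∈ S, c a ^ 2 ≤ v) :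
    bernoulliSum S p (fun H => if f H < m / 2 then 1 else 0) ≤
      Real.exp (-(m ^ 2 / (16 * v))) := by
  set t : ℝ := m / (4 * v) with ht
  have ht0 : 0 ≤ t := by positivity
  have h1 := bernoulliSum_exp_le S hp0 hp1 (fun a => t * c a) (fun H => -t * f H) (by
    intro a H
    rw [← mul_sub, abs_mul, abs_neg, abs_of_nonneg ht0]
    exact mul_le_mul_of_nonneg_left (hf a H) ht0)
  rw [bernoulliSum_mul_left] at h1
  simp only [mul_pow, ← mul_sum] at h1
  calc bernoulliSum S p (fun H => if f H < m / 2 then 1 else 0)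
      ≤ bernoulliSum S p (fun H => Real.exp (t * (m / 2)) * Real.exp (-t * f H)) := by
        refine bernoulliSum_mono hp0 hp1 fun H _ => ?_
        split_ifs with h
        · rw [← Real.exp_add]
          apply Real.one_le_exp
          nlinarith
        · positivity
    _ ≤ Real.exp (t * (m / 2)) * Real.exp (-t * m + t ^ 2 * v) := by
        rw [bernoulliSum_mul_left]
        gcongr
        refine h1.trans (Real.exp_le_exp.2 ?_)
        nlinarith [sq_nonneg t]
    _ ≤ _ := by
        rw [← Real.exp_add]
        apply le_of_eq
        congr 1
        rw [ht]
        field_simp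
        ring

end Bernoulli

/-! ### Generic spanning tuples -/

section PermCount

open Equiv

/-- The number of permutations under which given distinct points have their preimages in `B`. -/
lemma card_perm_symm_mem_mul {V : Type*} [Fintype V] [DecidableEq V] (B : Finset V) {l : ℕ}
    (w : Fin l ↪ V) :
    #{σ : Perm V | ∀ j, σ.symm (w j) ∈ B} * (Fintype.card V).descFactorial l =
      Fintype.card (Perm V) * (#B).descFactorial l := by
  -- by transitivity, the number does not depend on the points
  have hconst : ∀ w' : Fin l ↪ V, #{σ : Perm V | ∀ j, σ.symm (w' j) ∈ B} =
      #{σ : Perm V | ∀ j, σ.symm (w j) ∈ B} := by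
    intro w'
    obtain ⟨g, rfl⟩ := (Perm.isMultiplyPretransitive V l).exists_smul_eq w w'
    refine card_nbij' (fun σ => g⁻¹ * σ) (fun σ => g * σ) ?_ ?_ ?_ ?_
    · intro σ hσ
      simp only [coe_filter, mem_univ, true_and, Set.mem_ofPred_eq] at hσ ⊢
      intro j
      exact hσ j
    · intro σ hσ
      simp only [coe_filter, mem_univ, true_and, Set.mem_ofPred_eq] at hσ ⊢
      intro j
      have : (g * σ).symm ((g • w) j) = σ.symm (w j) := by
        rw [symm_apply_eq]
        simp [Function.Embedding.smul_apply]
      rw [this]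
      exact hσ j
    · intro σ _; simp
    · intro σ _; simp
  have hcount : ∀ σ : Perm V, #{w' : Fin l ↪ V | ∀ j, σ.symm (w' j) ∈ B} =
      (#B).descFactorial l := by
    intro σ
    have h1 : Fintype.card (Fin l ↪ B) = (#B).descFactorial l := by
      rw [Fintype.card_embedding_eq]; simp
    rw [← h1, ← Finset.card_univ]
    symm
    refine card_bij (fun u _ => (u.trans (Function.Embedding.subtype _)).trans σ.toEmbedding)
      ?_ ?_ ?_
    · intro u _
      simp
    · intro u _ u' _ h
      ext j
      have := DFunLike.congr_fun h j
      simpa using this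
    · intro w' hw'
      have hw' := (mem_filter.1 hw').2
      exact ⟨⟨fun j => ⟨σ.symm (w' j), hw' j⟩, fun i j h => w'.injective (σ.symm.injective
        (congrArg Subtype.val h))⟩, mem_univ _, by ext j; exact σ.apply_symm_apply _⟩
  have hdouble : ∑ w' : Fin l ↪ V, #{σ : Perm V | ∀ j, σ.symm (w' j) ∈ B} =
      ∑ σ : Perm V, #{w' : Fin l ↪ V | ∀ j, σ.symm (w' j) ∈ B} := by
    simp only [card_filter]
    exact sum_comm
  rw [sum_congr rfl fun w' _ => hconst w', sum_congr rfl fun σ _ => hcount σ, sum_const, sum_const,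
    Finset.card_univ, Finset.card_univ, Fintype.card_embedding_eq, Fintype.card_fin, smul_eq_mul,
    smul_eq_mul] at hdouble
  rw [mul_comm, hdouble]

/-- A positive proportion of all permutations has the preimages of given distinct points in a set
`B` of positive density. -/
lemma card_perm_le_mul_card_symm_mem {V : Type*} [Fintype V] [DecidableEq V] {B : Finset V}
    {n l : ℕ} (hB : #B = n) (hn : 2 * l ≤ n) (hV : Fintype.card V ≤ 4 * n) (w : Fin l ↪ V) :
    Fintype.card (Perm V) ≤ 8 ^ l * #{σ : Perm V | ∀ j, σ.symm (w j) ∈ B} := by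
  have h := card_perm_symm_mem_mul B w
  have hlV : l ≤ Fintype.card V := by
    have := Fintype.card_le_of_embedding w
    simpa using this
  have hpos : 0 < (Fintype.card V).descFactorial l := Nat.descFactorial_pos.2 hlV
  refine Nat.le_of_mul_le_mul_right ?_ hpos
  rw [mul_assoc, h, hB, mul_left_comm]
  refine Nat.mul_le_mul_left _ ?_
  calc (Fintype.card V).descFactorial l ≤ Fintype.card V ^ l := Nat.descFactorial_le_pow _ _
    _ ≤ (4 * n) ^ l := Nat.pow_le_pow_left hV l
    _ ≤ (8 * (n + 1 - l)) ^ l := Nat.pow_le_pow_left (by omega) l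
    _ = 8 ^ l * (n + 1 - l) ^ l := mul_pow _ _ _
    _ ≤ _ := Nat.mul_le_mul_left _ (Nat.pow_sub_le_descFactorial n l)

end PermCount

section Generic

variable {k : ℕ} {F : Type} [Field F]

/-- The labels of the vertices of an absorber outside the absorbed edge: those of the spanning
vertices and those of the algebraic vertices. -/
abbrev NewLabel (k : ℕ) : Type :=
  Fin k ⊕ ({I : Finset (Fin k) // I.Nonempty ∧ Even #I} × Fin k)

/-- The values of the vertices of an absorber outside the absorbed edge. The value of an algebraic
vertex makes the sum of the values vanish when it replaces the corresponding vertex of `e_I`. -/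
def newVal (α β : Fin k → F) : NewLabel k → F :=
  Sum.elim β fun q => mix q.1.1 α β q.2 - ∑ j, mix q.1.1 α β j

/-- The set of indices `j` for which `β j` occurs in the value with the given label. -/
def betaSupport : NewLabel k → Finset (Fin k) :=
  Sum.elim (fun i => {i}) fun q => q.1.1.erase q.2

/-- The set of indices `j` for which `α j` occurs in the value with the given label. -/
def alphaSupport : NewLabel k → Finset (Fin k) :=
  Sum.elim (fun _ => ∅) fun q => ((q.1.1.erase q.2)ᶜ).erase q.2

lemma newVal_eq [CharP F 2] (α β : Fin k → F) (t : NewLabel k) :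
    newVal α β t = ∑ j ∈ betaSupport t, β j + ∑ j ∈ alphaSupport t, α j := by
  rcases t with i | ⟨⟨I, hI⟩, i⟩
  · simp [newVal, betaSupport, alphaSupport]
  · simp only [newVal, betaSupport, alphaSupport, Sum.elim_inr]
    rw [← Finset.add_sum_erase univ _ (mem_univ i), sub_add_cancel_left, CharTwo.neg_eq,
      ← sum_filter_add_sum_filter_not (univ.erase i) (· ∈ I)]
    congr 1
    · refine sum_congr_of_eq_on_inter ?_ ?_ ?_ <;> intro j <;> simp +contextual [mix]
    · refine sum_congr_of_eq_on_inter ?_ ?_ ?_ <;> intro j <;> simp +contextual [mix]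

lemma betaSupport_nonempty (t : NewLabel k) : (betaSupport t).Nonempty := by
  rcases t with i | ⟨⟨I, hI, hI'⟩, i⟩
  · simp [betaSupport]
  · simp only [betaSupport, Sum.elim_inr]
    rw [← card_pos]
    have h1 := hI.card_pos
    have h2 := pred_card_le_card_erase (s := I) (a := i)
    obtain ⟨r, hr⟩ := hI'
    omega

/-- Distinct labels of vertices of an absorber give values that are distinct as polynomials in the
values of the spanning vertices. For larger `k`, the sum in the hypothesis may vanish. -/
lemma alphaSupport_sum_ne {α : Fin k → F} (hα : Function.Injective α)
    (hα2 : ∀ i i' : Fin k, i' ≠ i → ∑ j ∈ (({i} : Finset (Fin k))ᶜ).erase i', α j ≠ 0)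
    {t t' : NewLabel k} (htt : t ≠ t') (h : betaSupport t = betaSupport t') :
    ∑ j ∈ alphaSupport t, α j ≠ ∑ j ∈ alphaSupport t', α j := by
  have hmixed : ∀ (i : Fin k) (I : Finset (Fin k)) (hI : I.Nonempty ∧ Even #I) (i' : Fin k),
      ({i} : Finset (Fin k)) = I.erase i' →
        ∑ j ∈ ((I.erase i')ᶜ).erase i', α j ≠ 0 := by
    intro i I hI i' h
    rw [← h]
    refine hα2 i i' ?_
    rintro rfl
    have : i' ∈ I.erase i' := h ▸ mem_singleton_self i'
    simp at this
  rcases t with i | ⟨⟨I, hI⟩, i⟩ <;> rcases t' with i' | ⟨⟨I', hI'⟩, i'⟩ <;>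
    simp only [betaSupport, alphaSupport, Sum.elim_inr, Sum.elim_inl, sum_empty] at h ⊢
  · exact absurd (congrArg Sum.inl (singleton_injective h)) htt
  · exact (hmixed i I' hI' i' h).symm
  · exact hmixed i' I hI i h.symm
  · intro hsum
    rw [← h, sum_erase_eq_sub (by simp), sum_erase_eq_sub (by rw [h]; simp), sub_right_inj] at hsum
    obtain rfl := hα hsum
    apply htt
    -- the parity of the support tells whether `i` belongs to `I`
    have hII : I = I' := by
      by_cases h1 : i ∈ I <;> by_cases h2 : i ∈ I'
      · rw [← insert_erase h1, h, insert_erase h2]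
      · have := congrArg card h
        rw [card_erase_of_mem h1, erase_eq_of_notMem h2] at this
        have := hI.1.card_pos
        obtain ⟨r, hr⟩ := hI.2
        obtain ⟨r', hr'⟩ := hI'.2
        omega
      · have := congrArg card h
        rw [card_erase_of_mem h2, erase_eq_of_notMem h1] at this
        have := hI'.1.card_pos
        obtain ⟨r, hr⟩ := hI.2
        obtain ⟨r', hr'⟩ := hI'.2
        omega
      · rwa [erase_eq_of_notMem h1, erase_eq_of_notMem h2] at h
    subst hII
    rfl

/-- The values `β` of the spanning vertices are generic with respect to those of the absorbed edge
if the values of all vertices of the absorber are distinct and nonzero. -/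
structure IsGeneric (α β : Fin k → F) : Prop where
  injective : Function.Injective (newVal α β)
  ne_zero : ∀ t, newVal α β t ≠ 0
  ne_old : ∀ t i, newVal α β t ≠ α i

open scoped Classical in
/-- The generic tuples for which all vertices of the absorber exist. -/
noncomputable def goodTuples {n : ℕ} [Fintype F] (π : Fin n ↪ Fˣ) (α : Fin k → F) :
    Finset (Fin k → F) :=
  {β | IsGeneric α β ∧ ∀ t, ∃ v, (π v : F) = newVal α β t}

lemma mem_goodTuples {n : ℕ} [Fintype F] {π : Fin n ↪ Fˣ} {α β : Fin k → F} :
    β ∈ goodTuples π α ↔ IsGeneric α β ∧ ∀ t, ∃ v, (π v : F) = newVal α β t := by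
  simp [goodTuples]

section Counting

open scoped Classical

variable [Fintype F]

lemma card_sum_sub_sum_eq_le (c c' : Finset (Fin k)) (h : c ≠ c') (v : F) :
    #{β : Fin k → F | ∑ j ∈ c, β j - ∑ j ∈ c', β j = v} * Fintype.card F ≤
      Fintype.card F ^ k := by
  set φ : (Fin k → F) →ₗ[F] F :=
    ∑ j ∈ c, LinearMap.proj j - ∑ j ∈ c', LinearMap.proj j with hφ
  have happ : ∀ β, φ β = ∑ j ∈ c, β j - ∑ j ∈ c', β j := by
    intro β; simp [hφ, LinearMap.sum_apply]
  have hne : φ ≠ 0 := by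
    intro h0
    apply h
    ext j
    have := happ (Pi.single j 1)
    rw [h0, LinearMap.zero_apply, sum_pi_single', sum_pi_single'] at this
    by_cases h1 : j ∈ c <;> by_cases h2 : j ∈ c' <;> simp_all
  have := card_fiber_mul_le φ hne v
  simp only [happ] at this
  simpa using this

variable [CharP F 2]

lemma card_newVal_eq_le (α : Fin k → F) (t : NewLabel k) (v : F) :
    #{β : Fin k → F | newVal α β t = v} * Fintype.card F ≤ Fintype.card F ^ k := by
  refine le_trans (Nat.mul_le_mul_right _ (card_le_card fun β hβ => ?_))
    (card_sum_sub_sum_eq_le (betaSupport t) ∅ (betaSupport_nonempty t).ne_empty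
      (v - ∑ j ∈ alphaSupport t, α j))
  simp only [mem_filter, mem_univ, true_and] at hβ ⊢
  rw [← hβ, newVal_eq, sum_empty]
  ring

lemma card_newVal_eq_newVal_le {α : Fin k → F} (hα : Function.Injective α)
    (hα2 : ∀ i i' : Fin k, i' ≠ i → ∑ j ∈ (({i} : Finset (Fin k))ᶜ).erase i', α j ≠ 0)
    {t t' : NewLabel k} (htt : t ≠ t') :
    #{β : Fin k → F | newVal α β t = newVal α β t'} * Fintype.card F ≤ Fintype.card F ^ k := by
  by_cases h : betaSupport t = betaSupport t'
  · have : ({β : Fin k → F | newVal α β t = newVal α β t'} : Finset _) = ∅ := by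
      rw [filter_eq_empty_iff]
      intro β _ heq
      rw [newVal_eq, newVal_eq, h, add_right_inj] at heq
      exact alphaSupport_sum_ne hα hα2 htt h heq
    simp [this]
  · refine le_trans (Nat.mul_le_mul_right _ (card_le_card fun β hβ => ?_))
      (card_sum_sub_sum_eq_le _ _ h
        (∑ j ∈ alphaSupport t', α j - ∑ j ∈ alphaSupport t, α j))
    simp only [mem_filter, mem_univ, true_and] at hβ ⊢
    rw [newVal_eq, newVal_eq] at hβ
    linear_combination hβ

/-- The number of labels of vertices of an absorber outside the absorbed edge. -/
def numLabels (k : ℕ) : ℕ := Fintype.card (NewLabel k)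

/-- All but a proportion of `O(1 / q)` of all tuples are generic. -/
lemma card_not_isGeneric_le {α : Fin k → F} (hα : Function.Injective α)
    (hα2 : ∀ i i' : Fin k, i' ≠ i → ∑ j ∈ (({i} : Finset (Fin k))ᶜ).erase i', α j ≠ 0) :
    #{β : Fin k → F | ¬ IsGeneric α β} * Fintype.card F ≤
      (numLabels k * numLabels k + numLabels k + numLabels k * k) * Fintype.card F ^ k := by
  have hsub : ({β : Fin k → F | ¬ IsGeneric α β} : Finset _) ⊆
      ((univ : Finset (NewLabel k × NewLabel k)).filter fun p => p.1 ≠ p.2).biUnion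
        (fun p => {β : Fin k → F | newVal α β p.1 = newVal α β p.2}) ∪
      (univ : Finset (NewLabel k)).biUnion (fun t => {β : Fin k → F | newVal α β t = 0}) ∪
      (univ : Finset (NewLabel k × Fin k)).biUnion
        (fun p => {β : Fin k → F | newVal α β p.1 = α p.2}) := by
    intro β hβ
    replace hβ := (mem_filter.1 hβ).2
    by_contra hcon
    simp only [mem_union, mem_biUnion, mem_filter, mem_univ, true_and, Prod.exists, not_or,
      not_exists, not_and] at hcon
    obtain ⟨⟨h1, h2⟩, h3⟩ := hcon
    exact hβ ⟨fun t t' h => by_contra fun hne => h1 t t' hne h, h2, fun t i => h3 t i⟩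
  have hbi : ∀ {ι : Type} (s : Finset ι) (A : ι → Finset (Fin k → F)),
      (∀ i ∈ s, #(A i) * Fintype.card F ≤ Fintype.card F ^ k) →
      #(s.biUnion A) * Fintype.card F ≤ #s * Fintype.card F ^ k := by
    intro ι s A h
    refine (Nat.mul_le_mul_right _ card_biUnion_le).trans ?_
    rw [sum_mul]
    exact sum_le_card_nsmul _ _ _ h
  refine (Nat.mul_le_mul_right _ ((card_le_card hsub).trans ((card_union_le _ _).trans
    (Nat.add_le_add_right (card_union_le _ _) _)))).trans ?_
  rw [add_mul, add_mul, add_mul, add_mul]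
  refine add_le_add (add_le_add ?_ ?_) ?_
  · refine (hbi _ _ fun p hp => card_newVal_eq_newVal_le hα hα2 (mem_filter.1 hp).2).trans ?_
    gcongr
    refine (card_filter_le _ _).trans_eq ?_
    simp [numLabels]
  · refine (hbi _ _ fun t _ => card_newVal_eq_le α t 0).trans_eq ?_
    rfl
  · refine (hbi _ _ fun p _ => card_newVal_eq_le α p.1 _).trans_eq ?_
    rw [Finset.card_univ, Fintype.card_prod, Fintype.card_fin]
    rfl

variable {n : ℕ}

lemma card_goodTuples_swap_le (π : Fin n ↪ Fˣ) (α : Fin k → F) (σ : Equiv.Perm Fˣ) (u v : Fˣ) :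
    (#(goodTuples (π.trans σ.toEmbedding) α) : ℝ) ≤
      #(goodTuples (π.trans (Equiv.swap u v * σ).toEmbedding) α) +
        2 * numLabels k * ((Fintype.card F : ℝ) ^ k / Fintype.card F) := by
  have hF : (0 : ℝ) < Fintype.card F := by exact_mod_cast Fintype.card_pos
  set Bu : Fˣ → Finset (Fin k → F) := fun u =>
    (univ : Finset (NewLabel k)).biUnion fun t => {β : Fin k → F | newVal α β t = u} with hBu
  have hBcard : ∀ u, (#(Bu u) : ℝ) ≤ numLabels k * ((Fintype.card F : ℝ) ^ k / Fintype.card F) := by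
    intro u
    calc (#(Bu u) : ℝ) ≤ ∑ t : NewLabel k, (#{β : Fin k → F | newVal α β t = u} : ℝ) := by
          exact_mod_cast card_biUnion_le
      _ ≤ ∑ t : NewLabel k, ((Fintype.card F : ℝ) ^ k / Fintype.card F) := by
          refine sum_le_sum fun t _ => ?_
          rw [le_div_iff₀ hF]
          exact_mod_cast card_newVal_eq_le α t u
      _ = _ := by simp [numLabels]
  have hsub : goodTuples (π.trans σ.toEmbedding) α ⊆
      goodTuples (π.trans (Equiv.swap u v * σ).toEmbedding) α ∪ (Bu u ∪ Bu v) := by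
    intro β hβ
    by_cases hu : β ∈ Bu u
    · exact mem_union_right _ (mem_union_left _ hu)
    by_cases hv : β ∈ Bu v
    · exact mem_union_right _ (mem_union_right _ hv)
    refine mem_union_left _ (mem_goodTuples.2 ⟨(mem_goodTuples.1 hβ).1, fun t => ?_⟩)
    obtain ⟨w, hw⟩ := (mem_goodTuples.1 hβ).2 t
    refine ⟨w, ?_⟩
    rw [← hw]
    simp only [hBu, mem_biUnion, mem_filter, mem_univ, true_and, not_exists] at hu hv
    simp only [Function.Embedding.trans_apply, Equiv.coe_toEmbedding] at hw
    simp only [Function.Embedding.trans_apply, Equiv.coe_toEmbedding, Equiv.Perm.mul_apply]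
    rw [Equiv.swap_apply_of_ne_of_ne]
    · intro h; exact hu t (by rw [← hw, h])
    · intro h; exact hv t (by rw [← hw, h])
  have h1 : (#(goodTuples (π.trans σ.toEmbedding) α) : ℝ) ≤
      #(goodTuples (π.trans (Equiv.swap u v * σ).toEmbedding) α) + (#(Bu u) + #(Bu v)) := by
    exact_mod_cast (card_le_card hsub).trans ((card_union_le _ _).trans
      (Nat.add_le_add_left (card_union_le _ _) _))
  linarith [hBcard u, hBcard v]

lemma abs_card_goodTuples_sub_le (π : Fin n ↪ Fˣ) (α : Fin k → F) (σ : Equiv.Perm Fˣ) (u v : Fˣ) :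
    |(#(goodTuples (π.trans (Equiv.swap u v * σ).toEmbedding) α) : ℝ) -
      #(goodTuples (π.trans σ.toEmbedding) α)| ≤
        2 * numLabels k * ((Fintype.card F : ℝ) ^ k / Fintype.card F) := by
  have h1 := card_goodTuples_swap_le π α σ u v
  have h2 := card_goodTuples_swap_le π α (Equiv.swap u v * σ) u v
  rw [← mul_assoc, Equiv.swap_mul_self, one_mul] at h2
  rw [abs_le]
  constructor <;> linarith

/-- On average over all injections, a positive proportion of all tuples is good. -/
lemma card_perm_mul_le_sum_card_goodTuples (π : Fin n ↪ Fˣ) {α : Fin k → F}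
    (hα : Function.Injective α)
    (hα2 : ∀ i i' : Fin k, i' ≠ i → ∑ j ∈ (({i} : Finset (Fin k))ᶜ).erase i', α j ≠ 0)
    (hn : 2 * numLabels k ≤ n) (hF : Fintype.card Fˣ ≤ 4 * n)
    (hq : 2 * (numLabels k * numLabels k + numLabels k + numLabels k * k) ≤ Fintype.card F) :
    (Fintype.card (Equiv.Perm Fˣ) : ℝ) * ((Fintype.card F : ℝ) ^ k / (2 * 8 ^ numLabels k)) ≤
      ∑ σ : Equiv.Perm Fˣ, (#(goodTuples (π.trans σ.toEmbedding) α) : ℝ) := by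
  have hgen : Fintype.card F ^ k ≤ 2 * #{β : Fin k → F | IsGeneric α β} := by
    have h1 := card_not_isGeneric_le hα hα2
    have h2 : #{β : Fin k → F | IsGeneric α β} + #{β : Fin k → F | ¬ IsGeneric α β} =
        Fintype.card F ^ k := by
      rw [card_filter_add_card_filter_not]
      simp
    have h3 : 2 * #{β : Fin k → F | ¬ IsGeneric α β} ≤ Fintype.card F ^ k := by
      refine Nat.le_of_mul_le_mul_right ?_ (Fintype.card_pos (α := F))
      calc _ = 2 * (#{β : Fin k → F | ¬ IsGeneric α β} * Fintype.card F) := by ring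
        _ ≤ 2 * ((numLabels k * numLabels k + numLabels k + numLabels k * k) *
            Fintype.card F ^ k) := by gcongr
        _ = (2 * (numLabels k * numLabels k + numLabels k + numLabels k * k)) *
            Fintype.card F ^ k := by ring
        _ ≤ Fintype.card F * Fintype.card F ^ k := by gcongr
        _ = _ := by ring
    omega
  have hper : ∀ β : Fin k → F, IsGeneric α β → Fintype.card (Equiv.Perm Fˣ) ≤
      8 ^ numLabels k * #{σ : Equiv.Perm Fˣ | β ∈ goodTuples (π.trans σ.toEmbedding) α} := by
    intro β hβ
    set w : NewLabel k ↪ Fˣ := ⟨fun t => Units.mk0 _ (hβ.ne_zero t), fun t t' h =>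
      hβ.injective (by simpa using congrArg Units.val h)⟩ with hw
    set e : NewLabel k ≃ Fin (numLabels k) := Fintype.equivFin _
    -- `π` followed by `σ` takes a value `v` if and only if `π` takes the value `σ⁻¹ v`
    have h1 := card_perm_le_mul_card_symm_mem (B := univ.map π) (by simp) hn hF
      (e.symm.toEmbedding.trans w)
    refine h1.trans (Nat.mul_le_mul_left _ (card_le_card fun σ hσ => ?_))
    simp only [mem_filter, mem_univ, true_and, Finset.mem_map] at hσ ⊢
    refine mem_goodTuples.2 ⟨hβ, fun t => ?_⟩
    obtain ⟨v, hv⟩ := hσ (e t)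
    refine ⟨v, ?_⟩
    rw [Equiv.eq_symm_apply] at hv
    have hw' : e.symm.toEmbedding.trans w (e t) = w t := by simp
    rw [hw'] at hv
    exact congrArg Units.val hv
  have hswap : ∑ σ : Equiv.Perm Fˣ, #(goodTuples (π.trans σ.toEmbedding) α) =
      ∑ β : Fin k → F, #{σ : Equiv.Perm Fˣ | β ∈ goodTuples (π.trans σ.toEmbedding) α} := by
    simp only [card_filter]
    rw [sum_comm]
    refine sum_congr rfl fun σ _ => ?_
    rw [← card_filter, filter_mem_eq_inter, univ_inter]
  have hmain : #{β : Fin k → F | IsGeneric α β} * Fintype.card (Equiv.Perm Fˣ) ≤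
      8 ^ numLabels k * ∑ σ : Equiv.Perm Fˣ, #(goodTuples (π.trans σ.toEmbedding) α) := by
    rw [hswap, mul_sum]
    calc _ = ∑ β : Fin k → F with IsGeneric α β, Fintype.card (Equiv.Perm Fˣ) := by simp
      _ ≤ ∑ β : Fin k → F with IsGeneric α β, 8 ^ numLabels k *
          #{σ : Equiv.Perm Fˣ | β ∈ goodTuples (π.trans σ.toEmbedding) α} :=
          sum_le_sum fun β hβ => hper β (mem_filter.1 hβ).2
      _ ≤ _ := sum_le_sum_of_subset (filter_subset _ _)
  have h1 : ((Fintype.card F : ℝ) ^ k) ≤ 2 * #{β : Fin k → F | IsGeneric α β} := by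
    exact_mod_cast hgen
  have h2 : (#{β : Fin k → F | IsGeneric α β} : ℝ) * Fintype.card (Equiv.Perm Fˣ) ≤
      8 ^ numLabels k * ∑ σ : Equiv.Perm Fˣ, (#(goodTuples (π.trans σ.toEmbedding) α) : ℝ) := by
    exact_mod_cast hmain
  rw [← mul_div_assoc, div_le_iff₀ (by positivity)]
  have hc : (0 : ℝ) ≤ Fintype.card (Equiv.Perm Fˣ) := Nat.cast_nonneg _
  nlinarith

end Counting

end Generic

/-! ### Absorbers from good tuples -/

section Realization

variable {n k : ℕ} {F : Type} [Field F] {π : Fin n ↪ Fˣ} {H : Hypergraph n}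
  {x a : Fin k → Fin n} {b : Finset (Fin k) → Fin k → Fin n} {α β : Fin k → F}

/-- In characteristic two, sums of one or two distinct nonzero elements do not vanish. -/
lemma sum_compl_erase_ne_zero [CharP F 2] (hk : k = 3 ∨ k = 4) (hα : Function.Injective α)
    (hα0 : ∀ i, α i ≠ 0) (i i' : Fin k) (hi : i' ≠ i) :
    ∑ j ∈ (({i} : Finset (Fin k))ᶜ).erase i', α j ≠ 0 := by
  have hcard : #((({i} : Finset (Fin k))ᶜ).erase i') = k - 2 := by
    rw [card_erase_of_mem (by simpa using hi), card_compl, card_singleton, Fintype.card_fin]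
    omega
  rcases hk with rfl | rfl
  · obtain ⟨j, hj⟩ := card_eq_one.1 hcard
    rw [hj, sum_singleton]
    exact hα0 j
  · obtain ⟨j, j', hne, hj⟩ := card_eq_two.1 hcard
    rw [hj, sum_pair hne]
    intro h
    exact hne (hα (CharTwo.add_eq_zero.1 h))

/-- The tuples `a` and `b I` have the values of the spanning vertices and of the algebraic vertices
of the absorber that is given by the values `β` of the spanning vertices. -/
structure Realizes (π : Fin n ↪ Fˣ) (x : Fin k → Fin n) (β : Fin k → F) (a : Fin k → Fin n)
    (b : Finset (Fin k) → Fin k → Fin n) : Prop where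
  spanning : ∀ i, (π (a i) : F) = β i
  algebraic : ∀ (I : Finset (Fin k)) (hI : I.Nonempty ∧ Even #I) (i : Fin k),
    (π (b I i) : F) = newVal (fun j => (π (x j) : F)) β (.inr (⟨I, hI⟩, i))

lemma exists_realizes [Fintype F] (h : β ∈ goodTuples π fun j => (π (x j) : F)) :
    ∃ a b, Realizes π x β a b := by
  classical
  obtain ⟨-, h⟩ := mem_goodTuples.1 h
  choose u hu using h
  refine ⟨fun i => u (.inl i),
    fun I i => if hI : I.Nonempty ∧ Even #I then u (.inr (⟨I, hI⟩, i)) else x i, ?_, ?_⟩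
  · intro i
    exact hu _
  · intro I hI i
    rw [dif_pos hI]
    exact hu _

lemma Realizes.absorberVertex_injective (h : Realizes π x β a b)
    (hg : IsGeneric (fun j => (π (x j) : F)) β) (hx : Function.Injective x) :
    Function.Injective (absorberVertex x a b) := by
  have hval : ∀ t : NewLabel k, (π (absorberVertex x a b
      (Sum.elim (fun i => .inl (.inr i)) .inr t)) : F) = newVal (fun j => (π (x j) : F)) β t := by
    rintro (i | ⟨⟨I, hI⟩, i⟩)
    · exact h.spanning i
    · exact h.algebraic I hI i
  have hlab : ∀ t : (Fin k ⊕ Fin k) ⊕ ({I : Finset (Fin k) // I.Nonempty ∧ Even (#I)} × Fin k),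
      (∃ i, t = .inl (.inl i)) ∨
        ∃ t' : NewLabel k, t = Sum.elim (fun i => .inl (.inr i)) .inr t' := by
    rintro ((i | i) | q)
    · exact .inl ⟨i, rfl⟩
    · exact .inr ⟨.inl i, rfl⟩
    · exact .inr ⟨.inr q, rfl⟩
  intro t t' htt
  rcases hlab t with ⟨i, rfl⟩ | ⟨s, rfl⟩ <;> rcases hlab t' with ⟨i', rfl⟩ | ⟨s', rfl⟩
  · rw [hx htt]
  · refine absurd ?_ (hg.ne_old s' i)
    rw [← hval, ← htt]
    rfl
  · refine absurd ?_ (hg.ne_old s i')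
    rw [← hval, htt]
    rfl
  · rw [hg.injective (show newVal _ β s = newVal _ β s' by rw [← hval, ← hval, htt])]

lemma Realizes.val_crossTuple_spanning (h : Realizes π x β a b) (I : Finset (Fin k)) (i : Fin k) :
    (π (crossTuple x a I i) : F) = mix I (fun j => (π (x j) : F)) β i := by
  rw [val_crossTuple]
  simp only [mix, h.spanning]

/-- If all edges of the candidate absorber given by a good tuple are present, then it is an
absorber. -/
lemma Realizes.spansAbsorber (h : Realizes π x β a b)
    (hg : IsGeneric (fun j => (π (x j) : F)) β) (hx : Function.Injective x)
    (hH : absorberGraph x a b ⊆ H) : SpansAbsorber π H x a b := by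
  have hinj := h.absorberVertex_injective hg hx
  have hmem : ∀ I : Finset (Fin k), I.Nonempty → Even #I → ∀ J : Finset (Fin k), J.Nonempty →
      crossEdge (crossTuple x a I) (b I) J ∈ H := by
    intro I hI hI' J hJ
    refine hH (mem_union_right _ (mem_biUnion.2 ⟨I, by simp [hI, hI'], mem_image.2 ⟨J, ?_, rfl⟩⟩))
    simp [hJ]
  refine ⟨fun I hI => hH (mem_union_left _ (mem_image.2 ⟨I, by simp [hI], rfl⟩)),
    fun I hI hI' => ⟨?_, ?_, fun J hJ _ => hmem I hI hI' J hJ⟩, hinj⟩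
  · intro hT
    have hsum := (mem_template.1 hT).2
    rw [sum_image (crossTuple_injective_of_absorberVertex hinj I).injOn] at hsum
    simp only [h.val_crossTuple_spanning] at hsum
    obtain ⟨i, hi⟩ := hI
    have : newVal (fun j => (π (x j) : F)) β (.inr (⟨I, ⟨i, hi⟩, hI'⟩, i)) =
        newVal (fun j => (π (x j) : F)) β (.inl i) := by
      simp only [newVal, Sum.elim_inr, Sum.elim_inl, hsum, sub_zero]
      simp [mix, hi]
    exact absurd (hg.injective this) (by simp)
  · intro i
    refine mem_template.2 ⟨hmem I hI hI' {i} (singleton_nonempty i), ?_⟩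
    rw [crossEdge, sum_image
      (crossTuple_crossTuple_injective_of_absorberVertex hinj hI hI' {i}).injOn]
    simp only [val_crossTuple _ _ _ {i}, sum_mix_singleton, h.algebraic I ⟨hI, hI'⟩,
      h.val_crossTuple_spanning, newVal, Sum.elim_inr]
    ring

lemma absorberGraph_subset_complete (hinj : Function.Injective (absorberVertex x a b)) :
    absorberGraph x a b ⊆ complete n k := by
  intro e he
  simp only [absorberGraph, mem_union, mem_image, mem_biUnion, mem_filter, mem_univ,
    true_and] at he
  refine mem_powersetCard.2 ⟨subset_univ _, ?_⟩
  rcases he with ⟨I, -, rfl⟩ | ⟨I, ⟨hI, hI'⟩, J, -, rfl⟩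
  · rw [crossEdge, card_image_of_injective _ (crossTuple_injective_of_absorberVertex hinj I)]
    simp
  · rw [crossEdge, card_image_of_injective _
      (crossTuple_crossTuple_injective_of_absorberVertex hinj hI hI' J)]
    simp

lemma card_absorberGraph_le (hk : k = 3 ∨ k = 4) : #(absorberGraph x a b) ≤ absorberSize k := by
  have hcard : #({I | Odd #I} : Finset (Finset (Fin k))) +
      #({I | I.Nonempty ∧ Even #I} : Finset (Finset (Fin k))) *
        #({J | J.Nonempty} : Finset (Finset (Fin k))) ≤ absorberSize k := by
    rcases hk with rfl | rfl <;> decide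
  refine le_trans ((card_union_le _ _).trans (add_le_add card_image_le ?_)) hcard
  exact card_biUnion_le_card_mul _ _ _ fun I _ => card_image_le

/-- Every edge of an absorber has a vertex outside the absorbed edge. -/
lemma Realizes.exists_newVal (h : Realizes π x β a b) {e : Finset (Fin n)}
    (he : e ∈ absorberGraph x a b) :
    ∃ v ∈ e, ∃ t, (π v : F) = newVal (fun j => (π (x j) : F)) β t := by
  simp only [absorberGraph, mem_union, mem_image, mem_biUnion, mem_filter, mem_univ,
    true_and] at he
  rcases he with ⟨I, hI, rfl⟩ | ⟨I, hI, J, ⟨i, hi⟩, rfl⟩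
  · obtain ⟨i, hi⟩ := card_pos.1 hI.pos
    refine ⟨a i, mem_image.2 ⟨i, mem_univ _, by simp [crossTuple, hi]⟩, .inl i, h.spanning i⟩
  · exact ⟨b I i, mem_image.2 ⟨i, mem_univ _, by simp [crossTuple, hi]⟩, _, h.algebraic I hI i⟩

lemma mem_biUnion_absorberGraph (x a : Fin k → Fin n) (b : Finset (Fin k) → Fin k → Fin n)
    (i : Fin k) : a i ∈ (absorberGraph x a b).biUnion id := by
  refine mem_biUnion.2 ⟨crossEdge x a {i}, mem_union_left _ (mem_image.2 ⟨{i}, ?_, rfl⟩), ?_⟩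
  · simp
  · exact mem_image.2 ⟨i, mem_univ _, by simp [crossTuple]⟩

lemma card_biUnion_absorberGraph_le (hk : k = 3 ∨ k = 4) :
    #((absorberGraph x a b).biUnion id) ≤ absorberSize k * k := by
  refine (card_biUnion_le_card_mul _ _ k fun e he => ?_).trans
    (Nat.mul_le_mul_right _ (card_absorberGraph_le hk))
  have : ∃ t : Fin k → Fin n, e = univ.image t := by
    simp only [absorberGraph, mem_union, mem_image, mem_biUnion] at he
    rcases he with ⟨I, -, rfl⟩ | ⟨I, -, J, -, rfl⟩ <;> exact ⟨_, rfl⟩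
  obtain ⟨t, rfl⟩ := this
  exact card_image_le.trans (by simp)

end Realization

section RandomHypergraph

open scoped Classical

variable {n k : ℕ} {F : Type} [Field F] [Fintype F] [CharP F 2] {π : Fin n ↪ Fˣ}

/-- In a random hypergraph, an edge with many good tuples is very likely to have many absorbers. -/
lemma bernoulliSum_card_absorbers_lt_le (hk : k = 3 ∨ k = 4) {x : Fin k → Fin n}
    (hx : Function.Injective x) {p : ℝ} (hp0 : 0 ≤ p) (hp1 : p ≤ 1) {g : ℝ} (hg0 : 0 ≤ g)
    (hg : g ≤ #(goodTuples π fun j => (π (x j) : F))) :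
    bernoulliSum (complete n k) p (fun H =>
      if ((absorberSize k * k) ^ k : ℕ) * (#(absorbers k π H (univ.image x)) : ℝ) <
        g * p ^ absorberSize k / 2 then 1 else 0) ≤
      Real.exp (-((g * p ^ absorberSize k) ^ 2 / (16 * (k * numLabels k * absorberSize k *
        (Fintype.card F : ℝ) ^ (2 * k) / Fintype.card F)))) := by
  set q : ℝ := (Fintype.card F : ℝ) with hq
  have hq0 : 0 < q := by rw [hq]; exact_mod_cast Fintype.card_pos
  set 𝒢 := goodTuples π fun j => (π (x j) : F) with h𝒢
  have hgen : ∀ β ∈ 𝒢, IsGeneric (fun j => (π (x j) : F)) β := fun β hβ => (mem_goodTuples.1 hβ).1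
  have hex : ∀ β : Fin k → F, ∃ (a : Fin k → Fin n) (b : Finset (Fin k) → Fin k → Fin n),
      β ∈ 𝒢 → Realizes π x β a b := by
    intro β
    by_cases hβ : β ∈ 𝒢
    · obtain ⟨a, b, h⟩ := exists_realizes hβ
      exact ⟨a, b, fun _ => h⟩
    · exact ⟨x, fun _ => x, fun h => absurd h hβ⟩
  choose a b hab using hex
  set G : (Fin k → F) → Hypergraph n := fun β => absorberGraph x (a β) (b β) with hG
  set f : Hypergraph n → ℝ := fun H => #{β ∈ 𝒢 | G β ⊆ H} with hf
  set c : Finset (Fin n) → ℝ := fun e => #{β ∈ 𝒢 | e ∈ G β} with hc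
  have hlip : ∀ e H, |f (insert e H) - f H| ≤ c e := by
    intro e H
    have h1 : #{β ∈ 𝒢 | G β ⊆ H} ≤ #{β ∈ 𝒢 | G β ⊆ insert e H} :=
      card_le_card (monotone_filter_right _ fun β _ h => h.trans (subset_insert _ _))
    have h2 : #{β ∈ 𝒢 | G β ⊆ insert e H} ≤ #{β ∈ 𝒢 | G β ⊆ H} + #{β ∈ 𝒢 | e ∈ G β} := by
      refine le_trans (card_le_card fun β hβ => ?_) (card_union_le _ _)
      obtain ⟨hβ, h⟩ := mem_filter.1 hβ
      by_cases he : e ∈ G β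
      · exact mem_union_right _ (mem_filter.2 ⟨hβ, he⟩)
      · exact mem_union_left _ (mem_filter.2 ⟨hβ, (subset_insert_iff_of_notMem he).1 h⟩)
    have h1' : f H ≤ f (insert e H) := by simp only [hf]; exact_mod_cast h1
    have h2' : f (insert e H) ≤ f H + c e := by simp only [hf, hc]; exact_mod_cast h2
    rw [abs_le]
    constructor <;> linarith [show 0 ≤ c e from Nat.cast_nonneg _]
  have hcmax : ∀ e ∈ complete n k, c e ≤ k * numLabels k * (q ^ k / q) := by
    intro e he
    have hek : #e = k := (mem_powersetCard.1 he).2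
    have hsub : {β ∈ 𝒢 | e ∈ G β} ⊆ (e ×ˢ (univ : Finset (NewLabel k))).biUnion
        fun w => {β : Fin k → F | newVal (fun j => (π (x j) : F)) β w.2 = π w.1} := by
      intro β hβ
      obtain ⟨hβ, he⟩ := mem_filter.1 hβ
      obtain ⟨v, hv, t, ht⟩ := (hab β hβ).exists_newVal he
      exact mem_biUnion.2 ⟨(v, t), by simp [hv], by simp [ht]⟩
    calc c e ≤ ∑ w ∈ e ×ˢ (univ : Finset (NewLabel k)),
          (#{β : Fin k → F | newVal (fun j => (π (x j) : F)) β w.2 = π w.1} : ℝ) := by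
          simp only [hc]
          exact_mod_cast (card_le_card hsub).trans card_biUnion_le
      _ ≤ ∑ w ∈ e ×ˢ (univ : Finset (NewLabel k)), (q ^ k / q) := by
          refine sum_le_sum fun w _ => ?_
          rw [le_div_iff₀ hq0, hq]
          exact_mod_cast card_newVal_eq_le (fun j => (π (x j) : F)) w.2 (π w.1 : F)
      _ = _ := by
          rw [sum_const, card_product, hek, nsmul_eq_mul]
          simp [numLabels]
  have hcsum : ∑ e ∈ complete n k, c e ≤ absorberSize k * q ^ k := by
    have h1 : ∑ e ∈ complete n k, #{β ∈ 𝒢 | e ∈ G β} ≤ #𝒢 * absorberSize k := by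
      have : ∑ e ∈ complete n k, #{β ∈ 𝒢 | e ∈ G β} =
          ∑ β ∈ 𝒢, #{e ∈ complete n k | e ∈ G β} := by
        simp only [card_filter]
        exact sum_comm
      rw [this]
      refine sum_le_card_nsmul _ _ _ fun β _ => ?_
      refine (card_le_card fun e he => ?_).trans (card_absorberGraph_le (x := x) (a := a β)
        (b := b β) hk)
      exact (mem_filter.1 he).2
    have h2 : #𝒢 ≤ Fintype.card F ^ k := (card_le_univ _).trans (by simp)
    have h3 : ∑ e ∈ complete n k, #{β ∈ 𝒢 | e ∈ G β} ≤ absorberSize k * Fintype.card F ^ k :=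
      h1.trans (by rw [mul_comm]; exact Nat.mul_le_mul_left _ h2)
    simp only [hc, hq]
    exact_mod_cast h3
  have hM0 : 0 < absorberSize k := by rcases hk with rfl | rfl <;> decide
  have hk0 : 0 < k := by omega
  have hl0 : 0 < numLabels k := by
    have : Nonempty (NewLabel k) := ⟨.inl ⟨0, hk0⟩⟩
    exact Fintype.card_pos
  have hmean : g * p ^ absorberSize k ≤ bernoulliSum (complete n k) p f := by
    have h1 : f = fun H => ∑ β ∈ 𝒢, if G β ⊆ H then (1 : ℝ) else 0 := by
      ext H
      simp [hf]
    rw [h1, bernoulliSum_sum]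
    calc g * p ^ absorberSize k ≤ #𝒢 * p ^ absorberSize k := by gcongr
      _ = ∑ β ∈ 𝒢, p ^ absorberSize k := by simp
      _ ≤ _ := by
        refine sum_le_sum fun β hβ => ?_
        rw [bernoulliSum_subset (absorberGraph_subset_complete
          ((hab β hβ).absorberVertex_injective (hgen β hβ) hx))]
        exact pow_le_pow_of_le_one hp0 hp1 (card_absorberGraph_le hk)
  have htail := bernoulliSum_lt_half_le (complete n k) hp0 hp1 c f hlip
    (m := g * p ^ absorberSize k)
    (v := k * numLabels k * absorberSize k * q ^ (2 * k) / q) (by positivity) hmean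
    (by positivity) (by
      calc ∑ e ∈ complete n k, c e ^ 2
          ≤ ∑ e ∈ complete n k, k * numLabels k * (q ^ k / q) * c e := by
            refine sum_le_sum fun e he => ?_
            rw [sq]
            exact mul_le_mul_of_nonneg_right (hcmax e he) (Nat.cast_nonneg _)
        _ = k * numLabels k * (q ^ k / q) * ∑ e ∈ complete n k, c e := by rw [mul_sum]
        _ ≤ k * numLabels k * (q ^ k / q) * (absorberSize k * q ^ k) := by gcongr
        _ = _ := by rw [two_mul, pow_add]; ring)
  refine le_trans (bernoulliSum_mono hp0 hp1 fun H _ => ?_) htail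
  -- each absorber comes from boundedly many tuples
  have hmult : f H ≤ ((absorberSize k * k) ^ k : ℕ) * (#(absorbers k π H (univ.image x)) : ℝ) := by
    have h1 : #{β ∈ 𝒢 | G β ⊆ H} ≤
        (absorberSize k * k) ^ k * #(absorbers k π H (univ.image x)) := by
      refine card_le_mul_card_image_of_maps_to (f := G) ?_ _ ?_
      · intro β hβ
        obtain ⟨hβ, hβH⟩ := mem_filter.1 hβ
        exact mem_absorbers.2 ⟨x, a β, b β, rfl,
          (hab β hβ).spansAbsorber (hgen β hβ) hx hβH, rfl⟩
      · intro A hA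
        obtain h0 | ⟨β₀, hβ₀⟩ := {β ∈ {β ∈ 𝒢 | G β ⊆ H} | G β = A}.eq_empty_or_nonempty
        · rw [h0]; simp
        have hAcard : #(A.biUnion id) ≤ absorberSize k * k := by
          rw [← (mem_filter.1 hβ₀).2]
          exact card_biUnion_absorberGraph_le hk
        calc _ ≤ #(Fintype.piFinset fun _ : Fin k => A.biUnion id) := by
              refine card_le_card_of_injOn a ?_ ?_
              · intro β hβ
                rw [mem_coe, Fintype.mem_piFinset]
                intro i
                rw [← (mem_filter.1 hβ).2]
                exact mem_biUnion_absorberGraph x (a β) (b β) i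
              · intro β hβ β' hβ' h
                have hβ := (mem_filter.1 (mem_filter.1 hβ).1).1
                have hβ' := (mem_filter.1 (mem_filter.1 hβ').1).1
                ext i
                rw [← (hab β hβ).spanning, ← (hab β' hβ').spanning, h]
          _ = #(A.biUnion id) ^ k := by simp
          _ ≤ _ := Nat.pow_le_pow_left hAcard k
    simp only [hf]
    exact_mod_cast h1
  split_ifs with h1 h2 h2
  · exact le_rfl
  · exact absurd (hmult.trans_lt h1) h2
  · exact zero_le_one
  · exact le_rfl

end RandomHypergraph

/-! ### Random injections and random hypergraphs -/

section Probability

open scoped Classical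

variable {n k : ℕ} {F : Type} [Field F] [Fintype F]

/-- Every edge, in every position under `π`, has at least `g` good tuples. -/
def HasManyGoodTuples (k : ℕ) (g : ℝ) (π : Fin n ↪ Fˣ) : Prop :=
  ∀ α : Fin k → F, Function.Injective α → (∀ i, α i ≠ 0) → g ≤ #(goodTuples π α)

/-- A uniformly random injection is very likely to give many good tuples. -/
lemma card_not_hasManyGoodTuples_le [CharP F 2] (hk : k = 3 ∨ k = 4) (hn : 2 * numLabels k ≤ n)
    (hF : Fintype.card F ≤ 4 * n)
    (hq : 2 * (numLabels k * numLabels k + numLabels k + numLabels k * k) ≤ Fintype.card F) :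
    (#{π : Fin n ↪ Fˣ | ¬ HasManyGoodTuples k
      ((Fintype.card F : ℝ) ^ k / (2 * 8 ^ numLabels k) / 2) π} : ℝ) ≤
      Fintype.card (Fin n ↪ Fˣ) * ((Fintype.card F : ℝ) ^ k * Real.exp
        (-(Fintype.card F / (1024 * (8 ^ numLabels k) ^ 2 * (numLabels k : ℝ) ^ 2)))) := by
  set q : ℝ := (Fintype.card F : ℝ) with hqdef
  have hq0 : 0 < q := by rw [hqdef]; exact_mod_cast Fintype.card_pos
  set l := numLabels k with hl
  have hl0 : (0 : ℝ) < l := by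
    have hk0 : 0 < k := by omega
    have : Nonempty (NewLabel k) := ⟨.inl ⟨0, hk0⟩⟩
    rw [hl]
    exact_mod_cast Fintype.card_pos (α := NewLabel k)
  set m : ℝ := q ^ k / (2 * 8 ^ l) with hm
  set ε : ℝ := Real.exp (-(q / (1024 * (8 ^ l) ^ 2 * (l : ℝ) ^ 2))) with hε
  have hunits : Fintype.card Fˣ ≤ Fintype.card F :=
    Fintype.card_le_of_injective _ Units.val_injective
  have htail : ∀ π : Fin n ↪ Fˣ, ∀ α : Fin k → F, Function.Injective α → (∀ i, α i ≠ 0) →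
      (#{σ : Equiv.Perm Fˣ | (#(goodTuples (π.trans σ.toEmbedding) α) : ℝ) < m / 2} : ℝ) ≤
        Fintype.card (Equiv.Perm Fˣ) * ε := by
    intro π α hα hα0
    have h := card_perm_lt_half_le
      (fun σ : Equiv.Perm Fˣ => (#(goodTuples (π.trans σ.toEmbedding) α) : ℝ))
      (c := 2 * l * (q ^ k / q)) (m := m) (v := 4 * q * (2 * l * (q ^ k / q)) ^ 2)
      (fun σ u v => abs_card_goodTuples_sub_le π α σ u v) (by positivity)
      (card_perm_mul_le_sum_card_goodTuples π hα (sum_compl_erase_ne_zero hk hα hα0) hn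
        (hunits.trans hF) hq) (by positivity) (by
          have : (Fintype.card Fˣ : ℝ) ≤ q := by rw [hqdef]; exact_mod_cast hunits
          gcongr)
    convert h using 3
    rw [hm]
    field_simp
    norm_num
  have hsum : ∀ π : Fin n ↪ Fˣ,
      (#{σ : Equiv.Perm Fˣ | ¬ HasManyGoodTuples k (m / 2) (π.trans σ.toEmbedding)} : ℝ) ≤
        Fintype.card (Equiv.Perm Fˣ) * (q ^ k * ε) := by
    intro π
    set Y : Finset (Fin k → F) := {α | Function.Injective α ∧ ∀ i, α i ≠ 0} with hY
    have hsub : ({σ : Equiv.Perm Fˣ |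
        ¬ HasManyGoodTuples k (m / 2) (π.trans σ.toEmbedding)} : Finset _) ⊆
        Y.biUnion fun α => {σ | (#(goodTuples (π.trans σ.toEmbedding) α) : ℝ) < m / 2} := by
      intro σ hσ
      simp only [mem_filter, mem_univ, true_and, HasManyGoodTuples, not_forall, not_le] at hσ
      obtain ⟨α, h1, h2, h3⟩ := hσ
      exact mem_biUnion.2 ⟨α, by simp [hY, h1, h2], by simpa using h3⟩
    have hYcard : (#Y : ℝ) ≤ q ^ k := by
      have : #Y ≤ Fintype.card F ^ k := (card_le_univ _).trans (by simp)
      rw [hqdef]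
      exact_mod_cast this
    calc _ ≤ ∑ α ∈ Y, (#{σ : Equiv.Perm Fˣ |
          (#(goodTuples (π.trans σ.toEmbedding) α) : ℝ) < m / 2} : ℝ) := by
          exact_mod_cast (card_le_card hsub).trans card_biUnion_le
      _ ≤ ∑ α ∈ Y, Fintype.card (Equiv.Perm Fˣ) * ε := by
          refine sum_le_sum fun α hα => ?_
          obtain ⟨h1, h2⟩ := (mem_filter.1 hα).2
          exact htail π α h1 h2
      _ = #Y * (Fintype.card (Equiv.Perm Fˣ) * ε) := by rw [sum_const, nsmul_eq_mul]
      _ ≤ q ^ k * (Fintype.card (Equiv.Perm Fˣ) * ε) := by gcongr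
      _ = _ := by ring
  -- a random injection may be composed with an independent random permutation of its values
  have hinv : ∀ σ : Equiv.Perm Fˣ,
      #{π : Fin n ↪ Fˣ | ¬ HasManyGoodTuples k (m / 2) (π.trans σ.toEmbedding)} =
        #{π : Fin n ↪ Fˣ | ¬ HasManyGoodTuples k (m / 2) π} := by
    intro σ
    refine card_nbij' (fun π => π.trans σ.toEmbedding) (fun π => π.trans σ.symm.toEmbedding)
      ?_ ?_ ?_ ?_
    · intro π hπ
      simpa using hπ
    · intro π hπ
      have : (π.trans σ.symm.toEmbedding).trans σ.toEmbedding = π := by ext; simp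
      simpa [this] using hπ
    · intro π _; ext; simp
    · intro π _; ext; simp
  have hdouble : Fintype.card (Equiv.Perm Fˣ) *
      #{π : Fin n ↪ Fˣ | ¬ HasManyGoodTuples k (m / 2) π} =
      ∑ π : Fin n ↪ Fˣ,
        #{σ : Equiv.Perm Fˣ | ¬ HasManyGoodTuples k (m / 2) (π.trans σ.toEmbedding)} := by
    rw [← Finset.card_univ, ← smul_eq_mul, ← sum_const, ← sum_congr rfl fun σ _ => hinv σ]
    simp only [card_filter]
    exact sum_comm
  have hperm : (0 : ℝ) < Fintype.card (Equiv.Perm Fˣ) := by exact_mod_cast Fintype.card_pos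
  refine le_of_mul_le_mul_left ?_ hperm
  calc (Fintype.card (Equiv.Perm Fˣ) : ℝ) *
      #{π : Fin n ↪ Fˣ | ¬ HasManyGoodTuples k (m / 2) π} =
      ∑ π : Fin n ↪ Fˣ,
        (#{σ : Equiv.Perm Fˣ | ¬ HasManyGoodTuples k (m / 2) (π.trans σ.toEmbedding)} : ℝ) := by
        exact_mod_cast hdouble
    _ ≤ ∑ π : Fin n ↪ Fˣ, Fintype.card (Equiv.Perm Fˣ) * (q ^ k * ε) :=
        sum_le_sum fun π _ => hsum π
    _ = _ := by
        rw [sum_const, nsmul_eq_mul, Finset.card_univ]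
        ring

/-- The union bound over the exceptional injections and, for the other ones, over the exceptional
hypergraphs. -/
lemma probInjHyp_le {p : ℝ} (hp0 : 0 ≤ p) (hp1 : p ≤ 1)
    (E : (Fin n ↪ Fˣ) → Hypergraph n → Prop) (Good : (Fin n ↪ Fˣ) → Prop) {ε₁ ε₂ : ℝ}
    (h0 : 0 ≤ ε₁) (h0' : 0 ≤ ε₂)
    (h1 : (#{π | ¬ Good π} : ℝ) ≤ Fintype.card (Fin n ↪ Fˣ) * ε₁)
    (h2 : ∀ π, Good π → bernoulliSum (complete n k) p (fun H => if E π H then 1 else 0) ≤ ε₂) :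
    probInjHyp n k F p E ≤ ε₁ + ε₂ := by
  have hinst : (Fintype.ofFinite (Fin n ↪ Fˣ)) = (inferInstance : Fintype (Fin n ↪ Fˣ)) :=
    Subsingleton.elim _ _
  rw [probInjHyp, hinst]
  refine div_le_of_le_mul₀ (Nat.cast_nonneg _) (by positivity) ?_
  have hinner : ∀ π : Fin n ↪ Fˣ, (∑ H ∈ (complete n k).powerset,
      if E π H then p ^ #H * (1 - p) ^ (#(complete n k) - #H) else 0) ≤
        (if ¬ Good π then 1 else 0) + ε₂ := by
    intro π
    have heq : (∑ H ∈ (complete n k).powerset,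
        if E π H then p ^ #H * (1 - p) ^ (#(complete n k) - #H) else 0) =
        bernoulliSum (complete n k) p (fun H => if E π H then 1 else 0) := by
      rw [bernoulliSum]
      exact sum_congr rfl fun H _ => by split_ifs <;> simp
    rw [heq]
    by_cases hG : Good π
    · simpa [hG] using h2 π hG
    · have : bernoulliSum (complete n k) p (fun H => if E π H then 1 else 0) ≤ 1 := by
        refine (bernoulliSum_mono hp0 hp1 (g := fun _ => 1) fun H _ => ?_).trans_eq
          (bernoulliSum_const _ _ _)
        split_ifs <;> norm_num
      simp only [hG, not_false_eq_true, if_true]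
      linarith
  refine (sum_le_sum fun π _ => hinner π).trans ?_
  rw [sum_add_distrib, sum_const, sum_boole, nsmul_eq_mul, Finset.card_univ]
  linarith

end Probability

/-- With very high probability, every edge has many absorbers. -/
theorem eventually_probInjHyp_not_manyAbsorbers_le {k : ℕ} (hk : k = 3 ∨ k = 4) {ε : ℝ}
    (hε : 0 < ε) (hε' : 2 * (absorberSize k : ℝ) * ε < 1) :
    ∃ c : ℝ, 0 < c ∧ ∀ D : ℝ, ∀ᶠ n : ℕ in atTop, ∀ (F : Type) [Field F] [Fintype F] [CharP F 2],
      n ≤ Fintype.card F → Fintype.card F ≤ 4 * n →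
      probInjHyp n k F ((n : ℝ) ^ (-ε)) (fun π H => ¬ ManyAbsorbers k c ε π H) ≤
        (n : ℝ) ^ (-D) := by
  classical
  obtain ⟨M, hM⟩ : ∃ M, M = absorberSize k := ⟨_, rfl⟩
  obtain ⟨l, hl⟩ : ∃ l, l = numLabels k := ⟨_, rfl⟩
  have hk0 : 0 < k := by omega
  have hM0 : 0 < M := by rw [hM]; rcases hk with rfl | rfl <;> decide
  have hl0 : 0 < l := by
    have : Nonempty (NewLabel k) := ⟨.inl ⟨0, hk0⟩⟩
    rw [hl]
    exact Fintype.card_pos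
  have hM0' : (0 : ℝ) < M := by exact_mod_cast hM0
  have hl0' : (0 : ℝ) < l := by exact_mod_cast hl0
  have hk0' : (0 : ℝ) < k := by exact_mod_cast hk0
  obtain ⟨R, hR⟩ : ∃ R : ℝ, R = ((absorberSize k * k) ^ k : ℕ) := ⟨_, rfl⟩
  have hR0 : 0 < R := by
    rw [hR, ← hM]
    exact_mod_cast pow_pos (Nat.mul_pos hM0 hk0) k
  obtain ⟨η, hη⟩ : ∃ η : ℝ, η = M * ε := ⟨_, rfl⟩
  have hη0 : 0 < η := by rw [hη]; positivity
  have hη1 : 0 < 1 - 2 * η := by rw [hη, hM]; linarith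
  obtain ⟨κ₁, hκ₁⟩ : ∃ κ : ℝ, κ = 1 / (1024 * (8 ^ l) ^ 2 * (l : ℝ) ^ 2) := ⟨_, rfl⟩
  obtain ⟨κ₂, hκ₂⟩ : ∃ κ : ℝ, κ = 1 / (256 * (8 ^ l) ^ 2 * (k * l * M)) := ⟨_, rfl⟩
  have hκ₁0 : 0 < κ₁ := by rw [hκ₁]; positivity
  have hκ₂0 : 0 < κ₂ := by rw [hκ₂]; positivity
  refine ⟨1 / (8 * 8 ^ l * R), by positivity, fun D => ?_⟩
  filter_upwards [eventually_mul_exp_neg_le one_pos hκ₁0 (k : ℝ) (D + 1),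
    eventually_mul_exp_neg_le hη1 hκ₂0 (k : ℝ) (D + 1), eventually_ge_atTop 1,
    eventually_ge_atTop (2 * l), eventually_ge_atTop (2 * (l * l + l + l * k)),
    eventually_ge_atTop (4 ^ k + 1)] with n ev1 ev2 hn1 hnl hnq hn4 F _ _ _ hq hq4
  have hn0 : (0 : ℝ) < n := by exact_mod_cast hn1
  obtain ⟨q, hqdef⟩ : ∃ q : ℝ, q = Fintype.card F := ⟨_, rfl⟩
  have hqn : (n : ℝ) ≤ q := by rw [hqdef]; exact_mod_cast hq
  have hqn4 : q ≤ 4 * n := by rw [hqdef]; exact_mod_cast hq4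
  have hq0 : 0 < q := hn0.trans_le hqn
  have hp0 : (0 : ℝ) ≤ (n : ℝ) ^ (-ε) := by positivity
  have hp1 : (n : ℝ) ^ (-ε) ≤ 1 :=
    Real.rpow_le_one_of_one_le_of_nonpos (by exact_mod_cast hn1) (by linarith)
  have hpM : ((n : ℝ) ^ (-ε)) ^ M = (n : ℝ) ^ (-η) := by
    rw [← Real.rpow_natCast, ← Real.rpow_mul hn0.le, hη]
    congr 1
    ring
  obtain ⟨g, hg⟩ : ∃ g : ℝ, g = q ^ k / (2 * 8 ^ l) / 2 := ⟨_, rfl⟩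
  have hg0 : 0 ≤ g := by rw [hg]; positivity
  have hbad := card_not_hasManyGoodTuples_le (n := n) (F := F) hk (hl ▸ hnl) hq4
    (by rw [← hl]; exact hnq.trans hq)
  rw [← hl, ← hqdef, ← hg] at hbad
  have hlast : (4 ^ k + 1) * (n : ℝ) ^ (-(D + 1)) ≤ (n : ℝ) ^ (-D) := by
    have h1 : (n : ℝ) ^ (-D) = n * (n : ℝ) ^ (-(D + 1)) := by
      nth_rewrite 2 [← Real.rpow_one (n : ℝ)]
      rw [← Real.rpow_add hn0]
      congr 1
      ring
    rw [h1]
    gcongr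
    exact_mod_cast hn4
  refine le_trans (probInjHyp_le hp0 hp1 _ (HasManyGoodTuples k g)
    (ε₁ := q ^ k * Real.exp (-(q / (1024 * (8 ^ l) ^ 2 * (l : ℝ) ^ 2))))
    (ε₂ := (n : ℝ) ^ k * Real.exp (-(κ₂ * (n : ℝ) ^ (1 - 2 * η))))
    (by positivity) (by positivity) hbad ?_) (le_trans ?_ hlast)
  · intro π hπ
    have hedge : ∀ e ∈ complete n k, bernoulliSum (complete n k) ((n : ℝ) ^ (-ε)) (fun H =>
        if R * (#(absorbers k π H e) : ℝ) < g * (n : ℝ) ^ (-η) / 2 then 1 else 0) ≤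
          Real.exp (-(κ₂ * (n : ℝ) ^ (1 - 2 * η))) := by
      intro e he
      have hek : #e = k := (mem_powersetCard.1 he).2
      set x : Fin k → Fin n := ⇑(e.orderEmbOfFin hek) with hx
      have hxinj : Function.Injective x := (e.orderEmbOfFin hek).injective
      have hxe : univ.image x = e := by
        rw [← coe_inj, coe_image, coe_univ, Set.image_univ]
        exact range_orderEmbOfFin e hek
      have h := bernoulliSum_card_absorbers_lt_le (π := π) hk hxinj hp0 hp1 hg0
        (hπ _ ((unit_val_injective π).comp hxinj) fun i => Units.ne_zero _)
      rw [hxe, ← hM, ← hl, ← hqdef, hpM, hM, ← hR] at h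
      refine h.trans (Real.exp_le_exp.2 (neg_le_neg ?_))
      rw [← hM]
      have h1 : (g * (n : ℝ) ^ (-η)) ^ 2 / (16 * (k * l * M * q ^ (2 * k) / q)) =
          κ₂ * (q * ((n : ℝ) ^ (-η)) ^ 2) := by
        rw [hg, hκ₂]
        field_simp
        ring
      have h2 : (n : ℝ) ^ (1 - 2 * η) = n * ((n : ℝ) ^ (-η)) ^ 2 := by
        rw [← Real.rpow_natCast, ← Real.rpow_mul hn0.le]
        nth_rewrite 2 [← Real.rpow_one (n : ℝ)]
        rw [← Real.rpow_add hn0]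
        congr 1
        push_cast
        ring
      rw [h1, h2]
      gcongr
    refine (bernoulliSum_mono hp0 hp1 (g := fun H => ∑ e ∈ complete n k,
      if R * (#(absorbers k π H e) : ℝ) < g * (n : ℝ) ^ (-η) / 2 then 1 else 0)
      fun H _ => ?_).trans ?_
    · by_cases hmany : ManyAbsorbers k (1 / (8 * 8 ^ l * R)) ε π H
      · rw [if_neg (not_not.2 hmany)]
        exact sum_nonneg fun e _ => by split_ifs <;> norm_num
      · rw [if_pos hmany]
        simp only [ManyAbsorbers, not_forall, not_le] at hmany
        obtain ⟨e, he, hlt⟩ := hmany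
        have hlt' : R * (#(absorbers k π H e) : ℝ) < g * (n : ℝ) ^ (-η) / 2 := by
          rw [← hM, ← hη] at hlt
          calc R * (#(absorbers k π H e) : ℝ)
              < R * (1 / (8 * 8 ^ l * R) * (n : ℝ) ^ ((k : ℝ) - η)) := by gcongr
            _ = (n : ℝ) ^ k / (2 * 8 ^ l) / 2 * (n : ℝ) ^ (-η) / 2 := by
                rw [sub_eq_add_neg, Real.rpow_add hn0, Real.rpow_natCast]
                field_simp
                norm_num
            _ ≤ _ := by rw [hg]; gcongr
        refine le_trans ?_ (single_le_sum (fun e _ => by split_ifs <;> norm_num) he)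
        rw [if_pos hlt']
    rw [bernoulliSum_sum]
    refine (sum_le_card_nsmul _ _ _ hedge).trans ?_
    rw [nsmul_eq_mul]
    gcongr
    rw [complete, card_powersetCard, card_univ, Fintype.card_fin]
    exact_mod_cast Nat.choose_le_pow _ _
  · rw [Real.rpow_natCast] at ev1 ev2
    rw [Real.rpow_one] at ev1
    have h1 : q ^ k * Real.exp (-(q / (1024 * (8 ^ l) ^ 2 * (l : ℝ) ^ 2))) ≤
        4 ^ k * ((n : ℝ) ^ k * Real.exp (-(κ₁ * n))) := by
      rw [← mul_assoc, ← mul_pow]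
      have h2 : κ₁ * n ≤ q / (1024 * (8 ^ l) ^ 2 * (l : ℝ) ^ 2) := by
        rw [hκ₁, one_div_mul_eq_div]
        gcongr
      gcongr
    have h4 : (0 : ℝ) < 4 ^ k := by positivity
    nlinarith

end RandomSteiner

theorem mainTheorem4 (k : ℕ) (hk : k = 3 ∨ k = 4) (ε : ℝ) (hε : 0 < ε)
    (hε' : 2 * (RandomSteiner.absorberSize k : ℝ) * ε < 1) :
    -- with very high probability every edge has many absorbers
    (∃ c : ℝ, 0 < c ∧ ∀ D : ℝ, ∀ᶠ n : ℕ in atTop, ∀ m : ℕ, 2 * n ≤ 2 ^ m → 2 ^ m ≤ 4 * n →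
      RandomSteiner.probInjHyp n k (GaloisField 2 m) ((n : ℝ) ^ (-ε))
        (fun π H => ¬ RandomSteiner.ManyAbsorbers k c ε π H) ≤ (n : ℝ) ^ (-D)) ∧
    -- given this, the algorithm succeeds with very high probability
    (∀ C δ c : ℝ, 0 < C → 0 < δ → 0 < c → 2 * (RandomSteiner.absorberSize k : ℝ) * ε < δ →
      ∀ D : ℝ, ∀ᶠ n : ℕ in atTop, ∀ m : ℕ, 2 * n ≤ 2 ^ m → 2 ^ m ≤ 4 * n →
      ∀ (π : Fin n ↪ (GaloisField 2 m)ˣ) (H : RandomSteiner.Hypergraph n),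
        H ⊆ RandomSteiner.complete n k → RandomSteiner.ManyAbsorbers k c ε π H →
      ∀ N : RandomSteiner.Hypergraph n, N ⊆ H → RandomSteiner.IsPartialDesign k N →
        RandomSteiner.FacetDisjoint k N (RandomSteiner.template π H) →
        RandomSteiner.AffineBounded (k - 1) C
          (RandomSteiner.vectorImage (k - 1) π (RandomSteiner.leave k π H N)) →
        RandomSteiner.density (k - 1) (RandomSteiner.leave k π H N) ≤ (n : ℝ) ^ (-δ) →
      ∀ s : List (Finset (Fin n)), s.Nodup →
        RandomSteiner.IsDecomposition k s.toFinset (RandomSteiner.leave k π H N) →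
        (RandomSteiner.greedy k π H s).toOuterMeasure (RandomSteiner.greedySuccess k π H s)ᶜ ≤
          ENNReal.ofReal ((n : ℝ) ^ (-D))) := by
  have hfield : ∀ n m : ℕ, 1 ≤ n → 2 * n ≤ 2 ^ m → ∀ [Fintype (GaloisField 2 m)],
      Fintype.card (GaloisField 2 m) = 2 ^ m := by
    intro n m hn hm _
    have hm0 : m ≠ 0 := by
      rintro rfl
      simp at hm
      omega
    rw [← Nat.card_eq_fintype_card, GaloisField.card 2 m hm0]
  have hM0 : (0 : ℝ) < RandomSteiner.absorberSize k := by
    have : 0 < RandomSteiner.absorberSize k := by rcases hk with rfl | rfl <;> decide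
    exact_mod_cast this
  constructor
  · obtain ⟨c, hc, h⟩ := RandomSteiner.eventually_probInjHyp_not_manyAbsorbers_le hk hε hε'
    refine ⟨c, hc, fun D => ?_⟩
    filter_upwards [h D, eventually_ge_atTop 1] with n hn hn1 m hm hm4
    let _ := Fintype.ofFinite (GaloisField 2 m)
    have hcard := hfield n m hn1 hm
    exact hn (GaloisField 2 m) (by omega) (by omega)
  · intro C δ c hC _ hc hδ D
    have hpos := mul_pos hM0 hε
    obtain ⟨d, rfl⟩ : ∃ d, k = d + 1 := ⟨k - 1, by omega⟩
    filter_upwards [RandomSteiner.eventually_greedy_failure_le d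
      (η := RandomSteiner.absorberSize (d + 1) * ε) (δ := δ) (by linarith) (by linarith) hC hc D,
      eventually_ge_atTop (max 1 d)] with n hn hn1 m hm hm4 π H _ hmany N _ _ _ hL hdens s hs hS
    let _ := Fintype.ofFinite (GaloisField 2 m)
    have hcard := hfield n m (le_of_max_le_left hn1) hm
    refine hn (GaloisField 2 m) (by omega) (by omega) π H hmany _ (fun f hf => ?_) hL ?_ s hs hS
    · exact (mem_powersetCard.1 (mem_sdiff.1 hf).1).2
    · have hchoose : (0 : ℝ) < (n.choose d : ℝ) := by
        exact_mod_cast Nat.choose_pos (le_of_max_le_right hn1)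
      rw [RandomSteiner.density, Nat.add_sub_cancel, div_le_iff₀ hchoose] at hdens
      refine hdens.trans ?_
      gcongr
      exact_mod_cast Nat.choose_le_pow _ _
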